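/- Let $I\subseteq\mathbb R$ be a nonempty open interval and $D\subseteq\mathbb R^3$ a nonempty open convex set (for instance $I=\mathbb R$, $D=\mathbb R^3$). Consider the class of systems $$A^i_t=0,\qquad \Phi_t=0,\qquad \ddot x^i-\dot x^j\,(A^j_{x^i}-A^i_{x^j})+\Phi_{x^i}=0\qquad(i=1,2,3),\tag{1}$$ whose arbitrary elements are the smooth potentials $\boldsymbol A:D\to\mathbb R^3$ and $\Phi:D\to\mathbb R$, for motions $\boldsymbol x(t)\in D$, $t\in I$. An *equivalence transformation* of the class is an invertible smooth point transformation $(t,\boldsymbol x)\mapsto(\tilde t,\tilde{\boldsymbol x})$, $(t,\boldsymbol x,\boldsymbol A,\Phi)\mapsto(\tilde{\boldsymbol A},\tilde\Phi)$ defined on $I\times D\times\mathbb R^3\times\mathbb R$ that maps every member of the class to a member of the class: for all smooth $\boldsymbol A,\Phi$ on $D$ there are smooth time-independent potentials on the set of transformed positions whose graph contains the image of the graph of $(\boldsymbol A,\Phi)$, and whenever the image of the graph of a solution of the first system is the graph of a function, this function is a solution of the second system. An *equivalence generator* is a smooth vector field $$\mathbf V=\xi(t,\boldsymbol x)\,\partial_t+\eta^i(t,\boldsymbol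 x)\,\partial_{x^i}+\mu^i(t,\boldsymbol x,\boldsymbol A,\Phi)\,\partial_{A^i}+\nu(t,\boldsymbol x,\boldsymbol A,\Phi)\,\partial_\Phi$$ on $I\times D\times\mathbb R^3\times\mathbb R$ whose prolongation (to second-order derivatives of $\boldsymbol x(t)$ and first-order derivatives of $\boldsymbol A,\Phi$ with respect to $(t,\boldsymbol x)$) annihilates the left-hand sides of (1) whenever (1) holds. **Theorem.** (a) The equivalence transformations of the class are exactly the transformations $$\tilde t=\epsilon_8t+\epsilon_0,\qquad \tilde{\boldsymbol x}=\epsilon_7R\boldsymbol x+\boldsymbol\epsilon,\qquad \tilde{\boldsymbol A}=\epsilon_7\epsilon_8^{-1}R\boldsymbol A+(\nabla g)(\tilde{\boldsymbol x}),\qquad \tilde\Phi=\epsilon_7^2\epsilon_8^{-2}\Phi+\epsilon_9,\tag{2}$$ with $R=R_1(\epsilon_6)R_2(\epsilon_5)R_3(\epsilon_4)$, where $\epsilon_0,\dots,\epsilon_9$ are arbitrary real constants with $\epsilon_7,\epsilon_8\neq0$, $\boldsymbol\epsilon=(\epsilon_1,\epsilon_2,\epsilon_3)$, $R_i(\theta)$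 is the rotation by the angle $\theta$ about the $x^i$-axis, and $g$ is an arbitrary smooth function of the new position $\tilde{\boldsymbol x}$. For $I=\mathbb R$, $D=\mathbb R^3$ the transformations (2) form a group. (b) The equivalence generators form a Lie algebra under the Lie bracket, and each of them can be written as $\sum_{i=0}^9c_i\mathbf V_i+\mathbf V_f$ with a unique $(c_0,\dots,c_9)\in\mathbb R^{10}$ and a smooth function $f$ on $D$; conversely all these fields are equivalence generators. Here $$\begin{aligned} \mathbf V_0&=\partial_t,\quad \mathbf V_1=\partial_x,\quad \mathbf V_2=\partial_y,\quad \mathbf V_3=\partial_z,\\ \mathbf V_4&=x\partial_y-y\partial_x+A^1\partial_{A^2}-A^2\partial_{A^1},\\ \mathbf V_5&=z\partial_x-x\partial_z+A^3\partial_{A^1}-A^1\partial_{A^3},\\ \mathbf V_6&=y\partial_z-z\partial_y+A^2\partial_{A^3}-A^3\partial_{A^2},\\ \mathbf V_7&=x\partial_x+y\partial_y+z\partial_z+A^1\partial_{A^1}+A^2\partial_{A^2}+A^3\partial_{A^3}+2\Phi\partial_\Phi,\\ \mathbf V_8&=t\partial_t-A^1\partial_{A^1}-A^2\partial_{A^2}-A^3\partial_{A^3}-2\Phi\partial_\Phi,\\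 \mathbf V_9&=\partial_\Phi,\qquad \mathbf V_f=\nabla f\cdot\partial_{\boldsymbol A}. \end{aligned}$$ The fields $\mathbf V_0,\dots,\mathbf V_9$ are linearly independent and span a ten-dimensional Lie subalgebra; the fields $\mathbf V_f$ form an infinite-dimensional part, and the bracket of any equivalence generator with a $\mathbf V_f$ is again of this form. (c) The transformation (2) with $\epsilon_7=\epsilon_8=1$, all other $\epsilon_i=0$ and $g=0$ is the identity. There $\mathbf V_i$ is the derivative of (2) with respect to the parameter $\epsilon_i$ $(i=0,\dots,9)$, and $\mathbf V_f$ is the derivative at $s=0$ of (2) with $g=sf$. -/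

import Mathlib

open scoped ContDiff

noncomputable section

namespace ChargedParticle

/-- Euclidean three-space. -/
abbrev E3 := EuclideanSpace ℝ (Fin 3)

/-- The space of the variables `(t, x)`. -/
abbrev Base := ℝ × E3

/-- The space of the values `(A, Φ)` of the potentials. -/
abbrev Fib := E3 × ℝ

/-- The augmented space of the variables `((t, x), (A, Φ))`. -/
abbrev Aug := Base × Fib

/-- The standard basis vectors of Euclidean three-space. -/
abbrev e (i : Fin 3) : E3 := EuclideanSpace.single i 1

/-- The part of the augmented space that lies over `t ∈ I`, `x ∈ D`;
the values `(A, Φ)` are unrestricted. -/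
def augDomain (I : Set ℝ) (D : Set E3) : Set Aug := (I ×ˢ D) ×ˢ Set.univ

/-! ### The class of systems -/

/-- The acceleration `ẋʲ (Aʲ_{xⁱ} - Aⁱ_{xʲ}) - Φ_{xⁱ}` at position `x` and velocity `v`
for the time-independent potentials `A`, `Φ`. -/
def acceleration (A : E3 → E3) (Φ : E3 → ℝ) (x v : E3) : E3 :=
  WithLp.toLp 2 fun i =>
    ∑ j, v j * ((fderiv ℝ A x (e i)) j - (fderiv ℝ A x (e j)) i) - fderiv ℝ Φ x (e i)

/-- The motion `x` solves the equations of motion with potentials `A`, `Φ` at all times in `J`. -/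
def IsSolution (A : E3 → E3) (Φ : E3 → ℝ) (J : Set ℝ) (x : ℝ → E3) : Prop :=
  ∃ v : ℝ → E3, ∀ t ∈ J,
    HasDerivAt x (v t) t ∧ HasDerivAt v (acceleration A Φ (x t) (v t)) t

/-! ### Equivalence transformations -/

/-- `Ψ(t, x, A, Φ) = (T(t, x), U(t, x, A, Φ))` is an invertible smooth point transformation,
over `t ∈ I`, `x ∈ D`, of the augmented space. -/
structure IsPointTransformation (I : Set ℝ) (D : Set E3) (T : Base → Base) (U : Aug → Fib) :
    Prop where
  smooth : ContDiffOn ℝ ∞ (fun p : Aug => (T p.1, U p)) (augDomain I D)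
  injOn_base : Set.InjOn T (I ×ˢ D)
  injOn : Set.InjOn (fun p : Aug => (T p.1, U p)) (augDomain I D)
  nondegenerate : ∀ p ∈ augDomain I D,
    Function.Bijective (fderiv ℝ (fun p : Aug => (T p.1, U p)) p)

/-- The point transformation `(T, U)` maps the member of the class with potentials `A`, `Φ`
on `D` to the member with potentials `A'`, `Φ'` on the set of transformed positions:
it takes the graph of `(A, Φ)` to that of `(A', Φ')`, and whenever it takes the graph of a
solution `x` of the first system to the graph of a function `y`, then `y` is a solution of the
second system. -/
structure MapsMember (I : Set ℝ) (D : Set E3) (T : Base → Base) (U : Aug → Fib)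
    (A : E3 → E3) (Φ : E3 → ℝ) (A' : E3 → E3) (Φ' : E3 → ℝ) : Prop where
  smooth_vector : ContDiffOn ℝ ∞ A' ((fun q => (T q).2) '' (I ×ˢ D))
  smooth_scalar : ContDiffOn ℝ ∞ Φ' ((fun q => (T q).2) '' (I ×ˢ D))
  potentials : ∀ t ∈ I, ∀ x ∈ D,
    U ((t, x), (A x, Φ x)) = (A' (T (t, x)).2, Φ' (T (t, x)).2)
  solutions : ∀ (J J' : Set ℝ) (x y : ℝ → E3), IsOpen J → IsOpen J' → J ⊆ I →
    (∀ t ∈ J, x t ∈ D) → IsSolution A Φ J x →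
    T '' (J.graphOn x) = J'.graphOn y → IsSolution A' Φ' J' y

/-- `Ψ` is an equivalence transformation of the class over `t ∈ I`, `x ∈ D`: a point
transformation of the augmented space, acting on `(t, x)` independently of `(A, Φ)`, which maps
every member of the class to a member of the class. -/
def IsEquivalenceTransformation (I : Set ℝ) (D : Set E3) (Ψ : Aug → Aug) : Prop :=
  ∃ (T : Base → Base) (U : Aug → Fib),
    Set.EqOn Ψ (fun p => (T p.1, U p)) (augDomain I D) ∧
    IsPointTransformation I D T U ∧
    ∀ (A : E3 → E3) (Φ : E3 → ℝ), ContDiffOn ℝ ∞ A D → ContDiffOn ℝ ∞ Φ D →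
      ∃ (A' : E3 → E3) (Φ' : E3 → ℝ), MapsMember I D T U A Φ A' Φ'

/-! ### The explicit transformations -/

/-- Rotation about the first axis. -/
def rot1 (θ : ℝ) : Matrix (Fin 3) (Fin 3) ℝ :=
  !![1, 0, 0; 0, Real.cos θ, -Real.sin θ; 0, Real.sin θ, Real.cos θ]

/-- Rotation about the second axis. -/
def rot2 (θ : ℝ) : Matrix (Fin 3) (Fin 3) ℝ :=
  !![Real.cos θ, 0, Real.sin θ; 0, 1, 0; -Real.sin θ, 0, Real.cos θ]

/-- Rotation about the third axis. -/
def rot3 (θ : ℝ) : Matrix (Fin 3) (Fin 3) ℝ :=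
  !![Real.cos θ, -Real.sin θ, 0; Real.sin θ, Real.cos θ, 0; 0, 0, 1]

/-- The linear map `R₁(ε₆) R₂(ε₅) R₃(ε₄)`. -/
def eulerRotation (ε : Fin 10 → ℝ) : E3 →ₗ[ℝ] E3 :=
  Matrix.toEuclideanLin (rot1 (ε 6) * rot2 (ε 5) * rot3 (ε 4))

/-- The transformation `x ↦ ε₇ R₁(ε₆) R₂(ε₅) R₃(ε₄) x + (ε₁, ε₂, ε₃)` of space. -/
def spaceMap (ε : Fin 10 → ℝ) (x : E3) : E3 :=
  ε 7 • eulerRotation ε x + !₂[ε 1, ε 2, ε 3]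

/-- The transformation with parameters `ε₀, …, ε₉` and gauge function `g`. The gradient of `g` is
taken with respect to the new position, and evaluated there. -/
def groupMap (ε : Fin 10 → ℝ) (g : E3 → ℝ) (p : Aug) : Aug :=
  ((ε 8 * p.1.1 + ε 0, spaceMap ε p.1.2),
   ((ε 7 * (ε 8)⁻¹) • eulerRotation ε p.2.1 + gradient g (spaceMap ε p.1.2),
    ε 7 ^ 2 * (ε 8 ^ 2)⁻¹ * p.2.2 + ε 9))

/-- The set of all the transformations, on the whole augmented space. -/
def transformations : Set (Aug → Aug) :=
  {Ψ | ∃ (ε : Fin 10 → ℝ) (g : E3 → ℝ), ε 7 ≠ 0 ∧ ε 8 ≠ 0 ∧ ContDiff ℝ ∞ g ∧ Ψ = groupMap ε g}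

/-- The parameters of the identity transformation. -/
def idParam : Fin 10 → ℝ := ![0, 0, 0, 0, 0, 0, 0, 1, 1, 0]

/-! ### The infinitesimal criterion -/

/-- The space of the variables `((t, x), (A, Φ))`, `(ẋ, ẍ)` and the first derivatives of `(A, Φ)`
with respect to `(t, x)`, the latter as a linear map `P`: thus `P (1, 0) = (A_t, Φ_t)` and
`P (0, e j) = (A_{xʲ}, Φ_{xʲ})`. -/
abbrev Jet := Aug × (E3 × E3) × (Base →L[ℝ] Fib)

/-- The left-hand sides of the auxiliary equations `A_t = 0`, `Φ_t = 0`. -/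
def auxEq (j : Jet) : Fib := j.2.2 (1, 0)

/-- The left-hand sides of the primary equations
`ẍⁱ - ẋʲ (Aʲ_{xⁱ} - Aⁱ_{xʲ}) + Φ_{xⁱ} = 0`. -/
def primEq (j : Jet) : E3 :=
  WithLp.toLp 2 fun i =>
    j.2.1.2 i - ∑ k, j.2.1.1 k * ((j.2.2 (0, e i)).1 k - (j.2.2 (0, e k)).1 i)
      + (j.2.2 (0, e i)).2

/-- First prolongation coefficient `D_t η - ẋ D_t ξ` for `b = (ξ, η)`, as a function of
`((t, x), ẋ)`. -/
def prolong1 (b : Base → Base) (s : Base × E3) : E3 :=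
  (fderiv ℝ b s.1 (1, s.2)).2 - (fderiv ℝ b s.1 (1, s.2)).1 • s.2

/-- Second prolongation coefficient `D_t η⁽¹⁾ - ẍ D_t ξ`. -/
def prolong2 (b : Base → Base) (q : Base) (v w : E3) : E3 :=
  fderiv ℝ (prolong1 b) (q, v) ((1, v), w) - (fderiv ℝ b q (1, v)).1 • w

/-- Prolongation coefficients of the first derivatives of `(A, Φ)`, for `b = (ξ, η)`, `c = (μ, ν)`:
in the direction `h` of the `(t, x)`-space these are `D_h c - P (∂_h b)`, where `D_h` is the total
derivative. -/
def prolongFib (b : Base → Base) (c : Aug → Fib) (z : Aug) (P : Base →L[ℝ] Fib) :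
    Base →L[ℝ] Fib :=
  (fderiv ℝ c z).comp ((ContinuousLinearMap.id ℝ Base).prod P) - P.comp (fderiv ℝ b z.1)

/-- The prolongation `V^(2,1)` of the vector field
`V = ξ(t,x) ∂_t + η(t,x) · ∂_x + μ(t,x,A,Φ) · ∂_A + ν(t,x,A,Φ) ∂_Φ`. -/
def prolongation (b : Base → Base) (c : Aug → Fib) (j : Jet) : Jet :=
  ((b j.1.1, c j.1),
   (prolong1 b (j.1.1, j.2.1.1), prolong2 b j.1.1 j.2.1.1 j.2.1.2),
   prolongFib b c j.1 j.2.2)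

/-- `V` is an infinitesimal generator of equivalence transformations over `t ∈ I`, `x ∈ D`:
a smooth vector field whose `(t, x)`-components depend on `(t, x)` only, and whose prolongation
annihilates the equations of the class whenever these equations hold. -/
def IsEquivalenceGenerator (I : Set ℝ) (D : Set E3) (V : Aug → Aug) : Prop :=
  ∃ (b : Base → Base) (c : Aug → Fib),
    Set.EqOn V (fun p => (b p.1, c p)) (augDomain I D) ∧
    ContDiffOn ℝ ∞ b (I ×ˢ D) ∧ ContDiffOn ℝ ∞ c (augDomain I D) ∧
    ∀ j : Jet, j.1 ∈ augDomain I D → auxEq j = 0 → primEq j = 0 →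
      fderiv ℝ auxEq j (prolongation b c j) = 0 ∧ fderiv ℝ primEq j (prolongation b c j) = 0

/-- Infinitesimal rotation about the third axis. -/
def infRot4 (x : E3) : E3 := !₂[-x 1, x 0, 0]

/-- Infinitesimal rotation about the second axis. -/
def infRot5 (x : E3) : E3 := !₂[x 2, 0, -x 0]

/-- Infinitesimal rotation about the first axis. -/
def infRot6 (x : E3) : E3 := !₂[0, -x 2, x 1]

/-- The vector fields `V₀, …, V₉`. -/
def basisField (i : Fin 10) (p : Aug) : Aug :=
  ![((1, 0), (0, 0)),
    ((0, e 0), (0, 0)),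
    ((0, e 1), (0, 0)),
    ((0, e 2), (0, 0)),
    ((0, infRot4 p.1.2), (infRot4 p.2.1, 0)),
    ((0, infRot5 p.1.2), (infRot5 p.2.1, 0)),
    ((0, infRot6 p.1.2), (infRot6 p.2.1, 0)),
    ((0, p.1.2), (p.2.1, 2 * p.2.2)),
    ((p.1.1, 0), (-p.2.1, -(2 * p.2.2))),
    ((0, 0), (0, 1))] i

/-- The vector field `V_f = ∇f · ∂_A`. -/
def gaugeField (f : E3 → ℝ) (p : Aug) : Aug := ((0, 0), (gradient f p.1.2, 0))

end ChargedParticle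

end

open ChargedParticle

noncomputable section

namespace ChargedParticle

open scoped InnerProductSpace Topology
open Set Filter

/-! ### The augmented domain -/

section Domain

variable {I : Set ℝ} {D : Set E3}

/-! Both halves of the classification rest on one device: every first-order jet `(a, P)` of
potentials at a point may be prescribed freely, and the force depends on the jet only through
`⟪force P v, w⟫ = ⟪(P w).1, v⟫ - ⟪(P v).1, w⟫ - (P w).2`, an electric part plus a part linear and
skew in the velocity. For transformations the jets are realised by affine potentials, whose force
does not depend on the position; for generators they are coordinates of the jet space.

For a transformation `(T, U)`, injectivity together with the freedom in the values of the potentials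
forces the new position to determine the old one (`eq_of_space_eq`). The kernel of the derivative of
the new position is then the time direction, so the new position does not depend on `t`. The
transformed equations of motion, cleared of a denominator, are a cubic polynomial in the speed, and
its coefficients vanish separately (`transformed_coefficients`). Pairing the linear coefficient with
the new velocity removes the unknown new magnetic force, and the constant coefficient removes the
unknown new electric force. In what remains, a zero field, an electric field along `v` and a
magnetic field deflecting `v` show in turn that the new time is affine in `t`, that it does not
depend on `x`, and that the space derivative preserves orthogonality. The quadratic coefficient
makes the new position affine. Hence space undergoes a conformal affine map, that is, a multiple of
a rotation followed by a translation; the dimension being odd, a reflection is absorbed into the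
sign of the factor.

The same coefficients constrain the potentials. After subtraction of the expected linear terms, the
scalar component has vanishing total derivatives and is constant; the vector component, pulled back
to the old position, has symmetric total derivatives for every jet and is a gradient by the Poincaré
lemma (`exists_gradient_of_totalDeriv_symm`). Conversely, scaled rotations and translations carry
forces to forces, and a gradient adds none because second derivatives commute.

The generators obey the linearised version of this argument (`criterion_coefficients`): the
coefficient identities yield an affine field on the `(t, x)`-space whose space part is a skew map
plus a multiple of the identity. The data are collected in `FieldData`, where Lie brackets become
commutators and the gauge fields form an ideal. -/

theorem mem_augDomain {p : Aug} : p ∈ augDomain I D ↔ p.1.1 ∈ I ∧ p.1.2 ∈ D := by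
  simp [augDomain, Set.mem_prod]

theorem isOpen_augDomain (hI : IsOpen I) (hD : IsOpen D) : IsOpen (augDomain I D) :=
  (hI.prod hD).prod isOpen_univ

theorem isPreconnected_base (hI : IsPreconnected I) (hD : Convex ℝ D) :
    IsPreconnected (I ×ˢ D) :=
  hI.prod hD.isPreconnected

theorem isPreconnected_augDomain (hI : IsPreconnected I) (hD : Convex ℝ D) :
    IsPreconnected (augDomain I D) :=
  (isPreconnected_base hI hD).prod isPreconnected_univ

end Domain

/-! ### The force exerted by a first-order jet of potentials -/

/-- The acceleration at velocity `v`, for potentials with derivative `P` at the position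
considered. -/
def force (P : E3 →L[ℝ] Fib) (v : E3) : E3 :=
  WithLp.toLp 2 fun i => ∑ j, v j * ((P (e i)).1 j - (P (e j)).1 i) - (P (e i)).2

theorem eq_sum_basis (w : E3) : w = w 0 • e 0 + w 1 • e 1 + w 2 • e 2 := by
  ext i
  fin_cases i <;> simp [e]

/-- Testing against `w` exposes the alternating derivative of the vector potential. Force identities
below are mostly proved in this coordinate-free form. -/
theorem inner_force (P : E3 →L[ℝ] Fib) (v w : E3) :
    ⟪force P v, w⟫_ℝ = ⟪(P w).1, v⟫_ℝ - ⟪(P v).1, w⟫_ℝ - (P w).2 := by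
  have hw : P w = w 0 • P (e 0) + w 1 • P (e 1) + w 2 • P (e 2) := by
    conv_lhs => rw [eq_sum_basis w]
    simp only [map_add, map_smul]
  have hv : P v = v 0 • P (e 0) + v 1 • P (e 1) + v 2 • P (e 2) := by
    conv_lhs => rw [eq_sum_basis v]
    simp only [map_add, map_smul]
  rw [hw, hv]
  simp only [force, PiLp.inner_apply, Fin.sum_univ_three, RCLike.inner_apply, conj_trivial,
    Prod.fst_add, Prod.snd_add, Prod.smul_fst, Prod.smul_snd, PiLp.add_apply, PiLp.smul_apply,
    smul_eq_mul]
  ring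

theorem acceleration_eq_force (A : E3 → E3) (Φ : E3 → ℝ) (x v : E3) :
    acceleration A Φ x v = force ((fderiv ℝ A x).prod (fderiv ℝ Φ x)) v := rfl

theorem primEq_eq_force (j : Jet) :
    primEq j = j.2.1.2 - force (j.2.2.comp (ContinuousLinearMap.inr ℝ ℝ E3)) j.2.1.1 := by
  ext i
  simp [primEq, force]
  ring

/-- The part of the force that is linear in the velocity. -/
def magForce (P : E3 →L[ℝ] Fib) (v : E3) : E3 := force P v - force P 0

theorem inner_force_zero (P : E3 →L[ℝ] Fib) (w : E3) : ⟪force P 0, w⟫_ℝ = - (P w).2 := by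
  simp [inner_force]

theorem inner_magForce (P : E3 →L[ℝ] Fib) (v w : E3) :
    ⟪magForce P v, w⟫_ℝ = ⟪(P w).1, v⟫_ℝ - ⟪(P v).1, w⟫_ℝ := by
  rw [magForce, inner_sub_left, inner_force, inner_force_zero]
  ring

theorem inner_magForce_self (P : E3 →L[ℝ] Fib) (v : E3) : ⟪magForce P v, v⟫_ℝ = 0 := by
  rw [inner_magForce, sub_self]

theorem inner_magForce_swap (P : E3 →L[ℝ] Fib) (v w : E3) :
    ⟪magForce P v, w⟫_ℝ = - ⟪v, magForce P w⟫_ℝ := by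
  rw [real_inner_comm (magForce P w), inner_magForce, inner_magForce]
  ring

theorem magForce_smul (P : E3 →L[ℝ] Fib) (s : ℝ) (v : E3) :
    magForce P (s • v) = s • magForce P v := by
  refine ext_inner_right ℝ fun w => ?_
  rw [inner_smul_left, inner_magForce, inner_magForce]
  simp only [map_smul, Prod.smul_fst, inner_smul_left, inner_smul_right, conj_trivial]
  ring

theorem force_eq (P : E3 →L[ℝ] Fib) (v : E3) : force P v = magForce P v + force P 0 := by
  rw [magForce, sub_add_cancel]

theorem force_smul (P : E3 →L[ℝ] Fib) (s : ℝ) (v : E3) :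
    force P (s • v) = s • magForce P v + force P 0 := by
  rw [force_eq, magForce_smul]

/-- A jet of potentials with purely electric force `E`. -/
def electricJet (E : E3) : E3 →L[ℝ] Fib := (0 : E3 →L[ℝ] E3).prod (-(innerSL ℝ E))

theorem magForce_electricJet (E v : E3) : magForce (electricJet E) v = 0 := by
  refine ext_inner_right ℝ fun w => ?_
  rw [inner_magForce]
  simp [electricJet]

theorem force_electricJet (E v : E3) : force (electricJet E) v = E := by
  refine ext_inner_right ℝ fun w => ?_
  rw [inner_force]
  simp [electricJet]

/-- A jet of potentials with vanishing electric force, whose magnetic force at velocity `v` is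
`u` if `u` is orthogonal to `v`. -/
def magneticJet (u v : E3) : E3 →L[ℝ] Fib :=
  -- The derivative of `A` is `w ↦ ⟪u, w⟫ v / ‖v‖²`; pairing it with `v` returns `⟪u, w⟫`, and the
  -- transposed term contains `⟪u, v⟫`.
  ((innerSL ℝ u).smulRight ((‖v‖ ^ 2)⁻¹ • v)).prod 0

theorem magForce_magneticJet {u v : E3} (hv : v ≠ 0) (h : ⟪u, v⟫_ℝ = 0) :
    magForce (magneticJet u v) v = u := by
  have hv' : ‖v‖ ≠ 0 := norm_ne_zero_iff.2 hv
  refine ext_inner_right ℝ fun w => ?_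
  rw [inner_magForce]
  simp [magneticJet, inner_smul_left, h]
  field_simp

theorem force_magneticJet_zero (u v : E3) : force (magneticJet u v) 0 = 0 := by
  refine ext_inner_right ℝ fun w => ?_
  rw [inner_force]
  simp [magneticJet]

/-! ### Calculus -/

theorem two_le_infty : minSmoothness ℝ 2 ≤ (∞ : ℕ∞ω) := by
  rw [minSmoothness_of_isRCLikeNormedField]
  exact WithTop.coe_le_coe.2 (le_top : (2 : ℕ∞) ≤ ⊤)

/-- Applied with `f` a first derivative: a component that is constant near `x` has vanishing
derivative in every direction, which turns first-order identities into statements on second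
derivatives. -/
theorem clm_fderiv_eq_zero {E F G : Type*} [NormedAddCommGroup E] [NormedSpace ℝ E]
    [NormedAddCommGroup F] [NormedSpace ℝ F] [NormedAddCommGroup G] [NormedSpace ℝ G]
    {f : E → F} {x : E} (hf : DifferentiableAt ℝ f x) (ψ : F →L[ℝ] G) {c : G}
    (h : ∀ᶠ y in 𝓝 x, ψ (f y) = c) (u : E) : ψ (fderiv ℝ f x u) = 0 := by
  have h1 : HasFDerivAt (fun y => ψ (f y)) (ψ.comp (fderiv ℝ f x)) x :=
    ψ.hasFDerivAt.comp x hf.hasFDerivAt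
  have h2 : HasFDerivAt (fun y => ψ (f y)) (0 : E →L[ℝ] G) x :=
    (hasFDerivAt_const c x).congr_of_eventuallyEq h
  have := DFunLike.congr_fun (h1.unique h2) u
  simpa using this

/-- A jet of potentials with a prescribed value at a nonzero vector. -/
theorem exists_clm_apply_eq {F : Type*} [NormedAddCommGroup F] [NormedSpace ℝ F] (i : Fin 3)
    (a : F) : ∃ P : E3 →L[ℝ] F, ∀ u, P u = u i • a := by
  refine ⟨(EuclideanSpace.proj i : E3 →L[ℝ] ℝ).smulRight a, fun u => ?_⟩
  simp

/-! ### Functions whose total derivatives are constrained for every jet -/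

section TotalDerivative

variable {I : Set ℝ} {D : Set E3}

/-- The choice `P = 0` isolates the derivatives in `x`; a `P` with prescribed value at `e 0` then
isolates those in `(A, Φ)`. All partial derivatives vanish on a connected domain. -/
theorem exists_const_of_totalDeriv_eq_zero (hI : IsOpen I) (hIc : IsPreconnected I)
    (hD : IsOpen D) (hDc : Convex ℝ D) {W : Aug → ℝ}
    (hW : DifferentiableOn ℝ W (augDomain I D))
    (ht : ∀ z ∈ augDomain I D, fderiv ℝ W z ((1, 0), 0) = 0)
    (hx : ∀ z ∈ augDomain I D, ∀ (P : E3 →L[ℝ] Fib) (u : E3), fderiv ℝ W z ((0, u), P u) = 0) :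
    ∃ c, ∀ z ∈ augDomain I D, W z = c := by
  refine (isOpen_augDomain hI hD).exists_is_const_of_fderiv_eq_zero
    (isPreconnected_augDomain hIc hDc) hW fun z hz => ?_
  have h1 : ∀ u : E3, fderiv ℝ W z ((0, u), 0) = 0 := fun u => by simpa using hx z hz 0 u
  have h2 : ∀ a : Fib, fderiv ℝ W z ((0, 0), a) = 0 := fun a => by
    obtain ⟨P, hP⟩ := exists_clm_apply_eq 0 a
    have h3 := hx z hz P (e 0)
    have h4 : (((0, e 0), P (e 0)) : Aug) = ((0, e 0), 0) + ((0, 0), a) := by simp [hP, e]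
    rwa [h4, map_add, h1, zero_add] at h3
  refine ContinuousLinearMap.ext fun ⟨⟨s, u⟩, a⟩ => ?_
  have h4 : (((s, u), a) : Aug) = s • ((1, 0), 0) + ((0, u), 0) + ((0, 0), a) := by simp
  rw [h4, map_add, map_add, map_smul, ht z hz, h1, h2]
  simp

/-- A smooth function of `(t, x, A, Φ)` whose total derivatives with respect to `t` vanish, and
whose total derivatives with respect to `x` are symmetric for all values of the derivatives of
`(A, Φ)`, is the gradient of a function of `x`. -/
theorem exists_gradient_of_totalDeriv_symm (hI : IsOpen I) (hIc : IsPreconnected I)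
    (hIne : I.Nonempty) (hD : IsOpen D) (hDc : Convex ℝ D) {W : Aug → E3}
    (hW : ContDiffOn ℝ ∞ W (augDomain I D))
    (ht : ∀ z ∈ augDomain I D, fderiv ℝ W z ((1, 0), 0) = 0)
    (hx : ∀ z ∈ augDomain I D, ∀ (P : E3 →L[ℝ] Fib) (u w : E3),
      ⟪fderiv ℝ W z ((0, u), P u), w⟫_ℝ = ⟪fderiv ℝ W z ((0, w), P w), u⟫_ℝ) :
    ∃ f : E3 → ℝ, ContDiffOn ℝ ∞ f D ∧ ∀ z ∈ augDomain I D, W z = gradient f z.1.2 := by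
  obtain ⟨t₀, ht₀⟩ := hIne
  have hO := isOpen_augDomain hI hD
  have hdW : ∀ z ∈ augDomain I D, HasFDerivAt W (fderiv ℝ W z) z := fun z hz =>
    ((hW.contDiffAt (hO.mem_nhds hz)).differentiableAt (by simp)).hasFDerivAt
  have h1 : ∀ z ∈ augDomain I D, ∀ u w : E3,
      ⟪fderiv ℝ W z ((0, u), 0), w⟫_ℝ = ⟪fderiv ℝ W z ((0, w), 0), u⟫_ℝ := fun z hz u w => by
    simpa using hx z hz 0 u w
  -- Independence of `(A, Φ)`: for `P u = u i • a`, symmetry tested on `e i`, `e j` with `j ≠ i`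
  -- kills the `j`-th component of the derivative along `a`. Every `j` admits such an `i` because
  -- the dimension exceeds one.
  have h2 : ∀ z ∈ augDomain I D, ∀ a : Fib, fderiv ℝ W z ((0, 0), a) = 0 := fun z hz a => by
    have key : ∀ i j : Fin 3, i ≠ j → (fderiv ℝ W z ((0, 0), a)) j = 0 := fun i j hij => by
      obtain ⟨P, hP⟩ := exists_clm_apply_eq i a
      have h3 := hx z hz P (e i) (e j)
      have h4 : ∀ u : E3, (((0, u), P u) : Aug) = ((0, u), 0) + u i • ((0, 0), a) := by
        intro u; simp [hP]
      rw [h4, h4, map_add, map_add, inner_add_left, inner_add_left, h1 z hz, map_smul,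
        map_smul] at h3
      simpa [e, hij, hij.symm, EuclideanSpace.inner_single_right] using h3
    ext j
    fin_cases j
    · exact key 1 0 (by decide)
    · exact key 0 1 (by decide)
    · exact key 0 2 (by decide)
  have h3 : ∀ z ∈ augDomain I D, W z = W ((t₀, z.1.2), 0) := by
    rintro ⟨⟨t, x⟩, a⟩ hz
    have hx' := (mem_augDomain.1 hz).2
    have hder : ∀ q ∈ I ×ˢ (univ : Set Fib),
        HasFDerivAt (fun q : ℝ × Fib => W ((q.1, x), q.2)) (0 : ℝ × Fib →L[ℝ] E3) q := by
      intro q hq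
      have hz' : ((q.1, x), q.2) ∈ augDomain I D := mem_augDomain.2 ⟨hq.1, hx'⟩
      have hin : HasFDerivAt (fun q : ℝ × Fib => (((q.1, x), q.2) : Aug))
          (((ContinuousLinearMap.fst ℝ ℝ Fib).prod 0).prod (ContinuousLinearMap.snd ℝ ℝ Fib)) q :=
        (hasFDerivAt_fst.prodMk (hasFDerivAt_const x q)).prodMk hasFDerivAt_snd
      have hc := (hdW _ hz').comp q hin
      refine hc.congr_fderiv ?_
      refine ContinuousLinearMap.ext fun ⟨s, a'⟩ => ?_
      have h4 : (((s, 0), a') : Aug) = s • ((1, 0), 0) + ((0, 0), a') := by simp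
      simp only [ContinuousLinearMap.comp_apply, ContinuousLinearMap.prod_apply,
        ContinuousLinearMap.coe_fst', zero_apply,
        ContinuousLinearMap.coe_snd']
      rw [h4, map_add, map_smul, ht _ hz', h2 _ hz']
      simp
    exact (hI.prod isOpen_univ).is_const_of_fderiv_eq_zero (hIc.prod isPreconnected_univ)
      (fun q hq => (hder q hq).differentiableAt.differentiableWithinAt)
      (fun q hq => (hder q hq).fderiv) (x := (t, a)) (y := (t₀, 0))
      ⟨(mem_augDomain.1 hz).1, trivial⟩ ⟨ht₀, trivial⟩
  have hmem : ∀ x ∈ D, ((t₀, x), (0 : Fib)) ∈ augDomain I D := fun x hx' =>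
    mem_augDomain.2 ⟨ht₀, hx'⟩
  have hw : ∀ x ∈ D, HasFDerivAt (fun x => innerSL ℝ (W ((t₀, x), 0)))
      ((innerSL ℝ).comp ((fderiv ℝ W ((t₀, x), 0)).comp
        (((0 : E3 →L[ℝ] ℝ).prod (ContinuousLinearMap.id ℝ E3)).prod 0))) x := fun x hx' => by
    have hin : HasFDerivAt (fun x : E3 => (((t₀, x), 0) : Aug))
        (((0 : E3 →L[ℝ] ℝ).prod (ContinuousLinearMap.id ℝ E3)).prod 0) x :=
      ((hasFDerivAt_const t₀ x).prodMk (hasFDerivAt_id x)).prodMk (hasFDerivAt_const 0 x)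
    exact (innerSL ℝ).hasFDerivAt.comp x ((hdW _ (hmem x hx')).comp x hin)
  -- Poincaré lemma on the convex set `D`, for the closed one-form dual to `W`.
  obtain ⟨f, hf⟩ : ∃ f, ∀ x ∈ D, HasFDerivAt f (innerSL ℝ (W ((t₀, x), 0))) x :=
    hDc.exists_forall_hasFDerivAt_of_fderiv_symmetric hD
    (fun x hx' => (hw x hx').differentiableAt.differentiableWithinAt)
    (fun x hx' u v => by
      rw [(hw x hx').fderiv]
      simpa using h1 _ (hmem x hx') u v)
  refine ⟨f, ?_, fun z hz => ?_⟩
  · rw [contDiffOn_infty_iff_fderiv_of_isOpen hD]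
    refine ⟨fun x hx' => (hf x hx').differentiableAt.differentiableWithinAt, ?_⟩
    have hs : ContDiffOn ℝ ∞ (fun x => innerSL ℝ (W ((t₀, x), 0))) D := by
      refine (innerSL ℝ).contDiff.comp_contDiffOn (hW.comp ?_ fun x hx' => hmem x hx')
      exact ((contDiff_const.prodMk contDiff_id).prodMk contDiff_const).contDiffOn
    exact hs.congr fun x hx' => (hf x hx').fderiv
  · rw [h3 z hz]
    have hg : HasGradientAt f (W ((t₀, z.1.2), 0)) z.1.2 := by
      rw [hasGradientAt_iff_hasFDerivAt]
      exact hf _ (mem_augDomain.1 hz).2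
    exact hg.gradient.symm

end TotalDerivative

/-- A criterion for a map of the `(t, x)`-space to be affine and to respect the product
structure. -/
theorem exists_affine_of_fderiv {I : Set ℝ} {D : Set E3} (hI : IsOpen I)
    (hIc : IsPreconnected I) (hIne : I.Nonempty) (hD : IsOpen D) (hDc : Convex ℝ D)
    (hDne : D.Nonempty) {B : Base → Base} (hB : ContDiffOn ℝ ∞ B (I ×ˢ D))
    (h₁ : ∀ q ∈ I ×ˢ D, (fderiv ℝ B q (1, 0)).2 = 0)
    (h₂ : ∀ q ∈ I ×ˢ D, ∀ v, (fderiv ℝ B q (0, v)).1 = 0)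
    (h₃ : ∀ q ∈ I ×ˢ D, (fderiv ℝ (fderiv ℝ B) q (1, 0) (1, 0)).1 = 0)
    (h₄ : ∀ q ∈ I ×ˢ D, ∀ v, (fderiv ℝ (fderiv ℝ B) q (0, v) (0, v)).2 = 0) :
    ∃ (α τ : ℝ) (M : E3 →L[ℝ] E3) (k : E3), ∀ q ∈ I ×ˢ D,
      B q = (α * q.1 + τ, M q.2 + k) ∧ ∀ s v, fderiv ℝ B q (s, v) = (α * s, M v) := by
  obtain ⟨t₀, ht₀⟩ := hIne
  obtain ⟨x₀, hx₀⟩ := hDne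
  have hO : IsOpen (I ×ˢ D) := hI.prod hD
  have hc := isPreconnected_base hIc hDc
  have hdB : DifferentiableOn ℝ B (I ×ˢ D) := hB.differentiableOn (by simp)
  have hG : ContDiffOn ℝ ∞ (fderiv ℝ B) (I ×ˢ D) :=
    ((contDiffOn_infty_iff_fderiv_of_isOpen hO).1 hB).2
  have hdG : DifferentiableOn ℝ (fderiv ℝ B) (I ×ˢ D) := hG.differentiableOn (by simp)
  have hG0 : ∀ q ∈ I ×ˢ D, fderiv ℝ (fderiv ℝ B) q = 0 := by
    intro q hq
    have hdq := hdG.differentiableAt (hO.mem_nhds hq)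
    set H := fderiv ℝ (fderiv ℝ B) q with hH
    have hsymm : ∀ u w, H u w = H w u := fun u w =>
      ((hB.contDiffAt (hO.mem_nhds hq)).isSymmSndFDerivAt two_le_infty) u w
    have a1 : ∀ u, (H u (1, 0)).2 = 0 := fun u =>
      clm_fderiv_eq_zero hdq ((ContinuousLinearMap.snd ℝ ℝ E3).comp
        (ContinuousLinearMap.apply ℝ Base (1, 0)))
        (Filter.mem_of_superset (hO.mem_nhds hq) fun y hy => h₁ y hy) u
    have a2 : ∀ v u, (H u (0, v)).1 = 0 := fun v u =>
      clm_fderiv_eq_zero hdq ((ContinuousLinearMap.fst ℝ ℝ E3).comp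
        (ContinuousLinearMap.apply ℝ Base (0, v)))
        (Filter.mem_of_superset (hO.mem_nhds hq) fun y hy => h₂ y hy v) u
    -- Polarisation of `h₄`, by symmetry of the second derivative.
    have a3 : ∀ u v, (H (0, u) (0, v)).2 = 0 := fun u v => by
      have e1 := h₄ q hq (u + v)
      have e2 : ((0, u + v) : Base) = (0, u) + (0, v) := by simp
      rw [e2, ← hH] at e1
      simp only [map_add, add_apply, Prod.snd_add] at e1
      rw [h₄ q hq u, h₄ q hq v, hsymm (0, v) (0, u)] at e1
      simp only [zero_add, add_zero] at e1
      rwa [← two_smul ℝ, smul_eq_zero_iff_right two_ne_zero] at e1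
    have b1 : H (1, 0) (1, 0) = 0 := Prod.ext (h₃ q hq) (a1 _)
    have b2 : ∀ v, H (0, v) (1, 0) = 0 := fun v =>
      Prod.ext (by rw [hsymm]; exact a2 v _) (a1 _)
    have b3 : ∀ v, H (1, 0) (0, v) = 0 := fun v => by rw [hsymm]; exact b2 v
    have b4 : ∀ u v, H (0, u) (0, v) = 0 := fun u v => Prod.ext (a2 _ _) (a3 u v)
    have split : ∀ p : Base, p = p.1 • ((1, 0) : Base) + (0, p.2) := fun p => by
      ext <;> simp
    refine ContinuousLinearMap.ext fun u => ContinuousLinearMap.ext fun w => ?_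
    rw [split u, split w]
    simp only [map_add, map_smul, add_apply, smul_apply, b1, b2, b3, b4, smul_zero, add_zero,
      zero_apply]
  set L := fderiv ℝ B (t₀, x₀) with hL
  have hconst : ∀ q ∈ I ×ˢ D, fderiv ℝ B q = L := fun q hq =>
    hO.is_const_of_fderiv_eq_zero hc hdG (fun q hq => hG0 q hq) hq ⟨ht₀, hx₀⟩
  have hLq : ∀ q ∈ I ×ˢ D, B q - L q = B (t₀, x₀) - L (t₀, x₀) := fun q hq => by
    have hd : ∀ q ∈ I ×ˢ D, HasFDerivAt (fun q => B q - L q) 0 q := fun q hq => by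
      have := (hdB.differentiableAt (hO.mem_nhds hq)).hasFDerivAt.sub L.hasFDerivAt
      rwa [hconst q hq, sub_self] at this
    exact hO.is_const_of_fderiv_eq_zero (f := fun q => B q - L q) hc
      (fun q hq => (hd q hq).differentiableAt.differentiableWithinAt)
      (fun q hq => (hd q hq).fderiv) hq ⟨ht₀, hx₀⟩
  have hLs : ∀ s v, L (s, v) = ((L (1, 0)).1 * s, (L (0, v)).2) := fun s v => by
    have e1 : ((s, v) : Base) = s • (1, 0) + (0, v) := by simp
    have e2 := h₁ _ (mk_mem_prod ht₀ hx₀)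
    have e3 := h₂ _ (mk_mem_prod ht₀ hx₀) v
    rw [← hL] at e2 e3
    rw [e1, map_add, map_smul]
    ext1
    · simp [e3, mul_comm]
    · simp [e2]
  refine ⟨(L (1, 0)).1, (B (t₀, x₀) - L (t₀, x₀)).1,
    (ContinuousLinearMap.snd ℝ ℝ E3).comp (L.comp (ContinuousLinearMap.inr ℝ ℝ E3)),
    (B (t₀, x₀) - L (t₀, x₀)).2, fun q hq => ⟨?_, fun s v => ?_⟩⟩
  · rw [← hLq q hq]
    have := hLs q.1 q.2
    ext1
    · simp [this]
    · simp [this]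
  · rw [hconst q hq, hLs]
    simp

/-- A polynomial of degree at most three with vector coefficients that vanishes near `0` has zero
coefficients. -/
theorem cubic_coeff_eq_zero {V : Type*} [AddCommGroup V] [Module ℝ V] {a b c d : V}
    (h : ∀ᶠ s : ℝ in 𝓝 0, a + s • b + s ^ 2 • c + s ^ 3 • d = 0) : a = 0 ∧ b = 0 ∧ c = 0 := by
  obtain ⟨δ, hδ, hball⟩ := Metric.eventually_nhds_iff.1 h
  have H : ∀ s : ℝ, |s| < δ → a + s • b + s ^ 2 • c + s ^ 3 • d = 0 := fun s hs =>
    hball (by simpa using hs)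
  have ha : a = 0 := by simpa using H 0 (by simpa using hδ)
  -- The values at `±δ/2` give the even coefficient `c`; the two odd coefficients are then separated
  -- by a further value, at `δ/4`.
  have h1 := H (δ / 2) (by rw [abs_of_pos (by positivity)]; linarith)
  have h2 := H (-(δ / 2)) (by rw [abs_neg, abs_of_pos (by positivity)]; linarith)
  have h3 := H (δ / 4) (by rw [abs_of_pos (by positivity)]; linarith)
  subst ha
  have hc : (δ ^ 2) • c = 0 := by
    linear_combination (norm := module) (2 : ℝ) • h1 + (2 : ℝ) • h2
  have hc0 : c = 0 := (smul_eq_zero_iff_right (by positivity)).1 hc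
  subst hc0
  have hb : δ • b = 0 := by
    linear_combination (norm := module) (-(2 / 3) : ℝ) • h1 + (16 / 3 : ℝ) • h3
  exact ⟨rfl, (smul_eq_zero_iff_right hδ.ne').1 hb, rfl⟩

/-- A symmetric bilinear form that vanishes on pairs of orthogonal vectors is a multiple of the
inner product. -/
theorem exists_eq_mul_inner (B : E3 → E3 → ℝ) (hadd : ∀ u u' v, B (u + u') v = B u v + B u' v)
    (hsmul : ∀ (s : ℝ) u v, B (s • u) v = s * B u v) (hsymm : ∀ u v, B u v = B v u)
    (h : ∀ u v, ⟪u, v⟫_ℝ = 0 → B u v = 0) : ∃ c, ∀ u v, B u v = c * ⟪u, v⟫_ℝ := by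
  have hadd' : ∀ u v v', B u (v + v') = B u v + B u v' := fun u v v' => by
    rw [hsymm, hadd, hsymm v, hsymm v']
  have hsmul' : ∀ (s : ℝ) u v, B u (s • v) = s * B u v := fun s u v => by
    rw [hsymm, hsmul, hsymm v]
  have hne : ∀ i j : Fin 3, i ≠ j → B (e i) (e j) = 0 := fun i j hij => h _ _ (by
    simp [e, hij.symm, EuclideanSpace.inner_single_right])
  -- The vectors `e i + e j` and `e i - e j` are orthogonal, which equates the diagonal values.
  have heq : ∀ i j : Fin 3, i ≠ j → B (e i) (e i) = B (e j) (e j) := fun i j hij => by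
    have h1 := h (e i + e j) (e i + (-1 : ℝ) • e j) (by
      simp [e, inner_add_left, inner_add_right, hij, hij.symm, EuclideanSpace.inner_single_right])
    rw [hadd, hadd', hadd', hsmul', hsmul', hne i j hij, hne j i hij.symm] at h1
    linarith
  refine ⟨B (e 0) (e 0), fun u v => ?_⟩
  conv_lhs => rw [eq_sum_basis u, eq_sum_basis v]
  simp only [hadd, hadd', hsmul, hsmul', hne 0 1 (by decide), hne 0 2 (by decide),
    hne 1 0 (by decide), hne 1 2 (by decide), hne 2 0 (by decide), hne 2 1 (by decide),
    ← heq 0 1 (by decide), ← heq 0 2 (by decide)]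
  simp only [PiLp.inner_apply, Fin.sum_univ_three, RCLike.inner_apply, conj_trivial]
  ring

/-! ### Structure of equivalence transformations -/

section Forward

variable {I : Set ℝ} {D : Set E3} {T : Base → Base} {U : Aug → Fib}

/-- Affine potentials with value `a` and derivative `P` at `x₀`. -/
def affinePotential (a : Fib) (P : E3 →L[ℝ] Fib) (x₀ z : E3) : Fib := a + P (z - x₀)

theorem affinePotential_self (a : Fib) (P : E3 →L[ℝ] Fib) (x₀ : E3) :
    affinePotential a P x₀ x₀ = a := by simp [affinePotential]

theorem hasFDerivAt_affinePotential (a : Fib) (P : E3 →L[ℝ] Fib) (x₀ z : E3) :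
    HasFDerivAt (affinePotential a P x₀) P z :=
  (P.hasFDerivAt.comp z ((hasFDerivAt_id z).sub_const x₀)).const_add a

theorem contDiff_affinePotential (a : Fib) (P : E3 →L[ℝ] Fib) (x₀ : E3) :
    ContDiff ℝ ∞ (affinePotential a P x₀) :=
  contDiff_const.add (P.contDiff.comp (contDiff_id.sub contDiff_const))

theorem acceleration_affinePotential (a : Fib) (P : E3 →L[ℝ] Fib) (x₀ z v : E3) :
    acceleration (fun z => (affinePotential a P x₀ z).1) (fun z => (affinePotential a P x₀ z).2) z v
      = force P v := by
  rw [acceleration_eq_force, (hasFDerivAt_affinePotential a P x₀ z).fst.fderiv,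
    (hasFDerivAt_affinePotential a P x₀ z).snd.fderiv]
  rfl

/-- The pair `(T, U)` maps each member of the class with affine potentials to a member of the
class. -/
def MapsAffineMembers (I : Set ℝ) (D : Set E3) (T : Base → Base) (U : Aug → Fib) : Prop :=
  ∀ (a : Fib) (P : E3 →L[ℝ] Fib) (x₀ : E3), ∃ (A' : E3 → E3) (Φ' : E3 → ℝ),
    MapsMember I D T U (fun z => (affinePotential a P x₀ z).1)
      (fun z => (affinePotential a P x₀ z).2) A' Φ'

theorem IsPointTransformation.contDiffOn_base (h : IsPointTransformation I D T U) :
    ContDiffOn ℝ ∞ T (I ×ˢ D) :=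
  h.smooth.fst.comp (contDiff_id.prodMk (contDiff_const (c := (0 : Fib)))).contDiffOn
    fun _ hq => mem_augDomain.2 ⟨hq.1, hq.2⟩

theorem IsPointTransformation.contDiffOn_fib (h : IsPointTransformation I D T U) :
    ContDiffOn ℝ ∞ U (augDomain I D) := h.smooth.snd

theorem IsPointTransformation.bijective_fderiv_base (h : IsPointTransformation I D T U)
    (hI : IsOpen I) (hD : IsOpen D) {q : Base} (hq : q ∈ I ×ˢ D) :
    Function.Bijective (fderiv ℝ T q) := by
  have hp : ((q, 0) : Aug) ∈ augDomain I D := mem_augDomain.2 ⟨hq.1, hq.2⟩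
  have hT : HasFDerivAt T (fderiv ℝ T q) q :=
    ((h.contDiffOn_base.contDiffAt ((hI.prod hD).mem_nhds hq)).differentiableAt
      (by simp)).hasFDerivAt
  have hU : HasFDerivAt U (fderiv ℝ U (q, 0)) (q, 0) :=
    ((h.contDiffOn_fib.contDiffAt ((isOpen_augDomain hI hD).mem_nhds hp)).differentiableAt
      (by simp)).hasFDerivAt
  have hb := h.nondegenerate _ hp
  have hTU : HasFDerivAt (fun p : Aug => (T p.1, U p)) (((fderiv ℝ T q).comp
      (ContinuousLinearMap.fst ℝ Base Fib)).prod (fderiv ℝ U (q, 0))) (q, 0) :=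
    (hT.comp ((q, 0) : Aug) hasFDerivAt_fst).prodMk hU
  rw [hTU.fderiv] at hb
  have hs : Function.Surjective (fderiv ℝ T q) := fun w => by
    obtain ⟨u, hu⟩ := hb.2 (w, 0)
    exact ⟨u.1, congrArg Prod.fst hu⟩
  exact ⟨(LinearMap.injective_iff_surjective (f := (fderiv ℝ T q : Base →ₗ[ℝ] Base))).2 hs, hs⟩

/-- If two different old positions shared a new one, affine potentials with value `b` at the first
and `0` at the second would give `U (p, b) = U (q, 0)` for every `b`, since the new potentials
depend on the new position only. This contradicts injectivity. -/
theorem eq_of_space_eq (h : IsPointTransformation I D T U) (hm : MapsAffineMembers I D T U)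
    {p q : Base} (hp : p ∈ I ×ˢ D) (hq : q ∈ I ×ˢ D) (hpq : (T p).2 = (T q).2) : p.2 = q.2 := by
  by_contra hne
  have key : ∀ b : Fib, U (p, b) = U (q, 0) := fun b => by
    obtain ⟨i, hi⟩ : ∃ i, (q.2 - p.2) i ≠ 0 := by
      by_contra hcon
      push Not at hcon
      exact hne (sub_eq_zero.1 (PiLp.ext hcon : q.2 - p.2 = 0)).symm
    obtain ⟨P, hP⟩ := exists_clm_apply_eq i (-(((q.2 - p.2) i)⁻¹ • b))
    obtain ⟨A', Φ', hA⟩ := hm b P p.2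
    have h1 := hA.potentials p.1 hp.1 p.2 hp.2
    have h2 := hA.potentials q.1 hq.1 q.2 hq.2
    have h3 : affinePotential b P p.2 q.2 = 0 := by
      rw [affinePotential, hP, smul_neg, smul_inv_smul₀ hi, add_neg_cancel]
    rw [affinePotential_self] at h1
    rw [h3] at h2
    have h4 : U (p, b) = (A' (T p).2, Φ' (T p).2) := h1
    have h5 : U (q, 0) = (A' (T q).2, Φ' (T q).2) := h2
    rw [h4, h5, hpq]
  have hmem : ∀ b : Fib, ((p, b) : Aug) ∈ augDomain I D := fun b =>
    mem_augDomain.2 ⟨hp.1, hp.2⟩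
  have := h.injOn (hmem (0, 0)) (hmem (0, 1)) (by simp only [key])
  simp at this

theorem hasStrictFDerivAt_space (h : IsPointTransformation I D T U) (hI : IsOpen I)
    (hD : IsOpen D) {q : Base} (hq : q ∈ I ×ˢ D) :
    HasStrictFDerivAt (fun q => (T q).2)
      ((ContinuousLinearMap.snd ℝ ℝ E3).comp (fderiv ℝ T q)) q :=
  (ContinuousLinearMap.snd ℝ ℝ E3).hasStrictFDerivAt.comp q
    ((h.contDiffOn_base.contDiffAt ((hI.prod hD).mem_nhds hq)).hasStrictFDerivAt (by simp))

theorem range_fderiv_space (h : IsPointTransformation I D T U) (hI : IsOpen I)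
    (hD : IsOpen D) {q : Base} (hq : q ∈ I ×ˢ D) :
    ((ContinuousLinearMap.snd ℝ ℝ E3).comp (fderiv ℝ T q)).range = ⊤ := by
  refine LinearMap.range_eq_top.2 fun w => ?_
  obtain ⟨u, hu⟩ := (h.bijective_fderiv_base hI hD hq).2 (0, w)
  exact ⟨u, by simp [hu]⟩

/-- The image of the domain in the new space is open. -/
theorem isOpen_image_space (h : IsPointTransformation I D T U) (hI : IsOpen I) (hD : IsOpen D) :
    IsOpen ((fun q => (T q).2) '' (I ×ˢ D)) := by
  rw [isOpen_iff_mem_nhds]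
  rintro _ ⟨q, hq, rfl⟩
  rw [← (hasStrictFDerivAt_space h hI hD hq).map_nhds_eq_of_surj (range_fderiv_space h hI hD hq)]
  exact image_mem_map ((hI.prod hD).mem_nhds hq)

/-- The derivative of the new position maps four dimensions onto three. Its kernel is tangent to a
fibre of the new position, along which the old position is constant, so the kernel is the time axis.
-/
theorem fderiv_time_space_eq_zero (h : IsPointTransformation I D T U)
    (hm : MapsAffineMembers I D T U) (hI : IsOpen I) (hD : IsOpen D) {q : Base}
    (hq : q ∈ I ×ˢ D) : (fderiv ℝ T q (1, 0)).2 = 0 := by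
  have hs := hasStrictFDerivAt_space h hI hD hq
  have hr := range_fderiv_space h hI hD hq
  set X' := (ContinuousLinearMap.snd ℝ ℝ E3).comp (fderiv ℝ T q) with hX'
  -- The implicit function theorem supplies a curve inside the fibre with initial velocity `k`; its
  -- space component is constant near `0` by `eq_of_space_eq`.
  have hker : ∀ k : X'.ker, (k : Base).2 = 0 := fun k => by
    have h1 := hs.to_implicitFunction hr
    have hline : HasStrictDerivAt (fun s : ℝ => s • k) k 0 := by
      simpa using (hasStrictDerivAt_id (0 : ℝ)).smul_const k
    have h2 : HasDerivAt (fun s : ℝ => hs.implicitFunction _ _ hr ((T q).2) (s • k)) (k : Base) 0 := by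
      have h1' : HasStrictFDerivAt (hs.implicitFunction _ _ hr ((T q).2)) X'.ker.subtypeL
          ((0 : ℝ) • k) := by
        rw [zero_smul]; exact h1
      exact (h1'.comp_hasStrictDerivAt 0 hline).hasDerivAt
    have h0 : hs.implicitFunction _ _ hr ((T q).2) ((0 : ℝ) • k) = q := by
      rw [zero_smul]
      exact hs.implicitFunction_apply_image hr
    have h3 : ∀ᶠ s : ℝ in 𝓝 0,
        hs.implicitFunction _ _ hr ((T q).2) (s • k) ∈ I ×ˢ D := by
      refine h2.continuousAt.eventually_mem ?_
      rw [h0]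
      exact (hI.prod hD).mem_nhds hq
    have h4 : ∀ᶠ s : ℝ in 𝓝 0,
        (T (hs.implicitFunction _ _ hr ((T q).2) (s • k))).2 = (T q).2 := by
      have ht : Tendsto (fun s : ℝ => ((T q).2, s • k)) (𝓝 0) (𝓝 ((T q).2, 0)) := by
        have : ContinuousAt (fun s : ℝ => ((T q).2, s • k)) 0 := by fun_prop
        simpa [ContinuousAt] using this
      exact ht.eventually (hs.map_implicitFunction_eq hr)
    have h5 : HasDerivAt (fun s : ℝ => (hs.implicitFunction _ _ hr ((T q).2) (s • k)).2)
        (k : Base).2 0 := h2.snd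
    have h6 : HasDerivAt (fun s : ℝ => (hs.implicitFunction _ _ hr ((T q).2) (s • k)).2) 0 0 :=
      (hasDerivAt_const (0 : ℝ) q.2).congr_of_eventuallyEq (by
        filter_upwards [h3, h4] with s hs3 hs4
        exact eq_of_space_eq h hm hs3 hq hs4)
    exact h5.unique h6
  have hne : X'.ker ≠ ⊥ := by
    refine LinearMap.ker_ne_bot_of_finrank_lt ?_
    simp
  obtain ⟨k, hk, hk0⟩ := Submodule.exists_mem_ne_zero_of_ne_bot hne
  have hk2 := hker ⟨k, hk⟩
  have hk1 : k.1 ≠ 0 := fun hc => hk0 (Prod.ext hc hk2)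
  have hkeq : k = k.1 • ((1, 0) : Base) := by
    ext1
    · simp
    · simpa using hk2
  have h7 : X' k = 0 := hk
  rw [hkeq, map_smul] at h7
  exact (smul_eq_zero_iff_right hk1).1 h7

theorem space_eq_of_eq (h : IsPointTransformation I D T U) (hm : MapsAffineMembers I D T U)
    (hI : IsOpen I) (hIc : IsPreconnected I) (hD : IsOpen D) {t s : ℝ} (ht : t ∈ I) (hs : s ∈ I)
    {x : E3} (hx : x ∈ D) : (T (t, x)).2 = (T (s, x)).2 := by
  have hd : ∀ r ∈ I, HasDerivAt (fun r : ℝ => (T (r, x)).2) 0 r := fun r hr => by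
    have h1 := (hasStrictFDerivAt_space h hI hD (mk_mem_prod hr hx)).hasFDerivAt.comp_hasDerivAt r
      ((hasDerivAt_id r).prodMk (hasDerivAt_const r x))
    simp only [ContinuousLinearMap.comp_apply, ContinuousLinearMap.coe_snd',
      fderiv_time_space_eq_zero h hm hI hD (mk_mem_prod hr hx)] at h1
    exact h1
  exact hI.is_const_of_fderiv_eq_zero (f := fun r : ℝ => (T (r, x)).2) hIc
    (fun r hr => (hd r hr).differentiableAt.differentiableWithinAt)
    (fun r hr => by
      ext
      simp [(hd r hr).deriv]) ht hs

/-- Constant potentials with value `a` suffice: the new ones do not depend on time, and at fixed `x`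
neither does the new position. -/
theorem fib_eq_of_eq (h : IsPointTransformation I D T U) (hm : MapsAffineMembers I D T U)
    (hI : IsOpen I) (hIc : IsPreconnected I) (hD : IsOpen D) {t s : ℝ} (ht : t ∈ I) (hs : s ∈ I)
    {x : E3} (hx : x ∈ D) (a : Fib) : U ((t, x), a) = U ((s, x), a) := by
  obtain ⟨A', Φ', hA⟩ := hm a 0 x
  have h1 := hA.potentials t ht x hx
  have h2 := hA.potentials s hs x hx
  rw [affinePotential_self] at h1 h2
  have h1' : U ((t, x), a) = _ := h1
  have h2' : U ((s, x), a) = _ := h2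
  rw [h1', h2', space_eq_of_eq h hm hI hIc hD ht hs hx]

theorem fderiv_fib_time_eq_zero (h : IsPointTransformation I D T U)
    (hm : MapsAffineMembers I D T U) (hI : IsOpen I) (hIc : IsPreconnected I) (hD : IsOpen D)
    {z : Aug} (hz : z ∈ augDomain I D) : fderiv ℝ U z ((1, 0), 0) = 0 := by
  have hz' := mem_augDomain.1 hz
  have hU : HasFDerivAt U (fderiv ℝ U z) z :=
    ((h.contDiffOn_fib.contDiffAt ((isOpen_augDomain hI hD).mem_nhds hz)).differentiableAt
      (by simp)).hasFDerivAt
  have h1 : HasDerivAt (fun r : ℝ => U ((r, z.1.2), z.2)) (fderiv ℝ U z ((1, 0), 0)) z.1.1 :=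
    hU.comp_hasDerivAt z.1.1 (((hasDerivAt_id z.1.1).prodMk (hasDerivAt_const z.1.1 z.1.2)).prodMk
      (hasDerivAt_const z.1.1 z.2))
  have h2 : HasDerivAt (fun r : ℝ => U ((r, z.1.2), z.2)) 0 z.1.1 :=
    (hasDerivAt_const z.1.1 (U z)).congr_of_eventuallyEq (by
      filter_upwards [hI.mem_nhds hz'.1] with r hr
      exact fib_eq_of_eq h hm hI hIc hD hr hz'.1 hz'.2 z.2)
  exact h1.unique h2

end Forward

/-! ### Transport of solution curves -/

section Forward

variable {I : Set ℝ} {D : Set E3} {T : Base → Base} {U : Aug → Fib}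

theorem hasDerivAt_fst_comp {E F : Type*} [NormedAddCommGroup E] [NormedSpace ℝ E]
    [NormedAddCommGroup F] [NormedSpace ℝ F] {f : ℝ → E × F} {f' : E × F} {t : ℝ}
    (hf : HasDerivAt f f' t) : HasDerivAt (fun t => (f t).1) f'.1 t :=
  (ContinuousLinearMap.fst ℝ E F).hasFDerivAt.comp_hasDerivAt t hf

theorem hasDerivAt_snd_comp {E F : Type*} [NormedAddCommGroup E] [NormedSpace ℝ E]
    [NormedAddCommGroup F] [NormedSpace ℝ F] {f : ℝ → E × F} {f' : E × F} {t : ℝ}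
    (hf : HasDerivAt f f' t) : HasDerivAt (fun t => (f t).2) f'.2 t :=
  (ContinuousLinearMap.snd ℝ E F).hasFDerivAt.comp_hasDerivAt t hf

theorem contDiff_force (P : E3 →L[ℝ] Fib) : ContDiff ℝ ∞ (force P) := by
  rw [contDiff_euclidean]
  intro i
  simp only [force]
  fun_prop

/-- The equations of motion in the new variables, along a solution of the system with affine
potentials, expressed in the old variables. -/
theorem transformed_equation (h : IsPointTransformation I D T U) (hI : IsOpen I) (hD : IsOpen D)
    {a : Fib} {P : E3 →L[ℝ] Fib} {t₀ : ℝ} {x₀ : E3} (hq : (t₀, x₀) ∈ I ×ˢ D) {z : E3}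
    {A' : E3 → E3} {Φ' : E3 → ℝ}
    (hm : MapsMember I D T U (fun z' => (affinePotential a P z z').1)
      (fun z' => (affinePotential a P z z').2) A' Φ')
    {v₀ : E3} {Y N : Base} (hY : Y = fderiv ℝ T (t₀, x₀) (1, v₀))
    (hN : N = fderiv ℝ (fderiv ℝ T) (t₀, x₀) (1, v₀) (1, v₀) +
      fderiv ℝ T (t₀, x₀) (0, force P v₀))
    (hne : Y.1 ≠ 0) :
    N.1 • (Y.1⁻¹ • Y.2) + Y.1 ^ 2 • acceleration A' Φ' (T (t₀, x₀)).2 (Y.1⁻¹ • Y.2) = N.2 := by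
  have hO : IsOpen (I ×ˢ D) := hI.prod hD
  have hTs := h.contDiffOn_base
  have hdT : ∀ q ∈ I ×ˢ D, HasFDerivAt T (fderiv ℝ T q) q := fun q hq =>
    ((hTs.contDiffAt (hO.mem_nhds hq)).differentiableAt (by simp)).hasFDerivAt
  have hddT : HasFDerivAt (fderiv ℝ T) (fderiv ℝ (fderiv ℝ T) (t₀, x₀)) (t₀, x₀) :=
    ((((contDiffOn_infty_iff_fderiv_of_isOpen hO).1 hTs).2.contDiffAt
      (hO.mem_nhds hq)).differentiableAt (by simp)).hasFDerivAt
  -- a solution of the original system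
  have hf : ContDiffAt ℝ 1 (fun p : E3 × E3 => (p.2, force P p.2)) (x₀, v₀) := by
    have : ContDiff ℝ ∞ (fun p : E3 × E3 => (p.2, force P p.2)) :=
      contDiff_snd.prodMk ((contDiff_force P).comp contDiff_snd)
    exact (this.of_le (by simp)).contDiffAt
  obtain ⟨γ, hγ0, ε, hε, hγ⟩ :=
    hf.exists_forall_mem_closedBall_exists_eq_forall_mem_Ioo_hasDerivAt₀ t₀
  have hx : ∀ t ∈ Ioo (t₀ - ε) (t₀ + ε), HasDerivAt (fun t => (γ t).1) (γ t).2 t :=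
    fun t ht => hasDerivAt_fst_comp (hγ t ht)
  have hv : ∀ t ∈ Ioo (t₀ - ε) (t₀ + ε), HasDerivAt (fun t => (γ t).2) (force P (γ t).2) t :=
    fun t ht => hasDerivAt_snd_comp (hγ t ht)
  have ht₀ : t₀ ∈ Ioo (t₀ - ε) (t₀ + ε) := ⟨by linarith, by linarith⟩
  have hc : ∀ t ∈ Ioo (t₀ - ε) (t₀ + ε),
      HasDerivAt (fun t => ((t, (γ t).1) : Base)) (1, (γ t).2) t := fun t ht =>
    (hasDerivAt_id t).prodMk (hx t ht)
  have hc0 : ((t₀, (γ t₀).1) : Base) = (t₀, x₀) := by rw [hγ0]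
  have hYd : ∀ t ∈ Ioo (t₀ - ε) (t₀ + ε), (t, (γ t).1) ∈ I ×ˢ D →
      HasDerivAt (fun t => T (t, (γ t).1)) (fderiv ℝ T (t, (γ t).1) (1, (γ t).2)) t :=
    fun t ht hmem => (hdT _ hmem).comp_hasDerivAt t (hc t ht)
  have hNd : HasDerivAt (fun t => fderiv ℝ T (t, (γ t).1) (1, (γ t).2)) N t₀ := by
    have h1 : HasDerivAt (fun t => fderiv ℝ T (t, (γ t).1))
        (fderiv ℝ (fderiv ℝ T) (t₀, x₀) (1, v₀)) t₀ := by
      have h2 := hc t₀ ht₀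
      rw [hγ0] at h2
      refine HasFDerivAt.comp_hasDerivAt t₀ ?_ h2
      rw [hc0]; exact hddT
    have h3 : HasDerivAt (fun t => ((1, (γ t).2) : Base)) (0, force P v₀) t₀ := by
      have h4 := (hasDerivAt_const t₀ (1 : ℝ)).prodMk (hv t₀ ht₀)
      rwa [hγ0] at h4
    have h5 := h1.clm_apply h3
    simp only [hγ0] at h5
    rwa [← hN] at h5
  have hY0 : fderiv ℝ T (t₀, (γ t₀).1) (1, (γ t₀).2) = Y := by rw [hY, hγ0]
  have hnear : ∀ᶠ t in 𝓝 t₀, t ∈ Ioo (t₀ - ε) (t₀ + ε) ∧ (t, (γ t).1) ∈ I ×ˢ D := by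
    refine Filter.Eventually.and (Ioo_mem_nhds ht₀.1 ht₀.2) ?_
    refine (hc t₀ ht₀).continuousAt.eventually_mem ?_
    rw [hc0]; exact hO.mem_nhds hq
  -- the new time as a function of the old one
  have hstrict : HasStrictDerivAt (fun t => (T (t, (γ t).1)).1) Y.1 t₀ := by
    have h1 := hasStrictDerivAt_of_hasDerivAt_of_continuousAt
      (f := fun t => (T (t, (γ t).1)).1)
      (f' := fun t => (fderiv ℝ T (t, (γ t).1) (1, (γ t).2)).1) (x := t₀)
      (hnear.mono fun t ht => hasDerivAt_fst_comp (hYd t ht.1 ht.2)) (hasDerivAt_fst_comp hNd).continuousAt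
    rwa [hY0] at h1
  -- Since `Y.1 ≠ 0`, the new time is a local parameter on the image of the solution curve.
  set φ := (hstrict.hasStrictFDerivAt_equiv hne).toOpenPartialHomeomorph _ with hφ
  have hφc : ∀ t, φ t = (T (t, (γ t).1)).1 := fun t => rfl
  have hsrc : t₀ ∈ φ.source :=
    (hstrict.hasStrictFDerivAt_equiv hne).mem_toOpenPartialHomeomorph_source
  obtain ⟨J, hJsub, hJo, hJ0⟩ := mem_nhds_iff.1
    (Filter.inter_mem hnear (φ.open_source.mem_nhds hsrc))
  have hJI : ∀ t ∈ J, t ∈ Ioo (t₀ - ε) (t₀ + ε) := fun t ht => (hJsub ht).1.1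
  have hJD : ∀ t ∈ J, (t, (γ t).1) ∈ I ×ˢ D := fun t ht => (hJsub ht).1.2
  have hJs : ∀ t ∈ J, φ.symm (φ t) = t := fun t ht => φ.left_inv (hJsub ht).2
  have hJ'o : IsOpen (φ '' J) := φ.isOpen_image_of_subset_source hJo fun t ht => (hJsub ht).2
  -- The image curve parametrised by the new time: the function whose graph is the image of the old
  -- graph over `J`.
  set y : ℝ → E3 := fun s => (T (φ.symm s, (γ (φ.symm s)).1)).2 with hy
  have hyφ : ∀ t ∈ J, y (φ t) = (T (t, (γ t).1)).2 := fun t ht => by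
    simp only [hy, hJs t ht]
  have hsol := hm.solutions J (φ '' J) (fun t => (γ t).1) y hJo hJ'o (fun t ht => (hJD t ht).1)
    (fun t ht => (hJD t ht).2)
    ⟨fun t => (γ t).2, fun t ht => ⟨hx t (hJI t ht), by
      rw [acceleration_affinePotential]; exact hv t (hJI t ht)⟩⟩
    (by
      ext p
      simp only [Set.graphOn, mem_image, exists_exists_and_eq_and]
      refine exists_congr fun t => and_congr_right fun ht => ?_
      rw [hyφ t ht, hφc])
  obtain ⟨w, hw⟩ := hsol
  -- The chain rule for `y ∘ φ` gives this relation on all of `J`, so that it may be differentiated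
  -- once more at `t₀`.
  have hw0 : ∀ t ∈ J, (fderiv ℝ T (t, (γ t).1) (1, (γ t).2)).1 • w (φ t) =
      (fderiv ℝ T (t, (γ t).1) (1, (γ t).2)).2 := fun t ht => by
    have h1 : HasDerivAt (fun t => y (φ t)) _ t :=
      (hw (φ t) (mem_image_of_mem _ ht)).1.scomp t (hasDerivAt_fst_comp (hYd t (hJI t ht) (hJD t ht)))
    have h2 : HasDerivAt (fun t => y (φ t)) _ t :=
      (hasDerivAt_snd_comp (hYd t (hJI t ht) (hJD t ht))).congr_of_eventuallyEq
        (by filter_upwards [hJo.mem_nhds ht] with s hs using hyφ s hs)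
    exact h1.unique h2
  have hwd : HasDerivAt (fun t => w (φ t))
      (Y.1 • acceleration A' Φ' (y (φ t₀)) (w (φ t₀))) t₀ := by
    have h1 := hasDerivAt_fst_comp (hYd t₀ ht₀ (hJD t₀ hJ0))
    rw [hY0] at h1
    exact (hw (φ t₀) (mem_image_of_mem _ hJ0)).2.scomp t₀ h1
  have h1 := (hasDerivAt_fst_comp hNd).smul hwd
  have h2 : HasDerivAt (fun t => (fderiv ℝ T (t, (γ t).1) (1, (γ t).2)).1 • w (φ t)) N.2 t₀ :=
    (hasDerivAt_snd_comp hNd).congr_of_eventuallyEq (by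
      filter_upwards [hJo.mem_nhds hJ0] with s hs using hw0 s hs)
  have h3 := h1.unique h2
  have h4 : w (φ t₀) = Y.1⁻¹ • Y.2 := by
    have := hw0 t₀ hJ0
    rw [hY0] at this
    rw [← this, inv_smul_smul₀ hne]
  rw [hY0, hyφ t₀ hJ0, hc0, h4] at h3
  rw [← h3, pow_two, mul_smul, add_comm]

end Forward

/-! ### Comparison of powers of the velocity -/

section Forward

variable {I : Set ℝ} {D : Set E3} {T : Base → Base} {U : Aug → Fib}

/-- The derivative of the new position with respect to the old one. -/
def spaceDeriv (T : Base → Base) (q : Base) : E3 →L[ℝ] E3 :=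
  (ContinuousLinearMap.snd ℝ ℝ E3).comp ((fderiv ℝ T q).comp (ContinuousLinearMap.inr ℝ ℝ E3))

/-- The derivative of the new time with respect to the old position. -/
def timeSpaceDeriv (T : Base → Base) (q : Base) : E3 →L[ℝ] ℝ :=
  (ContinuousLinearMap.fst ℝ ℝ E3).comp ((fderiv ℝ T q).comp (ContinuousLinearMap.inr ℝ ℝ E3))

/-- The derivative of the new time with respect to the old one. -/
def timeDeriv (T : Base → Base) (q : Base) : ℝ := (fderiv ℝ T q (1, 0)).1

theorem fderiv_apply_eq (h : IsPointTransformation I D T U) (hm : MapsAffineMembers I D T U)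
    (hI : IsOpen I) (hD : IsOpen D) {q : Base} (hq : q ∈ I ×ˢ D) (s : ℝ) (v : E3) :
    fderiv ℝ T q (s, v) = (timeDeriv T q * s + timeSpaceDeriv T q v, spaceDeriv T q v) := by
  have h1 : ((s, v) : Base) = s • (1, 0) + (0, v) := by simp
  have h2 := fderiv_time_space_eq_zero h hm hI hD hq
  rw [h1, map_add, map_smul]
  ext1
  · simp [timeDeriv, timeSpaceDeriv, mul_comm]
  · simp [h2, spaceDeriv]

theorem timeDeriv_ne_zero (h : IsPointTransformation I D T U) (hm : MapsAffineMembers I D T U)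
    (hI : IsOpen I) (hD : IsOpen D) {q : Base} (hq : q ∈ I ×ˢ D) : timeDeriv T q ≠ 0 := by
  intro h0
  have h1 := fderiv_apply_eq h hm hI hD hq 1 0
  rw [h0] at h1
  have h2 := (h.bijective_fderiv_base hI hD hq).1 (a₁ := (1, 0)) (a₂ := 0) (by rw [h1]; simp)
  simpa using congrArg Prod.fst h2

theorem spaceDeriv_injective (h : IsPointTransformation I D T U) (hm : MapsAffineMembers I D T U)
    (hI : IsOpen I) (hD : IsOpen D) {q : Base} (hq : q ∈ I ×ˢ D) :
    Function.Injective (spaceDeriv T q) := by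
  rw [injective_iff_map_eq_zero]
  intro u hu
  have hα := timeDeriv_ne_zero h hm hI hD hq
  have h1 := fderiv_apply_eq h hm hI hD hq (-(timeSpaceDeriv T q u / timeDeriv T q)) u
  have h2 := (h.bijective_fderiv_base hI hD hq).1
    (a₁ := (-(timeSpaceDeriv T q u / timeDeriv T q), u)) (a₂ := 0) (by
      rw [h1, hu, map_zero]
      ext1
      · simp only [Prod.fst_zero]; field_simp; ring
      · rfl)
  exact congrArg Prod.snd h2

/-- The coefficients of the powers of the velocity in the transformed equations of motion. -/
theorem transformed_coefficients (h : IsPointTransformation I D T U)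
    (hma : MapsAffineMembers I D T U) (hI : IsOpen I) (hD : IsOpen D) {q : Base}
    (hq : q ∈ I ×ˢ D) {a : Fib} {P : E3 →L[ℝ] Fib} {A' : E3 → E3} {Φ' : E3 → ℝ}
    (hm : MapsMember I D T U (fun z => (affinePotential a P q.2 z).1)
      (fun z => (affinePotential a P q.2 z).2) A' Φ')
    {Q : E3 →L[ℝ] Fib} (hQ : Q = (fderiv ℝ A' (T q).2).prod (fderiv ℝ Φ' (T q).2))
    {α : ℝ} {β : E3 →L[ℝ] ℝ} {M : E3 →L[ℝ] E3} {H : Base →L[ℝ] Base →L[ℝ] Base}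
    (hα : α = timeDeriv T q) (hβ : β = timeSpaceDeriv T q) (hM : M = spaceDeriv T q)
    (hH : H = fderiv ℝ (fderiv ℝ T) q) (v : E3) :
    α • M (force P 0) - α ^ 3 • force Q 0 = 0 ∧
    α • M (magForce P v) + β v • M (force P 0)
      - ((H (1, 0) (1, 0)).1 + β (force P 0)) • M v
      - α ^ 2 • magForce Q (M v) - (3 * α ^ 2 * β v) • force Q 0 = 0 ∧
    α • (H (0, v) (0, v)).2 + β v • M (magForce P v)
      - (2 * (H (1, 0) (0, v)).1 + β (magForce P v)) • M v
      - (2 * α * β v) • magForce Q (M v) - (3 * α * β v ^ 2) • force Q 0 = 0 := by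
  obtain ⟨t, x⟩ := q
  have hO : IsOpen (I ×ˢ D) := hI.prod hD
  have hα0 : α ≠ 0 := hα ▸ timeDeriv_ne_zero h hma hI hD hq
  have hsymm : ∀ u w, H u w = H w u := fun u w => by
    rw [hH]
    exact ((h.contDiffOn_base.contDiffAt (hO.mem_nhds hq)).isSymmSndFDerivAt two_le_infty) u w
  have hddT : DifferentiableAt ℝ (fderiv ℝ T) (t, x) :=
    (((contDiffOn_infty_iff_fderiv_of_isOpen hO).1 h.contDiffOn_base).2.contDiffAt
      (hO.mem_nhds hq)).differentiableAt (by simp)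
  have hH2 : ∀ u, (H u (1, 0)).2 = 0 := fun u => by
    rw [hH]
    exact clm_fderiv_eq_zero hddT ((ContinuousLinearMap.snd ℝ ℝ E3).comp
      (ContinuousLinearMap.apply ℝ Base (1, 0)))
      (Filter.mem_of_superset (hO.mem_nhds hq) fun y hy =>
        fderiv_time_space_eq_zero h hma hI hD hy) u
  -- The velocity is `s • v`. Only small `s` are available, because the new time must remain a
  -- parameter along the curve. The cubic coefficient `d` is not needed later.
  refine cubic_coeff_eq_zero (d := β v • (H (0, v) (0, v)).2 - (H (0, v) (0, v)).1 • M v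
    - β v ^ 2 • magForce Q (M v) - β v ^ 3 • force Q 0) ?_
  have hne : ∀ᶠ s : ℝ in 𝓝 0, α + s * β v ≠ 0 := by
    have : ContinuousAt (fun s : ℝ => α + s * β v) 0 := by fun_prop
    exact this.eventually_ne (by simpa using hα0)
  filter_upwards [hne] with s hs
  have hY : (α + s * β v, s • M v) = fderiv ℝ T (t, x) (1, s • v) := by
    rw [fderiv_apply_eq h hma hI hD hq, ← hα, ← hβ, ← hM]
    simp
  have key := transformed_equation h hI hD hq hm hY rfl hs
  rw [acceleration_eq_force, ← hQ, ← hH, fderiv_apply_eq h hma hI hD hq, ← hβ, ← hM,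
    force_smul] at key
  have hsplit : ((1, s • v) : Base) = (1, 0) + s • (0, v) := by simp
  have hHs : H (1, s • v) (1, s • v) =
      H (1, 0) (1, 0) + (2 * s) • H (1, 0) (0, v) + s ^ 2 • H (0, v) (0, v) := by
    rw [hsplit]
    simp only [map_add, map_smul, add_apply, smul_apply, hsymm (0, v) (1, 0)]
    module
  have h11 := hH2 (1, 0)
  have h10 : (H (1, 0) (0, v)).2 = 0 := by rw [hsymm]; exact hH2 _
  rw [hHs] at key
  simp only [Prod.fst_add, Prod.snd_add, Prod.smul_fst, Prod.smul_snd, h11, h10, smul_zero,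
    zero_add, mul_zero, map_add, map_smul, smul_eq_mul, smul_smul, force_smul] at key
  -- Multiplication by `Y.1 = α + s β(v)` clears the inverse in the new velocity and leaves a
  -- polynomial in `s`.
  have key' := congrArg (fun w => (α + s * β v) • w) key
  simp only [smul_add, smul_smul] at key'
  have c1 : ∀ r : ℝ, (α + s * β v) * (r * ((α + s * β v)⁻¹ * s)) = r * s := fun r => by
    field_simp
  have c2 : (α + s * β v) * ((α + s * β v) ^ 2 * ((α + s * β v)⁻¹ * s)) =
      (α + s * β v) ^ 2 * s := by
    field_simp
  simp only [← mul_assoc] at key' c1 c2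
  rw [c1, c2] at key'
  linear_combination (norm := module) -key'

end Forward

/-! ### Test fields and the resulting rigidity -/

section Forward

variable {I : Set ℝ} {D : Set E3} {T : Base → Base} {U : Aug → Fib}

/-- The new magnetic force does no work, so pairing the linear coefficient with the new velocity
removes it; the constant coefficient eliminates the new electric force. Only the derivatives of `T`
and the freely chosen `P` remain. -/
theorem transformed_inner (h : IsPointTransformation I D T U)
    (hma : MapsAffineMembers I D T U) (hI : IsOpen I) (hD : IsOpen D) {q : Base}
    (hq : q ∈ I ×ˢ D) (P : E3 →L[ℝ] Fib) (v : E3) :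
    timeDeriv T q * ⟪spaceDeriv T q (magForce P v), spaceDeriv T q v⟫_ℝ
      - 2 * timeSpaceDeriv T q v * ⟪spaceDeriv T q (force P 0), spaceDeriv T q v⟫_ℝ
      - ((fderiv ℝ (fderiv ℝ T) q (1, 0) (1, 0)).1 + timeSpaceDeriv T q (force P 0))
        * ‖spaceDeriv T q v‖ ^ 2 = 0 := by
  obtain ⟨A', Φ', hm⟩ := hma 0 P q.2
  obtain ⟨h0, h1, -⟩ := transformed_coefficients h hma hI hD hq hm rfl rfl rfl rfl rfl v
  have hα := timeDeriv_ne_zero h hma hI hD hq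
  have h0' := congrArg (fun w => ⟪w, spaceDeriv T q v⟫_ℝ) h0
  have h1' := congrArg (fun w => ⟪w, spaceDeriv T q v⟫_ℝ) h1
  simp only [inner_sub_left, inner_add_left, inner_smul_left, conj_trivial, inner_zero_left,
    inner_magForce_self, real_inner_self_eq_norm_sq] at h0' h1'
  have h2 : ⟪spaceDeriv T q (force P 0), spaceDeriv T q v⟫_ℝ = timeDeriv T q ^ 2 *
      ⟪force ((fderiv ℝ A' (T q).2).prod (fderiv ℝ Φ' (T q).2)) 0, spaceDeriv T q v⟫_ℝ := by
    refine mul_left_cancel₀ hα ?_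
    linear_combination h0'
  linear_combination h1' - 3 * timeSpaceDeriv T q v * h2

theorem spaceDeriv_ne_zero (h : IsPointTransformation I D T U)
    (hma : MapsAffineMembers I D T U) (hI : IsOpen I) (hD : IsOpen D) {q : Base}
    (hq : q ∈ I ×ˢ D) {v : E3} (hv : v ≠ 0) : ‖spaceDeriv T q v‖ ^ 2 ≠ 0 :=
  pow_ne_zero 2 (norm_ne_zero_iff.2 fun h0 =>
    hv (spaceDeriv_injective h hma hI hD hq (by rw [h0, map_zero])))

theorem e_ne_zero (i : Fin 3) : e i ≠ 0 := by
  simp [e]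

/-- Free motion: with no field, only the second time derivative survives in `transformed_inner`. -/
theorem fderiv_time_time_eq_zero (h : IsPointTransformation I D T U)
    (hma : MapsAffineMembers I D T U) (hI : IsOpen I) (hD : IsOpen D) {q : Base}
    (hq : q ∈ I ×ˢ D) : (fderiv ℝ (fderiv ℝ T) q (1, 0) (1, 0)).1 = 0 := by
  have h1 := transformed_inner h hma hI hD hq (electricJet 0) (e 0)
  simpa [magForce_electricJet, force_electricJet,
    spaceDeriv_ne_zero h hma hI hD hq (e_ne_zero 0)] using h1

/-- For an electric field equal to `v`, both remaining terms are multiples of `timeSpaceDeriv T q v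
* ‖spaceDeriv T q v‖ ^ 2`, with total factor `-3`. -/
theorem timeSpaceDeriv_eq_zero (h : IsPointTransformation I D T U)
    (hma : MapsAffineMembers I D T U) (hI : IsOpen I) (hD : IsOpen D) {q : Base}
    (hq : q ∈ I ×ˢ D) : timeSpaceDeriv T q = 0 := by
  ext1 v
  by_cases hv : v = 0
  · simp [hv]
  have h1 := transformed_inner h hma hI hD hq (electricJet v) v
  rw [magForce_electricJet, force_electricJet, fderiv_time_time_eq_zero h hma hI hD hq,
    real_inner_self_eq_norm_sq, map_zero, inner_zero_left] at h1
  have h2 : timeSpaceDeriv T q v * ‖spaceDeriv T q v‖ ^ 2 = 0 := by linarith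
  exact (mul_eq_zero.1 h2).resolve_right (spaceDeriv_ne_zero h hma hI hD hq hv)

/-- A magnetic field accelerating a particle of velocity `v` by `u ⊥ v` must become one whose force
is again orthogonal to the velocity. -/
theorem inner_spaceDeriv_eq_zero (h : IsPointTransformation I D T U)
    (hma : MapsAffineMembers I D T U) (hI : IsOpen I) (hD : IsOpen D) {q : Base}
    (hq : q ∈ I ×ˢ D) {u v : E3} (huv : ⟪u, v⟫_ℝ = 0) :
    ⟪spaceDeriv T q u, spaceDeriv T q v⟫_ℝ = 0 := by
  by_cases hv : v = 0
  · simp [hv]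
  have h1 := transformed_inner h hma hI hD hq (magneticJet u v) v
  rw [magForce_magneticJet hv huv, force_magneticJet_zero,
    fderiv_time_time_eq_zero h hma hI hD hq] at h1
  simpa [timeDeriv_ne_zero h hma hI hD hq] using h1

/-- The quadratic coefficient for the zero field. Its mixed derivative of the new time vanishes
because `timeSpaceDeriv` is zero throughout the domain. -/
theorem fderiv_space_space_eq_zero (h : IsPointTransformation I D T U)
    (hma : MapsAffineMembers I D T U) (hI : IsOpen I) (hD : IsOpen D) {q : Base}
    (hq : q ∈ I ×ˢ D) (v : E3) : (fderiv ℝ (fderiv ℝ T) q (0, v) (0, v)).2 = 0 := by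
  have hO : IsOpen (I ×ˢ D) := hI.prod hD
  obtain ⟨A', Φ', hm⟩ := hma 0 (electricJet 0) q.2
  obtain ⟨-, -, h2⟩ := transformed_coefficients h hma hI hD hq hm rfl rfl rfl rfl rfl v
  have hddT : DifferentiableAt ℝ (fderiv ℝ T) q :=
    (((contDiffOn_infty_iff_fderiv_of_isOpen hO).1 h.contDiffOn_base).2.contDiffAt
      (hO.mem_nhds hq)).differentiableAt (by simp)
  have h3 : (fderiv ℝ (fderiv ℝ T) q (1, 0) (0, v)).1 = 0 :=
    clm_fderiv_eq_zero (c := (0 : ℝ)) hddT ((ContinuousLinearMap.fst ℝ ℝ E3).comp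
      (ContinuousLinearMap.apply ℝ Base (0, v)))
      (Filter.mem_of_superset (hO.mem_nhds hq) fun y hy => by
        have := fderiv_apply_eq h hma hI hD hy 0 v
        rw [timeSpaceDeriv_eq_zero h hma hI hD hy] at this
        simp [this]) (1, 0)
  rw [h3, timeSpaceDeriv_eq_zero h hma hI hD hq, magForce_electricJet] at h2
  simpa [timeDeriv_ne_zero h hma hI hD hq] using h2

/-- The base component of an equivalence transformation is affine and conformal in space, and it
maps the forces accordingly. -/
theorem exists_affine_conformal (h : IsPointTransformation I D T U)
    (hma : MapsAffineMembers I D T U) (hI : IsOpen I) (hIc : IsPreconnected I) (hIne : I.Nonempty)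
    (hD : IsOpen D) (hDc : Convex ℝ D) (hDne : D.Nonempty) :
    ∃ (α τ c : ℝ) (M : E3 →L[ℝ] E3) (k : E3), α ≠ 0 ∧ 0 < c ∧
      (∀ u v, ⟪M u, M v⟫_ℝ = c * ⟪u, v⟫_ℝ) ∧
      (∀ q ∈ I ×ˢ D, T q = (α * q.1 + τ, M q.2 + k)) ∧
      ∀ q ∈ I ×ˢ D, ∀ (a : Fib) (P : E3 →L[ℝ] Fib), ∃ Q : E3 →L[ℝ] Fib,
        (∀ u, fderiv ℝ U (q, a) ((0, u), P u) = Q (M u)) ∧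
        (α ^ 2 • force Q 0 = M (force P 0)) ∧ ∀ v, α • magForce Q (M v) = M (magForce P v) := by
  have hO : IsOpen (I ×ˢ D) := hI.prod hD
  obtain ⟨α, τ, M, k, hT⟩ := exists_affine_of_fderiv hI hIc hIne hD hDc hDne h.contDiffOn_base
    (fun q hq => fderiv_time_space_eq_zero h hma hI hD hq)
    (fun q hq v => by
      have := fderiv_apply_eq h hma hI hD hq 0 v
      rw [timeSpaceDeriv_eq_zero h hma hI hD hq] at this
      simp [this])
    (fun q hq => fderiv_time_time_eq_zero h hma hI hD hq)
    (fun q hq v => fderiv_space_space_eq_zero h hma hI hD hq v)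
  have hα : ∀ q ∈ I ×ˢ D, timeDeriv T q = α := fun q hq => by
    simp [timeDeriv, (hT q hq).2]
  have hM : ∀ q ∈ I ×ˢ D, spaceDeriv T q = M := fun q hq => by
    refine ContinuousLinearMap.ext fun v => ?_
    simp [spaceDeriv, (hT q hq).2]
  obtain ⟨t₀, ht₀⟩ := hIne
  obtain ⟨x₀, hx₀⟩ := hDne
  have hq₀ : (t₀, x₀) ∈ I ×ˢ D := ⟨ht₀, hx₀⟩
  have hα0 : α ≠ 0 := hα _ hq₀ ▸ timeDeriv_ne_zero h hma hI hD hq₀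
  -- A linear map preserving orthogonality is conformal.
  obtain ⟨c, hc⟩ := exists_eq_mul_inner (fun u v => ⟪M u, M v⟫_ℝ)
    (fun u u' v => by simp [inner_add_left]) (fun s u v => by simp [inner_smul_left])
    (fun u v => real_inner_comm _ _)
    (fun u v huv => by
      have := inner_spaceDeriv_eq_zero h hma hI hD hq₀ huv
      rwa [hM _ hq₀] at this)
  have hcpos : 0 < c := by
    have h1 := hc (e 0) (e 0)
    have h2 := spaceDeriv_ne_zero h hma hI hD hq₀ (e_ne_zero 0)
    rw [hM _ hq₀] at h2
    have h3 : ‖e 0‖ ^ 2 = 1 := by simp [e]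
    simp only [real_inner_self_eq_norm_sq] at h1
    rw [h3, mul_one] at h1
    rw [← h1]
    positivity
  refine ⟨α, τ, c, M, k, hα0, hcpos, hc, fun q hq => (hT q hq).1, fun q hq a P => ?_⟩
  obtain ⟨A', Φ', hm⟩ := hma a P q.2
  refine ⟨(fderiv ℝ A' (T q).2).prod (fderiv ℝ Φ' (T q).2), fun u => ?_, ?_, fun v => ?_⟩
  · have hz : (q, a) ∈ augDomain I D := mem_augDomain.2 ⟨hq.1, hq.2⟩
    have hU : HasFDerivAt U (fderiv ℝ U (q, a)) (q, a) :=
      ((h.contDiffOn_fib.contDiffAt ((isOpen_augDomain hI hD).mem_nhds hz)).differentiableAt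
        (by simp)).hasFDerivAt
    have hin : HasFDerivAt (fun x : E3 => (((q.1, x), affinePotential a P q.2 x) : Aug))
        (((0 : E3 →L[ℝ] ℝ).prod (ContinuousLinearMap.id ℝ E3)).prod P) q.2 :=
      ((hasFDerivAt_const q.1 q.2).prodMk (hasFDerivAt_id q.2)).prodMk
        (hasFDerivAt_affinePotential a P q.2 q.2)
    have h1 : HasFDerivAt (fun x : E3 => U ((q.1, x), affinePotential a P q.2 x))
        ((fderiv ℝ U (q, a)).comp
          (((0 : E3 →L[ℝ] ℝ).prod (ContinuousLinearMap.id ℝ E3)).prod P)) q.2 := by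
      refine HasFDerivAt.comp q.2 ?_ hin
      rw [affinePotential_self]
      exact hU
    have hX : HasFDerivAt (fun x : E3 => M x + k) M q.2 := M.hasFDerivAt.add_const k
    have hTq : (T q).2 = M q.2 + k := by rw [(hT q hq).1]
    -- The new potentials are smooth only on the set of new positions; its openness gives honest
    -- derivatives there.
    have hIm := (isOpen_image_space h hI hD).mem_nhds (mem_image_of_mem (fun q => (T q).2) hq)
    have hA : HasFDerivAt A' (fderiv ℝ A' (T q).2) (M q.2 + k) := by
      rw [← hTq]
      exact ((hm.smooth_vector.contDiffAt hIm).differentiableAt (by simp)).hasFDerivAt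
    have hΦ : HasFDerivAt Φ' (fderiv ℝ Φ' (T q).2) (M q.2 + k) := by
      rw [← hTq]
      exact ((hm.smooth_scalar.contDiffAt hIm).differentiableAt (by simp)).hasFDerivAt
    -- The same function of `x` is differentiated through the new potentials; comparison with `h1`
    -- identifies the jet `Q` with the total derivative of `U`.
    have h2 : HasFDerivAt (fun x : E3 => U ((q.1, x), affinePotential a P q.2 x))
        (((fderiv ℝ A' (T q).2).comp M).prod ((fderiv ℝ Φ' (T q).2).comp M)) q.2 := by
      refine ((hA.comp q.2 hX).prodMk (hΦ.comp q.2 hX)).congr_of_eventuallyEq ?_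
      filter_upwards [hD.mem_nhds hq.2] with x hx
      have := hm.potentials q.1 hq.1 x hx
      rw [(hT (q.1, x) ⟨hq.1, hx⟩).1] at this
      exact this
    exact DFunLike.congr_fun (h1.unique h2) u
  · obtain ⟨h0, -, -⟩ := transformed_coefficients h hma hI hD hq hm rfl rfl rfl rfl rfl 0
    rw [hα q hq, hM q hq] at h0
    refine smul_right_injective E3 hα0 ?_
    simp only [smul_smul]
    linear_combination (norm := module) -h0
  · obtain ⟨-, h1, -⟩ := transformed_coefficients h hma hI hD hq hm rfl rfl rfl rfl rfl v
    rw [hα q hq, hM q hq, timeSpaceDeriv_eq_zero h hma hI hD hq,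
      fderiv_time_time_eq_zero h hma hI hD hq] at h1
    simp only [zero_apply, zero_smul, add_zero, mul_zero, sub_zero] at h1
    refine smul_right_injective E3 hα0 ?_
    simp only [smul_smul]
    linear_combination (norm := module) -h1

/-- The force law for `Q` says that `U.2 - c α⁻² Φ` has zero total derivative, and that `M.adjoint
U.1 - c α⁻¹ A`, the new one-form pulled back to the old position, has a symmetric one. The two
criteria on total derivatives then apply. -/
theorem exists_potential_form (h : IsPointTransformation I D T U)
    (hma : MapsAffineMembers I D T U) (hI : IsOpen I) (hIc : IsPreconnected I) (hIne : I.Nonempty)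
    (hD : IsOpen D) (hDc : Convex ℝ D) (hDne : D.Nonempty) :
    ∃ (α τ c ν : ℝ) (M : E3 →L[ℝ] E3) (k : E3) (f : E3 → ℝ), α ≠ 0 ∧ 0 < c ∧
      (∀ u v, ⟪M u, M v⟫_ℝ = c * ⟪u, v⟫_ℝ) ∧ ContDiffOn ℝ ∞ f D ∧
      ∀ z ∈ augDomain I D, (T z.1, U z) = ((α * z.1.1 + τ, M z.1.2 + k),
        (α⁻¹ • M z.2.1 + c⁻¹ • M (gradient f z.1.2), c * (α ^ 2)⁻¹ * z.2.2 + ν)) := by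
  obtain ⟨α, τ, c, M, k, hα, hc, hM, hT, hQ⟩ :=
    exists_affine_conformal h hma hI hIc hIne hD hDc hDne
  have hU : ∀ z ∈ augDomain I D, HasFDerivAt U (fderiv ℝ U z) z := fun z hz =>
    ((h.contDiffOn_fib.contDiffAt ((isOpen_augDomain hI hD).mem_nhds hz)).differentiableAt
      (by simp)).hasFDerivAt
  have hmem : ∀ z ∈ augDomain I D, z.1 ∈ I ×ˢ D := fun z hz => hz.1
  -- the scalar potential
  have hS : ∀ z ∈ augDomain I D, HasFDerivAt (fun z : Aug => (U z).2 - (c * (α ^ 2)⁻¹) * z.2.2)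
      ((ContinuousLinearMap.snd ℝ E3 ℝ).comp (fderiv ℝ U z) -
        (c * (α ^ 2)⁻¹) • (ContinuousLinearMap.snd ℝ E3 ℝ).comp
          (ContinuousLinearMap.snd ℝ Base Fib)) z := fun z hz =>
    ((ContinuousLinearMap.snd ℝ E3 ℝ).hasFDerivAt.comp z (hU z hz)).sub
      (((ContinuousLinearMap.snd ℝ E3 ℝ).comp
          (ContinuousLinearMap.snd ℝ Base Fib)).hasFDerivAt.const_mul _)
  obtain ⟨ν, hν⟩ := exists_const_of_totalDeriv_eq_zero hI hIc hD hDc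
    (W := fun z : Aug => (U z).2 - (c * (α ^ 2)⁻¹) * z.2.2)
    (fun z hz => (hS z hz).differentiableAt.differentiableWithinAt)
    (fun z hz => by
      rw [(hS z hz).fderiv]
      simp [fderiv_fib_time_eq_zero h hma hI hIc hD hz])
    (fun z hz P u => by
      obtain ⟨Q, hQ1, hQ2, -⟩ := hQ z.1 (hmem z hz) z.2 P
      rw [(hS z hz).fderiv]
      have h1 := congrArg (fun w => ⟪w, M u⟫_ℝ) hQ2
      simp only [inner_smul_left, conj_trivial, hM, inner_force_zero] at h1
      have h2 := hQ1 u
      simp only [sub_apply, ContinuousLinearMap.comp_apply,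
        smul_apply, ContinuousLinearMap.coe_snd', smul_eq_mul]
      rw [h2]
      field_simp
      linear_combination -h1)
  -- the vector potential
  have hV : ∀ z ∈ augDomain I D,
      HasFDerivAt (fun z : Aug => M.adjoint (U z).1 - (c * α⁻¹) • z.2.1)
      (M.adjoint.comp ((ContinuousLinearMap.fst ℝ E3 ℝ).comp (fderiv ℝ U z)) -
        (c * α⁻¹) • (ContinuousLinearMap.fst ℝ E3 ℝ).comp
          (ContinuousLinearMap.snd ℝ Base Fib)) z := fun z hz =>
    (M.adjoint.hasFDerivAt.comp z
      ((ContinuousLinearMap.fst ℝ E3 ℝ).hasFDerivAt.comp z (hU z hz))).sub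
      ((c * α⁻¹) • (ContinuousLinearMap.fst ℝ E3 ℝ).comp
          (ContinuousLinearMap.snd ℝ Base Fib)).hasFDerivAt
  obtain ⟨f, hf, hfW⟩ := exists_gradient_of_totalDeriv_symm hI hIc hIne hD hDc
    (W := fun z : Aug => M.adjoint (U z).1 - (c * α⁻¹) • z.2.1)
    ((M.adjoint.contDiff.comp_contDiffOn h.contDiffOn_fib.fst).sub
      (by fun_prop : ContDiff ℝ ∞ fun z : Aug => (c * α⁻¹) • z.2.1).contDiffOn)
    (fun z hz => by
      rw [(hV z hz).fderiv]
      simp [fderiv_fib_time_eq_zero h hma hI hIc hD hz])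
    (fun z hz P u w => by
      obtain ⟨Q, hQ1, -, hQ3⟩ := hQ z.1 (hmem z hz) z.2 P
      rw [(hV z hz).fderiv]
      have h1 := congrArg (fun y => ⟪y, M u⟫_ℝ) (hQ3 w)
      simp only [inner_smul_left, conj_trivial, hM, inner_magForce] at h1
      simp only [sub_apply, ContinuousLinearMap.comp_apply,
        smul_apply, ContinuousLinearMap.coe_fst', ContinuousLinearMap.coe_snd',
        inner_sub_left, ContinuousLinearMap.adjoint_inner_left, inner_smul_left, conj_trivial]
      rw [hQ1 u, hQ1 w]
      field_simp
      linear_combination h1)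
  -- Conformality gives `M.adjoint ∘ M = c`; surjectivity of `M` gives the other order, which undoes
  -- the pullback.
  have hMM : ∀ y, M (M.adjoint y) = c • y := by
    have h1 : ∀ u, M.adjoint (M u) = c • u := fun u => by
      refine ext_inner_right ℝ fun v => ?_
      rw [ContinuousLinearMap.adjoint_inner_left, hM, inner_smul_left, conj_trivial]
    have hinj : Function.Injective M := by
      rw [injective_iff_map_eq_zero]
      intro u hu
      have := h1 u
      rw [hu, map_zero] at this
      exact (smul_eq_zero_iff_right hc.ne').1 this.symm
    intro y
    obtain ⟨u, rfl⟩ := (LinearMap.injective_iff_surjective (f := (M : E3 →ₗ[ℝ] E3))).1 hinj y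
    simp [h1]
  refine ⟨α, τ, c, ν, M, k, f, hα, hc, hM, hf, fun z hz => ?_⟩
  rw [hT z.1 (hmem z hz)]
  refine Prod.ext rfl (Prod.ext ?_ ?_)
  · have h1 := congrArg M (hfW z hz)
    simp only [map_sub, map_smul, hMM] at h1
    rw [← h1, smul_sub, inv_smul_smul₀ hc.ne', smul_smul, ← mul_assoc, inv_mul_cancel₀ hc.ne',
      one_mul]
    simp
  · have h1 := hν z hz
    simp only at h1 ⊢
    linarith

end Forward

/-! ### Rotations -/

theorem exists_cos_sin_eq {p q : ℝ} (h : p ^ 2 + q ^ 2 = 1) :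
    ∃ θ, Real.cos θ = p ∧ Real.sin θ = q := by
  have hn : ‖(⟨p, q⟩ : ℂ)‖ = 1 := by
    rw [Complex.norm_eq_sqrt_sq_add_sq, h, Real.sqrt_one]
  have h0 : (⟨p, q⟩ : ℂ) ≠ 0 := fun h0 => by simp [h0] at hn
  refine ⟨Complex.arg ⟨p, q⟩, ?_, ?_⟩
  · rw [Complex.cos_arg h0, hn, div_one]
  · rw [Complex.sin_arg, hn, div_one]

theorem eq_zero_of_sq_add_sq_eq_zero {p q : ℝ} (h : p ^ 2 + q ^ 2 = 0) : p = 0 ∧ q = 0 := by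
  rw [add_eq_zero_iff_of_nonneg (sq_nonneg p) (sq_nonneg q)] at h
  exact ⟨pow_eq_zero_iff two_ne_zero |>.1 h.1, pow_eq_zero_iff two_ne_zero |>.1 h.2⟩

theorem rot1_transpose_mul (θ : ℝ) : (rot1 θ).transpose * rot1 θ = 1 := by
  have h := Real.sin_sq_add_cos_sq θ
  ext i j
  fin_cases i <;> fin_cases j <;> simp [rot1, Matrix.mul_apply, Fin.sum_univ_three] <;> linarith

theorem rot2_transpose_mul (θ : ℝ) : (rot2 θ).transpose * rot2 θ = 1 := by
  have h := Real.sin_sq_add_cos_sq θ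
  ext i j
  fin_cases i <;> fin_cases j <;> simp [rot2, Matrix.mul_apply, Fin.sum_univ_three] <;> linarith

theorem rot3_transpose_mul (θ : ℝ) : (rot3 θ).transpose * rot3 θ = 1 := by
  have h := Real.sin_sq_add_cos_sq θ
  ext i j
  fin_cases i <;> fin_cases j <;> simp [rot3, Matrix.mul_apply, Fin.sum_univ_three] <;> linarith

theorem det_rot1 (θ : ℝ) : (rot1 θ).det = 1 := by
  have h := Real.sin_sq_add_cos_sq θ
  simp [rot1, Matrix.det_fin_three]; linarith

theorem det_rot2 (θ : ℝ) : (rot2 θ).det = 1 := by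
  have h := Real.sin_sq_add_cos_sq θ
  simp [rot2, Matrix.det_fin_three]; linarith

/-- Every rotation matrix is a product of rotations about the three axes. -/
theorem exists_eq_rot_mul {A : Matrix (Fin 3) (Fin 3) ℝ} (hA : A.transpose * A = 1)
    (hdet : A.det = 1) : ∃ a b c, A = rot1 a * rot2 b * rot3 c := by
  have hcol : A 0 2 ^ 2 + A 1 2 ^ 2 + A 2 2 ^ 2 = 1 := by
    have := congrFun (congrFun hA 2) 2
    simp [Matrix.mul_apply, Fin.sum_univ_three] at this
    linarith
  -- The third column of `rot1 a * rot2 b` is `(sin b, -sin a cos b, cos a cos b)`. The angles are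
  -- chosen to match it with that of `A`, taking `cos b ≥ 0`; if `cos b = 0`, any `a` would do.
  obtain ⟨b, hb1, hb2⟩ := exists_cos_sin_eq (p := √(A 1 2 ^ 2 + A 2 2 ^ 2)) (q := A 0 2) (by
    rw [Real.sq_sqrt (by positivity)]; linarith)
  obtain ⟨a, ha1, ha2⟩ : ∃ a, Real.cos a * Real.cos b = A 2 2 ∧
      -(Real.sin a * Real.cos b) = A 1 2 := by
    rw [hb1]
    have hr := Real.sq_sqrt (x := A 1 2 ^ 2 + A 2 2 ^ 2) (by positivity)
    set r := √(A 1 2 ^ 2 + A 2 2 ^ 2)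
    by_cases h0 : r = 0
    · rw [h0] at hr ⊢
      obtain ⟨h1, h2⟩ := eq_zero_of_sq_add_sq_eq_zero (p := A 1 2) (q := A 2 2) (by
        rw [← hr]; simp)
      exact ⟨0, by simp [h2], by simp [h1]⟩
    · obtain ⟨a, ha1, ha2⟩ := exists_cos_sin_eq (p := A 2 2 / r) (q := -(A 1 2 / r)) (by
        field_simp; linarith)
      exact ⟨a, by rw [ha1]; field_simp, by rw [ha2]; field_simp⟩
  set B := rot1 a * rot2 b with hB
  have hB1 : B.transpose * B = 1 := by
    rw [hB, Matrix.transpose_mul, Matrix.mul_assoc, ← Matrix.mul_assoc (rot1 a).transpose,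
      rot1_transpose_mul, Matrix.one_mul, rot2_transpose_mul]
  have hB2 : B * B.transpose = 1 := mul_eq_one_comm.1 hB1
  have hBdet : B.transpose.det = 1 := by
    rw [Matrix.det_transpose, hB, Matrix.det_mul, det_rot1, det_rot2, one_mul]
  set Q := B.transpose * A with hQ
  have hBQ : B * Q = A := by rw [hQ, ← Matrix.mul_assoc, hB2, Matrix.one_mul]
  have hQ1 : Q.transpose * Q = 1 := by
    rw [hQ, Matrix.transpose_mul, Matrix.transpose_transpose, Matrix.mul_assoc,
      ← Matrix.mul_assoc B, hB2, Matrix.one_mul, hA]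
  have hQ2 : Q * Q.transpose = 1 := mul_eq_one_comm.1 hQ1
  have hQdet : Q.det = 1 := by rw [hQ, Matrix.det_mul, hBdet, hdet, one_mul]
  have hBcol : B 0 2 = A 0 2 ∧ B 1 2 = A 1 2 ∧ B 2 2 = A 2 2 := by
    simp [hB, rot1, rot2, ha1, ← ha2, hb2]
  -- After removal of `B` the third axis is fixed, so `Q` will be a rotation of the plane of the
  -- first two axes.
  have hQcol : ∀ i, Q i 2 = (1 : Matrix (Fin 3) (Fin 3) ℝ) i 2 := fun i => by
    rw [← hB1, hQ]
    simp [Matrix.mul_apply, Fin.sum_univ_three, hBcol]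
  have q02 : Q 0 2 = 0 := by simpa using hQcol 0
  have q12 : Q 1 2 = 0 := by simpa using hQcol 1
  have q22 : Q 2 2 = 1 := by simpa using hQcol 2
  have hrow : Q 2 0 ^ 2 + Q 2 1 ^ 2 = 0 := by
    have := congrFun (congrFun hQ2 2) 2
    simp [Matrix.mul_apply, Fin.sum_univ_three, q22] at this
    linarith
  obtain ⟨q20, q21⟩ := eq_zero_of_sq_add_sq_eq_zero hrow
  have h00 : Q 0 0 ^ 2 + Q 1 0 ^ 2 = 1 := by
    have := congrFun (congrFun hQ1 0) 0
    simp [Matrix.mul_apply, Fin.sum_univ_three, q20] at this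
    linarith
  have h11 : Q 0 1 ^ 2 + Q 1 1 ^ 2 = 1 := by
    have := congrFun (congrFun hQ1 1) 1
    simp [Matrix.mul_apply, Fin.sum_univ_three, q21] at this
    linarith
  rw [Matrix.det_fin_three, q02, q12, q22, q20, q21] at hQdet
  -- The left side is the sum of the squared lengths of the two planar columns minus twice the
  -- determinant, `1 + 1 - 2`.
  have hd : (Q 0 0 - Q 1 1) ^ 2 + (Q 0 1 + Q 1 0) ^ 2 = 0 := by linarith
  obtain ⟨e1, e2⟩ := eq_zero_of_sq_add_sq_eq_zero hd
  replace e1 : Q 1 1 = Q 0 0 := (sub_eq_zero.1 e1).symm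
  replace e2 : Q 0 1 = - Q 1 0 := eq_neg_of_add_eq_zero_left e2
  obtain ⟨c, hc1, hc2⟩ := exists_cos_sin_eq h00
  refine ⟨a, b, c, ?_⟩
  rw [← hB, ← hBQ]
  congr 1
  ext i j
  fin_cases i <;> fin_cases j <;> simp [rot3, hc1, hc2, e1, e2, q02, q12, q22, q20, q21]

theorem inner_toEuclideanLin {A : Matrix (Fin 3) (Fin 3) ℝ} (hA : A.transpose * A = 1)
    (u v : E3) : ⟪Matrix.toEuclideanLin A u, Matrix.toEuclideanLin A v⟫_ℝ = ⟪u, v⟫_ℝ := by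
  simp only [EuclideanSpace.inner_eq_star_dotProduct, Matrix.ofLp_toLpLin,
    Matrix.toLin'_apply, star_trivial]
  rw [Matrix.dotProduct_mulVec, Matrix.vecMul_mulVec, hA, Matrix.vecMul_one]

theorem inner_eulerRotation (ε : Fin 10 → ℝ) (u v : E3) :
    ⟪eulerRotation ε u, eulerRotation ε v⟫_ℝ = ⟪u, v⟫_ℝ := by
  refine inner_toEuclideanLin ?_ u v
  rw [Matrix.transpose_mul, Matrix.transpose_mul, Matrix.mul_assoc,
    ← Matrix.mul_assoc ((rot2 (ε 5)).transpose * (rot1 (ε 6)).transpose),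
    Matrix.mul_assoc (rot2 (ε 5)).transpose, ← Matrix.mul_assoc (rot1 (ε 6)).transpose,
    rot1_transpose_mul, Matrix.one_mul, rot2_transpose_mul, Matrix.one_mul, rot3_transpose_mul]

/-- The rotation `R₁(ε₆) R₂(ε₅) R₃(ε₄)` as a linear isometry. -/
def eulerIsometry (ε : Fin 10 → ℝ) : E3 ≃ₗᵢ[ℝ] E3 :=
  (LinearMap.isometryOfInner (eulerRotation ε) (inner_eulerRotation ε)).toLinearIsometryEquiv rfl

theorem eulerIsometry_apply (ε : Fin 10 → ℝ) (u : E3) :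
    eulerIsometry ε u = eulerRotation ε u := rfl

/-- Every conformal linear map is a multiple of a product of rotations about the three axes. -/
theorem exists_eq_smul_rotation {M : E3 →L[ℝ] E3} {c : ℝ} (hc : 0 < c)
    (hM : ∀ u v, ⟪M u, M v⟫_ℝ = c * ⟪u, v⟫_ℝ) :
    ∃ (r θ₄ θ₅ θ₆ : ℝ), r ≠ 0 ∧ r ^ 2 = c ∧ ∀ ε : Fin 10 → ℝ, ε 4 = θ₄ → ε 5 = θ₅ → ε 6 = θ₆ →
      ∀ x, M x = r • eulerRotation ε x := by
  have horth : ∀ r : ℝ, r ≠ 0 → r ^ 2 = c →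
      (Matrix.of fun i j => r⁻¹ * M (e j) i : Matrix (Fin 3) (Fin 3) ℝ).transpose *
        Matrix.of (fun i j => r⁻¹ * M (e j) i) = 1 := by
    intro r hr hrc
    ext i j
    have h1 := hM (e i) (e j)
    rw [PiLp.inner_apply, Fin.sum_univ_three] at h1
    simp only [RCLike.inner_apply, conj_trivial] at h1
    rw [Matrix.mul_apply, Fin.sum_univ_three]
    simp only [Matrix.transpose_apply, Matrix.of_apply]
    have h2 : ⟪e i, e j⟫_ℝ = (1 : Matrix (Fin 3) (Fin 3) ℝ) i j := by
      simp [e, EuclideanSpace.inner_single_right, Matrix.one_apply, eq_comm]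
    rw [h2] at h1
    field_simp
    rw [hrc]
    linarith
  have main : ∀ r : ℝ, r ≠ 0 → r ^ 2 = c →
      (Matrix.of fun i j => r⁻¹ * M (e j) i : Matrix (Fin 3) (Fin 3) ℝ).det = 1 →
      ∃ (r θ₄ θ₅ θ₆ : ℝ), r ≠ 0 ∧ r ^ 2 = c ∧
        ∀ ε : Fin 10 → ℝ, ε 4 = θ₄ → ε 5 = θ₅ → ε 6 = θ₆ →
          ∀ x, M x = r • eulerRotation ε x := by
    intro r hr hrc hdet
    obtain ⟨θ₆, θ₅, θ₄, h⟩ := exists_eq_rot_mul (A := Matrix.of fun i j => r⁻¹ * M (e j) i) (horth r hr hrc) hdet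
    refine ⟨r, θ₄, θ₅, θ₆, hr, hrc, ?_⟩
    rintro ε rfl rfl rfl x
    rw [eulerRotation, ← h]
    conv_lhs => rw [eq_sum_basis x]
    ext i
    simp only [map_add, map_smul, PiLp.add_apply, PiLp.smul_apply, smul_eq_mul,
      Matrix.ofLp_toLpLin, Matrix.toLin'_apply, Matrix.mulVec, dotProduct,
      Fin.sum_univ_three, Matrix.of_apply]
    field_simp
  have hs : √c ^ 2 = c := Real.sq_sqrt hc.le
  have hs0 : √c ≠ 0 := (Real.sqrt_pos.2 hc).ne'
  set A : Matrix (Fin 3) (Fin 3) ℝ := Matrix.of fun i j => (√c)⁻¹ * M (e j) i with hA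
  have hdet : A.det ^ 2 = 1 := by
    have := congrArg Matrix.det (horth _ hs0 hs)
    rwa [Matrix.det_mul, Matrix.det_transpose, Matrix.det_one, ← pow_two] at this
  rcases mul_self_eq_one_iff.1 ((pow_two _).symm.trans hdet) with h1 | h1
  · exact main _ hs0 hs h1
  -- In odd dimension, changing the sign of the factor changes the sign of the determinant.
  · refine main (-√c) (neg_ne_zero.2 hs0) (by rw [neg_sq, hs]) ?_
    have : (Matrix.of fun i j => (-√c)⁻¹ * M (e j) i : Matrix (Fin 3) (Fin 3) ℝ) = -A := by
      ext i j
      simp [hA, inv_neg]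
    rw [this, Matrix.det_neg, h1]
    simp; norm_num

/-! ### Gradients -/

theorem inner_gradient (g : E3 → ℝ) (z w : E3) : ⟪gradient g z, w⟫_ℝ = fderiv ℝ g z w :=
  inner_gradient_left

theorem gradient_apply (g : E3 → ℝ) (z : E3) (i : Fin 3) :
    gradient g z i = fderiv ℝ g z (e i) := by
  rw [← inner_gradient, e, EuclideanSpace.inner_single_right, conj_trivial, one_mul]

theorem contDiffOn_gradient {s : Set E3} (hs : IsOpen s) {g : E3 → ℝ} (hg : ContDiffOn ℝ ∞ g s) :
    ContDiffOn ℝ ∞ (gradient g) s := by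
  rw [contDiffOn_euclidean]
  intro i
  simp only [gradient_apply]
  exact ((contDiffOn_infty_iff_fderiv_of_isOpen hs).1 hg).2.clm_apply contDiffOn_const

theorem hasFDerivAt_gradient {s : Set E3} (hs : IsOpen s) {g : E3 → ℝ} (hg : ContDiffOn ℝ ∞ g s)
    {z : E3} (hz : z ∈ s) : HasFDerivAt (gradient g) (fderiv ℝ (gradient g) z) z :=
  (((contDiffOn_gradient hs hg).contDiffAt (hs.mem_nhds hz)).differentiableAt
    (by simp)).hasFDerivAt

theorem inner_fderiv_gradient {s : Set E3} (hs : IsOpen s) {g : E3 → ℝ} (hg : ContDiffOn ℝ ∞ g s)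
    {z : E3} (hz : z ∈ s) (u w : E3) :
    ⟪fderiv ℝ (gradient g) z u, w⟫_ℝ = fderiv ℝ (fderiv ℝ g) z u w := by
  have h1 : HasFDerivAt (fun z => ⟪w, gradient g z⟫_ℝ)
      ((innerSL ℝ w).comp (fderiv ℝ (gradient g) z)) z :=
    (innerSL ℝ w).hasFDerivAt.comp z (hasFDerivAt_gradient hs hg hz)
  have h2 : HasFDerivAt (fderiv ℝ g) (fderiv ℝ (fderiv ℝ g) z) z :=
    ((((contDiffOn_infty_iff_fderiv_of_isOpen hs).1 hg).2.contDiffAt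
      (hs.mem_nhds hz)).differentiableAt (by simp)).hasFDerivAt
  have h3 : HasFDerivAt (fun z => ⟪w, gradient g z⟫_ℝ)
      ((ContinuousLinearMap.apply ℝ ℝ w).comp (fderiv ℝ (fderiv ℝ g) z)) z := by
    have : (fun z => ⟪w, gradient g z⟫_ℝ) = fun z => fderiv ℝ g z w := by
      funext z
      rw [real_inner_comm, inner_gradient]
    rw [this]
    exact (ContinuousLinearMap.apply ℝ ℝ w).hasFDerivAt.comp z h2
  have h4 := DFunLike.congr_fun (h1.unique h3) u
  rw [real_inner_comm]
  exact h4

/-- Symmetry of the Hessian: the reason why a gauge term exerts no magnetic force. -/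
theorem inner_fderiv_gradient_comm {s : Set E3} (hs : IsOpen s) {g : E3 → ℝ}
    (hg : ContDiffOn ℝ ∞ g s) {z : E3} (hz : z ∈ s) (u w : E3) :
    ⟪fderiv ℝ (gradient g) z u, w⟫_ℝ = ⟪fderiv ℝ (gradient g) z w, u⟫_ℝ := by
  rw [inner_fderiv_gradient hs hg hz, inner_fderiv_gradient hs hg hz]
  exact ((hg.contDiffAt (hs.mem_nhds hz)).isSymmSndFDerivAt two_le_infty) u w

theorem gradient_eq_of_hasFDerivAt {f : E3 → ℝ} {L : E3 →L[ℝ] ℝ} {x w : E3}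
    (hf : HasFDerivAt f L x) (h : ∀ u, L u = ⟪w, u⟫_ℝ) : gradient f x = w := by
  refine ext_inner_right ℝ fun u => ?_
  rw [inner_gradient, hf.fderiv, h]

/-! ### The explicit transformations -/

section Explicit

variable {ε : Fin 10 → ℝ}

/-- The inverse of `spaceMap ε`. -/
def spaceInv (ε : Fin 10 → ℝ) (z : E3) : E3 :=
  (ε 7)⁻¹ • (eulerIsometry ε).symm (z - !₂[ε 1, ε 2, ε 3])

theorem spaceInv_spaceMap (h7 : ε 7 ≠ 0) (x : E3) : spaceInv ε (spaceMap ε x) = x := by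
  rw [spaceInv, spaceMap, add_sub_cancel_right, map_smul, inv_smul_smul₀ h7,
    ← eulerIsometry_apply, LinearIsometryEquiv.symm_apply_apply]

theorem spaceMap_spaceInv (h7 : ε 7 ≠ 0) (z : E3) : spaceMap ε (spaceInv ε z) = z := by
  rw [spaceInv, spaceMap, map_smul, smul_inv_smul₀ h7, ← eulerIsometry_apply,
    LinearIsometryEquiv.apply_symm_apply, sub_add_cancel]

/-- The linear part of `spaceMap ε`. -/
def spaceLin (ε : Fin 10 → ℝ) : E3 →L[ℝ] E3 := ε 7 • (eulerIsometry ε : E3 →L[ℝ] E3)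

/-- The linear part of `spaceInv ε`. -/
def spaceInvLin (ε : Fin 10 → ℝ) : E3 →L[ℝ] E3 := (ε 7)⁻¹ • ((eulerIsometry ε).symm : E3 →L[ℝ] E3)

theorem spaceLin_apply (u : E3) : spaceLin ε u = ε 7 • eulerIsometry ε u := rfl

theorem spaceInvLin_apply (u : E3) : spaceInvLin ε u = (ε 7)⁻¹ • (eulerIsometry ε).symm u := rfl

theorem spaceMap_eq (x : E3) : spaceMap ε x = spaceLin ε x + !₂[ε 1, ε 2, ε 3] := rfl

theorem spaceInv_eq (z : E3) : spaceInv ε z = spaceInvLin ε (z - !₂[ε 1, ε 2, ε 3]) := rfl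

theorem hasFDerivAt_spaceMap (x : E3) : HasFDerivAt (spaceMap ε) (spaceLin ε) x :=
  (spaceLin ε).hasFDerivAt.add_const _

theorem hasFDerivAt_spaceInv (z : E3) : HasFDerivAt (spaceInv ε) (spaceInvLin ε) z :=
  (spaceInvLin ε).hasFDerivAt.comp z ((hasFDerivAt_id z).sub_const _)

theorem contDiff_spaceMap : ContDiff ℝ ∞ (spaceMap ε) :=
  (spaceLin ε).contDiff.add contDiff_const

theorem contDiff_spaceInv : ContDiff ℝ ∞ (spaceInv ε) :=
  (spaceInvLin ε).contDiff.comp (contDiff_id.sub contDiff_const)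

theorem image_spaceMap (h7 : ε 7 ≠ 0) (D : Set E3) : spaceMap ε '' D = spaceInv ε ⁻¹' D :=
  congrFun (image_eq_preimage_of_inverse (spaceInv_spaceMap h7) (spaceMap_spaceInv h7)) D

theorem isOpen_image_spaceMap (h7 : ε 7 ≠ 0) {D : Set E3} (hD : IsOpen D) :
    IsOpen (spaceMap ε '' D) := by
  rw [image_spaceMap h7]
  exact hD.preimage contDiff_spaceInv.continuous

theorem inner_eulerIsometry (u v : E3) :
    ⟪eulerIsometry ε u, v⟫_ℝ = ⟪u, (eulerIsometry ε).symm v⟫_ℝ := by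
  conv_lhs => rw [← (eulerIsometry ε).apply_symm_apply v]
  rw [LinearIsometryEquiv.inner_map_map]

theorem hasFDerivAt_comp_spaceInv (h7 : ε 7 ≠ 0) {f : E3 → ℝ} {x : E3}
    (hf : DifferentiableAt ℝ f x) : HasFDerivAt (fun z => f (spaceInv ε z))
      ((fderiv ℝ f x).comp (spaceInvLin ε)) (spaceMap ε x) := by
  refine HasFDerivAt.comp (spaceMap ε x) ?_ (hasFDerivAt_spaceInv _)
  rw [spaceInv_spaceMap h7]
  exact hf.hasFDerivAt

theorem gradient_comp_spaceInv (h7 : ε 7 ≠ 0) {f : E3 → ℝ} {x : E3}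
    (hf : DifferentiableAt ℝ f x) :
    gradient (fun z => f (spaceInv ε z)) (spaceMap ε x) =
      (ε 7)⁻¹ • eulerRotation ε (gradient f x) := by
  refine gradient_eq_of_hasFDerivAt (hasFDerivAt_comp_spaceInv h7 hf) fun u => ?_
  rw [ContinuousLinearMap.comp_apply, ← inner_gradient, spaceInvLin_apply, inner_smul_right,
    inner_smul_left, ← eulerIsometry_apply, inner_eulerIsometry, conj_trivial]

/-- A map of the form of the explicit transformations, given by a conformal linear map, comes
from parameters. -/
theorem exists_param {α τ c ν : ℝ} {M : E3 →L[ℝ] E3} {k : E3} (hα : α ≠ 0) (hc : 0 < c)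
    (hM : ∀ u v, ⟪M u, M v⟫_ℝ = c * ⟪u, v⟫_ℝ) :
    ∃ ε : Fin 10 → ℝ, ε 7 ≠ 0 ∧ ε 8 ≠ 0 ∧ ε 7 ^ 2 = c ∧ (∀ x, spaceMap ε x = M x + k) ∧
      (∀ x, M x = ε 7 • eulerRotation ε x) ∧
      ∀ (g : E3 → ℝ) (p : Aug), groupMap ε g p = ((α * p.1.1 + τ, M p.1.2 + k),
        (α⁻¹ • M p.2.1 + gradient g (M p.1.2 + k), c * (α ^ 2)⁻¹ * p.2.2 + ν)) := by
  obtain ⟨r, θ₄, θ₅, θ₆, hr, hrc, h⟩ := exists_eq_smul_rotation hc hM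
  set ε : Fin 10 → ℝ := ![τ, k 0, k 1, k 2, θ₄, θ₅, θ₆, r, α, ν] with hε
  have hMR : ∀ x, M x = r • eulerRotation ε x := h ε rfl rfl rfl
  have hk : (!₂[ε 1, ε 2, ε 3] : E3) = k := by
    ext i
    fin_cases i <;> simp [hε]
  have hS : ∀ x, spaceMap ε x = M x + k := fun x => by rw [spaceMap, hk, hMR]; rfl
  refine ⟨ε, hr, hα, hrc, hS, hMR, fun g p => ?_⟩
  rw [groupMap, hS, hMR p.2.1, smul_smul, mul_comm α⁻¹, ← hrc]
  rfl

theorem spaceMap_injective (h7 : ε 7 ≠ 0) : Function.Injective (spaceMap ε) :=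
  Function.LeftInverse.injective (spaceInv_spaceMap h7)

/-- The inverse of `groupMap ε g`. -/
def groupInv (ε : Fin 10 → ℝ) (g : E3 → ℝ) (p : Aug) : Aug :=
  (((ε 8)⁻¹ * (p.1.1 - ε 0), spaceInv ε p.1.2),
   ((ε 8 * (ε 7)⁻¹) • (eulerIsometry ε).symm (p.2.1 - gradient g p.1.2),
    ε 8 ^ 2 * (ε 7 ^ 2)⁻¹ * (p.2.2 - ε 9)))

theorem groupInv_groupMap (h7 : ε 7 ≠ 0) (h8 : ε 8 ≠ 0) (g : E3 → ℝ) (p : Aug) :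
    groupInv ε g (groupMap ε g p) = p := by
  refine Prod.ext (Prod.ext ?_ ?_) (Prod.ext ?_ ?_)
  · simp only [groupInv, groupMap]; field_simp; ring
  · exact spaceInv_spaceMap h7 _
  · simp only [groupInv, groupMap]
    rw [add_sub_cancel_right, map_smul, smul_smul, ← eulerIsometry_apply,
      LinearIsometryEquiv.symm_apply_apply]
    have : ε 8 * (ε 7)⁻¹ * (ε 7 * (ε 8)⁻¹) = 1 := by field_simp
    rw [this, one_smul]
  · simp only [groupInv, groupMap]; field_simp; ring

theorem groupMap_groupInv (h7 : ε 7 ≠ 0) (h8 : ε 8 ≠ 0) (g : E3 → ℝ) (p : Aug) :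
    groupMap ε g (groupInv ε g p) = p := by
  refine Prod.ext (Prod.ext ?_ ?_) (Prod.ext ?_ ?_)
  · simp only [groupInv, groupMap]; field_simp; ring
  · exact spaceMap_spaceInv h7 _
  · simp only [groupInv, groupMap]
    rw [map_smul, smul_smul, ← eulerIsometry_apply,
      LinearIsometryEquiv.apply_symm_apply, spaceMap_spaceInv h7]
    have : ε 7 * (ε 8)⁻¹ * (ε 8 * (ε 7)⁻¹) = 1 := by field_simp
    rw [this, one_smul, sub_add_cancel]
  · simp only [groupInv, groupMap]; field_simp; ring

/-! ### The group of transformations -/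

theorem eulerRotation_idParam (x : E3) : eulerRotation idParam x = x := by
  ext i
  fin_cases i <;>
    simp [eulerRotation, idParam, rot1, rot2, rot3, Matrix.mulVec, dotProduct,
      Fin.sum_univ_three]

theorem spaceMap_idParam (x : E3) : spaceMap idParam x = x := by
  rw [spaceMap, eulerRotation_idParam]
  ext i
  fin_cases i <;> simp [idParam]

theorem gradient_zero (x : E3) : gradient (0 : E3 → ℝ) x = 0 := gradient_const x 0

theorem groupMap_idParam_apply (g : E3 → ℝ) (p : Aug) :
    groupMap idParam g p = p + gaugeField g p := by
  rw [groupMap, spaceMap_idParam, eulerRotation_idParam]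
  refine Prod.ext ?_ (Prod.ext ?_ ?_) <;> simp [idParam, gaugeField]

theorem groupMap_idParam : groupMap idParam 0 = id := by
  funext p
  rw [groupMap_idParam_apply, gaugeField, gradient_zero]
  simp

theorem comp_mem_transformations {Ψ Ψ' : Aug → Aug} (h : Ψ ∈ transformations)
    (h' : Ψ' ∈ transformations) : Ψ ∘ Ψ' ∈ transformations := by
  obtain ⟨ε, g, h7, h8, hg, rfl⟩ := h
  obtain ⟨ε', g', h7', h8', hg', rfl⟩ := h'
  -- The composite linear map is conformal, so `exists_param` provides angles for it without any
  -- composition law for the three rotations.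
  obtain ⟨ε'', h7'', h8'', -, -, -, hf⟩ := exists_param (α := ε 8 * ε' 8)
    (τ := ε 8 * ε' 0 + ε 0) (c := (ε 7 * ε' 7) ^ 2)
    (ν := ε 7 ^ 2 * (ε 8 ^ 2)⁻¹ * ε' 9 + ε 9) (M := (spaceLin ε).comp (spaceLin ε'))
    (k := spaceMap ε !₂[ε' 1, ε' 2, ε' 3]) (mul_ne_zero h8 h8') (by positivity) (fun u v => by
      simp only [ContinuousLinearMap.comp_apply, spaceLin_apply, inner_smul_left, inner_smul_right,
        LinearIsometryEquiv.inner_map_map, conj_trivial]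
      ring)
  -- The inner gradient is multiplied by `ε 7 * (ε 8)⁻¹` and rotated, while the gradient of `g' ∘
  -- spaceInv ε` carries a factor `(ε 7)⁻¹`; the coefficient balances the two.
  refine ⟨ε'', fun y => g y + (ε 7 ^ 2 * (ε 8)⁻¹) * g' (spaceInv ε y), h7'', h8'',
    hg.add (contDiff_const.mul (hg'.comp contDiff_spaceInv)), ?_⟩
  funext p
  have hS : (spaceLin ε).comp (spaceLin ε') p.1.2 + spaceMap ε !₂[ε' 1, ε' 2, ε' 3] =
      spaceMap ε (spaceMap ε' p.1.2) := by
    rw [spaceMap_eq, spaceMap_eq, spaceMap_eq, map_add, ContinuousLinearMap.comp_apply]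
    abel
  rw [hf, hS]
  have hgrad : gradient (fun y => g y + (ε 7 ^ 2 * (ε 8)⁻¹) * g' (spaceInv ε y))
      (spaceMap ε (spaceMap ε' p.1.2)) = gradient g (spaceMap ε (spaceMap ε' p.1.2)) +
        (ε 7 * (ε 8)⁻¹) • eulerRotation ε (gradient g' (spaceMap ε' p.1.2)) := by
    have hd := hg.differentiable (by simp) (spaceMap ε (spaceMap ε' p.1.2))
    have hd' := hg'.differentiable (by simp) (spaceMap ε' p.1.2)
    refine gradient_eq_of_hasFDerivAt
      (hd.hasFDerivAt.add ((hasFDerivAt_comp_spaceInv h7 hd').const_mul _)) fun u => ?_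
    simp only [add_apply, smul_apply, ContinuousLinearMap.comp_apply, ← inner_gradient,
      spaceInvLin_apply, inner_smul_right, inner_add_left, inner_smul_left, conj_trivial,
      ← eulerIsometry_apply, inner_eulerIsometry, smul_eq_mul]
    field_simp
  rw [hgrad]
  refine Prod.ext (Prod.ext ?_ rfl) (Prod.ext ?_ ?_)
  · simp only [Function.comp_apply, groupMap]; ring
  · simp only [Function.comp_apply, groupMap, ContinuousLinearMap.comp_apply, spaceLin_apply,
      map_add, map_smul, smul_add, smul_smul, mul_inv, ← eulerIsometry_apply]
    rw [add_assoc, add_comm (gradient g _)]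
    congr 2
    ring
  · simp only [Function.comp_apply, groupMap]
    field_simp
    ring

theorem exists_inverse_mem_transformations {Ψ : Aug → Aug} (h : Ψ ∈ transformations) :
    ∃ Ψ' ∈ transformations, Ψ ∘ Ψ' = id ∧ Ψ' ∘ Ψ = id := by
  obtain ⟨ε, g, h7, h8, hg, rfl⟩ := h
  refine ⟨groupInv ε g, ?_, funext fun p => groupMap_groupInv h7 h8 g p,
    funext fun p => groupInv_groupMap h7 h8 g p⟩
  obtain ⟨ε'', h7'', h8'', -, -, -, hf⟩ := exists_param (α := (ε 8)⁻¹)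
    (τ := -((ε 8)⁻¹ * ε 0)) (c := ((ε 7) ^ 2)⁻¹)
    (ν := -(ε 8 ^ 2 * (ε 7 ^ 2)⁻¹ * ε 9)) (M := spaceInvLin ε)
    (k := spaceInv ε 0) (inv_ne_zero h8) (by positivity) (fun u v => by
      simp only [spaceInvLin_apply, inner_smul_left, inner_smul_right,
        LinearIsometryEquiv.inner_map_map, conj_trivial]
      field_simp)
  -- Here the gradient of `g ∘ spaceMap ε` contributes a factor `ε 7` and the inverse rotation,
  -- leaving the required `-(ε 8 * (ε 7)⁻¹)`.
  refine ⟨ε'', fun y => -(ε 8 * (ε 7 ^ 2)⁻¹) * g (spaceMap ε y), h7'', h8'',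
    contDiff_const.mul (hg.comp contDiff_spaceMap), ?_⟩
  funext p
  have hS : spaceInvLin ε p.1.2 + spaceInv ε 0 = spaceInv ε p.1.2 := by
    rw [spaceInv_eq, spaceInv_eq, ← map_add]
    congr 1
    abel
  rw [hf, hS]
  have hgrad : gradient (fun y => -(ε 8 * (ε 7 ^ 2)⁻¹) * g (spaceMap ε y)) (spaceInv ε p.1.2) =
      -((ε 8 * (ε 7)⁻¹) • (eulerIsometry ε).symm (gradient g p.1.2)) := by
    have hd := hg.differentiable (by simp) (spaceMap ε (spaceInv ε p.1.2))
    refine gradient_eq_of_hasFDerivAt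
      ((hd.hasFDerivAt.comp _ (hasFDerivAt_spaceMap _)).const_mul _) fun u => ?_
    simp only [smul_apply, ContinuousLinearMap.comp_apply, ← inner_gradient, spaceMap_spaceInv h7,
      spaceLin_apply, inner_smul_right, inner_neg_left, inner_smul_left, conj_trivial,
      smul_eq_mul]
    rw [real_inner_comm, inner_eulerIsometry, real_inner_comm]
    field_simp
  rw [hgrad]
  refine Prod.ext (Prod.ext ?_ rfl) (Prod.ext ?_ ?_)
  · simp only [groupInv]; ring
  · simp only [groupInv, spaceInvLin_apply, map_sub, smul_sub, smul_smul, inv_inv]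
    rw [sub_eq_add_neg]
  · simp only [groupInv]
    field_simp
    ring

end Explicit

/-! ### The explicit transformations are exactly the equivalence transformations -/

section EquivalenceGroup

variable {I : Set ℝ} {D : Set E3} {ε : Fin 10 → ℝ} {g : E3 → ℝ}

theorem exists_groupMap_of_isEquivalenceTransformation (hI : IsOpen I) (hIc : IsPreconnected I)
    (hIne : I.Nonempty) (hD : IsOpen D) (hDc : Convex ℝ D) (hDne : D.Nonempty) {Ψ : Aug → Aug}
    (h : IsEquivalenceTransformation I D Ψ) :
    ∃ (ε : Fin 10 → ℝ) (g : E3 → ℝ), ε 7 ≠ 0 ∧ ε 8 ≠ 0 ∧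
      ContDiffOn ℝ ∞ g (spaceMap ε '' D) ∧ Set.EqOn Ψ (groupMap ε g) (augDomain I D) := by
  obtain ⟨T, U, hΨ, hpt, hm⟩ := h
  have hma : MapsAffineMembers I D T U := fun a P x₀ =>
    hm _ _ (contDiff_affinePotential a P x₀).fst.contDiffOn
      (contDiff_affinePotential a P x₀).snd.contDiffOn
  obtain ⟨α, τ, c, ν, M, k, f, hα, hc, hM, hf, hTU⟩ :=
    exists_potential_form hpt hma hI hIc hIne hD hDc hDne
  obtain ⟨ε, h7, h8, h7c, hS, hMR, hgm⟩ := exists_param (τ := τ) (ν := ν) (k := k) hα hc hM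
  -- The Poincaré lemma produced `f` as a function of the old position; the gauge function is the
  -- same function read at the new one.
  refine ⟨ε, fun z => f (spaceInv ε z), h7, h8, ?_, fun z hz => ?_⟩
  · refine hf.comp contDiff_spaceInv.contDiffOn fun z hz => ?_
    rwa [image_spaceMap h7] at hz
  · have hd : DifferentiableAt ℝ f z.1.2 :=
      (hf.contDiffAt (hD.mem_nhds (mem_augDomain.1 hz).2)).differentiableAt (by simp)
    rw [hΨ hz, hgm]
    refine (hTU z hz).trans ?_
    rw [← hS, gradient_comp_spaceInv h7 hd, hMR (gradient f _), smul_smul, ← h7c]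
    have : (ε 7 ^ 2)⁻¹ * ε 7 = (ε 7)⁻¹ := by field_simp
    rw [this]

theorem contDiffOn_groupMap (h7 : ε 7 ≠ 0) (hD : IsOpen D)
    (hg : ContDiffOn ℝ ∞ g (spaceMap ε '' D)) :
    ContDiffOn ℝ ∞ (groupMap ε g) (augDomain I D) := by
  have h1 : ContDiffOn ℝ ∞ (fun p : Aug => gradient g (spaceMap ε p.1.2)) (augDomain I D) :=
    (contDiffOn_gradient (isOpen_image_spaceMap h7 hD) hg).comp
      (contDiff_spaceMap.comp (contDiff_snd.comp contDiff_fst)).contDiffOn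
      fun p hp => mem_image_of_mem _ (mem_augDomain.1 hp).2
  have h2 : ContDiff ℝ ∞ (fun p : Aug => (ε 7 * (ε 8)⁻¹) • eulerRotation ε p.2.1) :=
    ((ε 7 * (ε 8)⁻¹) • (eulerIsometry ε : E3 →L[ℝ] E3)).contDiff.comp
      (contDiff_fst.comp contDiff_snd)
  have h3 : ContDiff ℝ ∞ (fun p : Aug => (ε 8 * p.1.1 + ε 0, spaceMap ε p.1.2)) :=
    (by fun_prop : ContDiff ℝ ∞ fun p : Aug => ε 8 * p.1.1 + ε 0).prodMk
      (contDiff_spaceMap.comp (contDiff_snd.comp contDiff_fst))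
  have h4 : ContDiff ℝ ∞ (fun p : Aug => ε 7 ^ 2 * (ε 8 ^ 2)⁻¹ * p.2.2 + ε 9) := by fun_prop
  exact h3.contDiffOn.prodMk ((h2.contDiffOn.add h1).prodMk h4.contDiffOn)

theorem isPointTransformation_groupMap (h7 : ε 7 ≠ 0) (h8 : ε 8 ≠ 0) (hI : IsOpen I)
    (hD : IsOpen D) (hg : ContDiffOn ℝ ∞ g (spaceMap ε '' D)) :
    IsPointTransformation I D (fun q => (ε 8 * q.1 + ε 0, spaceMap ε q.2))
      (fun p => (groupMap ε g p).2) where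
  smooth := contDiffOn_groupMap h7 hD hg
  injOn_base p _ q _ hpq := by
    simp only [Prod.mk.injEq, add_left_inj, mul_eq_mul_left_iff, h8, or_false] at hpq
    exact Prod.ext hpq.1 (spaceMap_injective h7 hpq.2)
  injOn := (Function.LeftInverse.injective (groupInv_groupMap h7 h8 g)).injOn
  nondegenerate p hp := by
    have hO := isOpen_image_spaceMap h7 hD
    have hd : HasFDerivAt (groupMap ε g) (fderiv ℝ (groupMap ε g) p) p :=
      (((contDiffOn_groupMap h7 hD hg).contDiffAt
        ((isOpen_augDomain hI hD).mem_nhds hp)).differentiableAt (by simp)).hasFDerivAt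
    have hmem : (groupMap ε g p).1.2 ∈ spaceMap ε '' D :=
      mem_image_of_mem _ (mem_augDomain.1 hp).2
    have hinv : DifferentiableAt ℝ (groupInv ε g) (groupMap ε g p) := by
      have h1 : DifferentiableAt ℝ (fun p : Aug => gradient g p.1.2) (groupMap ε g p) :=
        DifferentiableAt.comp (g := gradient g) (f := fun p : Aug => p.1.2) (groupMap ε g p)
          (hasFDerivAt_gradient hO hg hmem).differentiableAt (by fun_prop)
      have h2 : DifferentiableAt ℝ (fun p : Aug => spaceInv ε p.1.2) (groupMap ε g p) :=
        (hasFDerivAt_spaceInv _).differentiableAt.comp (groupMap ε g p)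
          (by fun_prop)
      have h3 : DifferentiableAt ℝ (fun p : Aug => (ε 8 * (ε 7)⁻¹) •
          (eulerIsometry ε).symm (p.2.1 - gradient g p.1.2)) (groupMap ε g p) :=
        ((ε 8 * (ε 7)⁻¹) • ((eulerIsometry ε).symm : E3 →L[ℝ] E3)).differentiableAt.comp
          (groupMap ε g p) ((by fun_prop : DifferentiableAt ℝ (fun p : Aug => p.2.1) _).sub h1)
      exact (DifferentiableAt.prodMk (by fun_prop) h2).prodMk (h3.prodMk (by fun_prop))
    -- Differentiating `groupInv ∘ groupMap = id` gives a left inverse of the derivative; finite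
    -- dimension does the rest.
    have hcomp := hinv.hasFDerivAt.comp p hd
    have hid : groupInv ε g ∘ groupMap ε g = id := funext (groupInv_groupMap h7 h8 g)
    rw [hid] at hcomp
    have hone := hcomp.unique (hasFDerivAt_id p)
    have hinj : Function.Injective (fderiv ℝ (groupMap ε g) p) :=
      Function.LeftInverse.injective fun u => DFunLike.congr_fun hone u
    exact ⟨hinj, (LinearMap.injective_iff_surjective
      (f := (fderiv ℝ (groupMap ε g) p : Aug →ₗ[ℝ] Aug))).1 hinj⟩

/-- The transformed vector potential. -/
def mappedVector (ε : Fin 10 → ℝ) (g : E3 → ℝ) (A : E3 → E3) (z : E3) : E3 :=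
  (ε 7 * (ε 8)⁻¹) • eulerIsometry ε (A (spaceInv ε z)) + gradient g z

/-- The transformed scalar potential. -/
def mappedScalar (ε : Fin 10 → ℝ) (Φ : E3 → ℝ) (z : E3) : ℝ :=
  ε 7 ^ 2 * (ε 8 ^ 2)⁻¹ * Φ (spaceInv ε z) + ε 9

/-- The conformal change of variables rescales both parts of the force alike, and the Hessian of `g`
cancels by symmetry. With lengths scaled by `ε 7` and time by `ε 8`, velocity and acceleration
acquire the factors `ε 7 * (ε 8)⁻¹` and `ε 7 * (ε 8 ^ 2)⁻¹`. -/
theorem acceleration_mapped (h7 : ε 7 ≠ 0) (h8 : ε 8 ≠ 0) (hD : IsOpen D)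
    (hg : ContDiffOn ℝ ∞ g (spaceMap ε '' D)) {A : E3 → E3} {Φ : E3 → ℝ}
    (hA : ContDiffOn ℝ ∞ A D) (hΦ : ContDiffOn ℝ ∞ Φ D) {x : E3} (hx : x ∈ D) (v : E3) :
    acceleration (mappedVector ε g A) (mappedScalar ε Φ) (spaceMap ε x)
      ((ε 7 * (ε 8)⁻¹) • eulerIsometry ε v) =
      (ε 7 * (ε 8 ^ 2)⁻¹) • eulerIsometry ε (acceleration A Φ x v) := by
  have hO := isOpen_image_spaceMap h7 hD
  have hz := mem_image_of_mem (spaceMap ε) hx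
  have hdA : HasFDerivAt A (fderiv ℝ A x) (spaceInv ε (spaceMap ε x)) := by
    rw [spaceInv_spaceMap h7]
    exact ((hA.contDiffAt (hD.mem_nhds hx)).differentiableAt (by simp)).hasFDerivAt
  have hdΦ : DifferentiableAt ℝ Φ x :=
    (hΦ.contDiffAt (hD.mem_nhds hx)).differentiableAt (by simp)
  have h1 : HasFDerivAt (mappedVector ε g A)
      ((ε 7 * (ε 8)⁻¹) • (eulerIsometry ε : E3 →L[ℝ] E3).comp
        ((fderiv ℝ A x).comp (spaceInvLin ε)) + fderiv ℝ (gradient g) (spaceMap ε x))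
      (spaceMap ε x) :=
    ((((eulerIsometry ε : E3 →L[ℝ] E3).hasFDerivAt.comp _
      (hdA.comp _ (hasFDerivAt_spaceInv _)))).const_smul (ε 7 * (ε 8)⁻¹)).add
      (hasFDerivAt_gradient hO hg hz)
  have h2 : HasFDerivAt (mappedScalar ε Φ)
      ((ε 7 ^ 2 * (ε 8 ^ 2)⁻¹) • (fderiv ℝ Φ x).comp (spaceInvLin ε)) (spaceMap ε x) :=
    ((hasFDerivAt_comp_spaceInv h7 hdΦ).const_mul _).add_const _
  have hN : spaceInvLin ε ((ε 7 * (ε 8)⁻¹) • eulerIsometry ε v) = (ε 8)⁻¹ • v := by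
    rw [spaceInvLin_apply, map_smul, LinearIsometryEquiv.symm_apply_apply, smul_smul]
    congr 1
    field_simp
  refine ext_inner_right ℝ fun u => ?_
  have hRu : (eulerIsometry ε).symm u = ε 7 • spaceInvLin ε u := by
    rw [spaceInvLin_apply, smul_inv_smul₀ h7]
  have hE : ∀ w, (eulerIsometry ε : E3 →L[ℝ] E3) w = eulerIsometry ε w := fun w => rfl
  have hs := inner_fderiv_gradient_comm hO hg hz u (eulerIsometry ε v)
  rw [acceleration_eq_force, acceleration_eq_force, inner_force, h1.fderiv, h2.fderiv,
    inner_smul_left, inner_eulerIsometry, hRu, inner_smul_right, inner_force]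
  simp only [ContinuousLinearMap.prod_apply, add_apply, smul_apply,
    ContinuousLinearMap.comp_apply, hN, hE, inner_add_left]
  simp only [inner_smul_left, inner_smul_right, conj_trivial, map_smul,
    LinearIsometryEquiv.inner_map_map, inner_eulerIsometry, hRu, smul_eq_mul]
  rw [hs]
  field_simp
  ring

theorem mapsMember_groupMap (h7 : ε 7 ≠ 0) (h8 : ε 8 ≠ 0) (hIne : I.Nonempty)
    (hD : IsOpen D) (hg : ContDiffOn ℝ ∞ g (spaceMap ε '' D)) {A : E3 → E3} {Φ : E3 → ℝ}
    (hA : ContDiffOn ℝ ∞ A D) (hΦ : ContDiffOn ℝ ∞ Φ D) :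
    MapsMember I D (fun q => (ε 8 * q.1 + ε 0, spaceMap ε q.2)) (fun p => (groupMap ε g p).2)
      A Φ (mappedVector ε g A) (mappedScalar ε Φ) := by
  have himage : (fun q : Base => spaceMap ε q.2) '' (I ×ˢ D) = spaceMap ε '' D := by
    have : (fun q : Base => spaceMap ε q.2) = spaceMap ε ∘ Prod.snd := rfl
    rw [this, image_comp, snd_image_prod hIne]
  have hmaps : MapsTo (spaceInv ε) (spaceMap ε '' D) D := fun z hz => by
    rwa [image_spaceMap h7] at hz
  refine ⟨?_, ?_, fun t _ x _ => ?_, ?_⟩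
  · rw [himage]
    exact (((ε 7 * (ε 8)⁻¹) • (eulerIsometry ε : E3 →L[ℝ] E3)).contDiff.comp_contDiffOn
      (hA.comp contDiff_spaceInv.contDiffOn hmaps)).add
      (contDiffOn_gradient (isOpen_image_spaceMap h7 hD) hg)
  · rw [himage]
    exact (contDiffOn_const.mul (hΦ.comp contDiff_spaceInv.contDiffOn hmaps)).add contDiffOn_const
  · simp only [groupMap, mappedVector, mappedScalar, spaceInv_spaceMap h7, eulerIsometry_apply]
  · rintro J J' x y - hJ' - hxD ⟨v, hv⟩ hgraph
    set σ : ℝ → ℝ := fun s => (ε 8)⁻¹ * (s - ε 0) with hσ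
    -- The equality of graphs identifies `y` with the image curve read at the old time `σ s`.
    have key : ∀ s ∈ J', σ s ∈ J ∧ y s = spaceMap ε (x (σ s)) := fun s hs => by
      have : (s, y s) ∈ J'.graphOn y := mem_image_of_mem _ hs
      rw [← hgraph] at this
      obtain ⟨_, ⟨t, ht, rfl⟩, hts⟩ := this
      simp only [Prod.mk.injEq] at hts
      have h1 : σ s = t := by
        rw [hσ, ← hts.1]
        field_simp
        ring
      rw [h1]
      exact ⟨ht, hts.2.symm⟩
    have hσd : ∀ s, HasDerivAt σ (ε 8)⁻¹ s := fun s => by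
      simpa using ((hasDerivAt_id s).sub_const (ε 0)).const_mul (ε 8)⁻¹
    refine ⟨fun s => (ε 7 * (ε 8)⁻¹) • eulerIsometry ε (v (σ s)), fun s hs => ?_⟩
    obtain ⟨hsJ, hys⟩ := key s hs
    obtain ⟨hx1, hv1⟩ := hv _ hsJ
    refine ⟨?_, ?_⟩
    · have h1 : HasDerivAt (fun s => spaceMap ε (x (σ s)))
          (spaceLin ε ((ε 8)⁻¹ • v (σ s))) s :=
        (hasFDerivAt_spaceMap _).comp_hasDerivAt s (hx1.scomp s (hσd s))
      rw [map_smul, spaceLin_apply, smul_smul, mul_comm] at h1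
      exact h1.congr_of_eventuallyEq
        (by filter_upwards [hJ'.mem_nhds hs] with r hr using (key r hr).2)
    · rw [hys, acceleration_mapped h7 h8 hD hg hA hΦ (hxD _ hsJ)]
      have h1 : HasDerivAt (fun s => (ε 7 * (ε 8)⁻¹) • eulerIsometry ε (v (σ s)))
          ((ε 7 * (ε 8)⁻¹) • (eulerIsometry ε : E3 →L[ℝ] E3)
            ((ε 8)⁻¹ • acceleration A Φ (x (σ s)) (v (σ s)))) s :=
        ((eulerIsometry ε : E3 →L[ℝ] E3).hasFDerivAt.comp_hasDerivAt s
          (hv1.scomp s (hσd s))).const_smul (ε 7 * (ε 8)⁻¹)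
      rw [map_smul, smul_smul, mul_assoc, ← mul_inv, ← pow_two] at h1
      exact h1

theorem isEquivalenceTransformation_iff (hI : IsOpen I) (hIc : IsPreconnected I)
    (hIne : I.Nonempty) (hD : IsOpen D) (hDc : Convex ℝ D) (hDne : D.Nonempty) (Ψ : Aug → Aug) :
    IsEquivalenceTransformation I D Ψ ↔ ∃ (ε : Fin 10 → ℝ) (g : E3 → ℝ), ε 7 ≠ 0 ∧ ε 8 ≠ 0 ∧
      ContDiffOn ℝ ∞ g (spaceMap ε '' D) ∧ Set.EqOn Ψ (groupMap ε g) (augDomain I D) := by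
  refine ⟨exists_groupMap_of_isEquivalenceTransformation hI hIc hIne hD hDc hDne, ?_⟩
  rintro ⟨ε, g, h7, h8, hg, hΨ⟩
  exact ⟨fun q => (ε 8 * q.1 + ε 0, spaceMap ε q.2), fun p => (groupMap ε g p).2, hΨ,
    isPointTransformation_groupMap h7 h8 hI hD hg, fun A Φ hA hΦ =>
      ⟨mappedVector ε g A, mappedScalar ε Φ, mapsMember_groupMap h7 h8 hIne hD hg hA hΦ⟩⟩

end EquivalenceGroup

/-! ### The infinitesimal criterion -/

theorem fderiv_auxEq (j J : Jet) : fderiv ℝ auxEq j J = J.2.2 (1, 0) := by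
  let L : Jet →L[ℝ] Fib := ((ContinuousLinearMap.apply ℝ Fib ((1, 0) : Base)).comp
    (ContinuousLinearMap.snd ℝ (E3 × E3) (Base →L[ℝ] Fib))).comp
    (ContinuousLinearMap.snd ℝ Aug ((E3 × E3) × (Base →L[ℝ] Fib)))
  have h : HasFDerivAt auxEq L j := L.hasFDerivAt
  rw [h.fderiv]
  rfl

theorem force_add_smul (P P' : E3 →L[ℝ] Fib) (v v' : E3) (s : ℝ) :
    force (P + s • P') (v + s • v') =
      force P v + s • (force P' v + magForce P v') + s ^ 2 • magForce P' v' := by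
  refine ext_inner_right ℝ fun w => ?_
  simp only [inner_add_left, inner_smul_left, inner_force, inner_magForce, add_apply, smul_apply,
    map_add, map_smul, Prod.fst_add, Prod.snd_add, Prod.smul_fst, Prod.smul_snd, inner_add_right,
    inner_smul_right, conj_trivial, smul_eq_mul]
  ring

theorem differentiable_primEq : Differentiable ℝ primEq := by
  rw [differentiable_euclidean]
  intro i
  simp only [primEq]
  fun_prop

/-- Along a line `primEq` is a quadratic polynomial in the parameter, up to a constant; its linear
coefficient is the derivative. -/
theorem fderiv_primEq (j J : Jet) : fderiv ℝ primEq j J = J.2.1.2 -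
    force (J.2.2.comp (ContinuousLinearMap.inr ℝ ℝ E3)) j.2.1.1 -
    magForce (j.2.2.comp (ContinuousLinearMap.inr ℝ ℝ E3)) J.2.1.1 := by
  have h1 : HasDerivAt (fun s : ℝ => primEq (j + s • J)) (fderiv ℝ primEq j J) 0 :=
    (differentiable_primEq j).hasFDerivAt.hasLineDerivAt J
  set P := j.2.2.comp (ContinuousLinearMap.inr ℝ ℝ E3) with hP
  set P' := J.2.2.comp (ContinuousLinearMap.inr ℝ ℝ E3) with hP'
  have h2 : (fun s : ℝ => primEq (j + s • J)) = fun s => primEq j +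
      (s • (J.2.1.2 - force P' j.2.1.1 - magForce P J.2.1.1) +
        s ^ 2 • (-magForce P' J.2.1.1)) := by
    funext s
    have h3 : (j + s • J).2.2.comp (ContinuousLinearMap.inr ℝ ℝ E3) = P + s • P' := by
      rw [hP, hP']
      rfl
    have h4 : (j + s • J).2.1.1 = j.2.1.1 + s • J.2.1.1 := rfl
    have h5 : (j + s • J).2.1.2 = j.2.1.2 + s • J.2.1.2 := rfl
    rw [primEq_eq_force, h3, h4, h5, force_add_smul, primEq_eq_force]
    module
  have h3 : HasDerivAt (fun s : ℝ => primEq j +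
      (s • (J.2.1.2 - force P' j.2.1.1 - magForce P J.2.1.1) + s ^ 2 • (-magForce P' J.2.1.1)))
      (J.2.1.2 - force P' j.2.1.1 - magForce P J.2.1.1) 0 := by
    have := (((hasDerivAt_id (0 : ℝ)).smul_const
      (J.2.1.2 - force P' j.2.1.1 - magForce P J.2.1.1)).add
      (((hasDerivAt_id (0 : ℝ)).pow 2).smul_const (-magForce P' J.2.1.1))).const_add (primEq j)
    simpa using this
  rw [h2] at h1
  exact h1.unique h3

/-- `N` is the second derivative of `b` along a curve with velocity `v` and acceleration `w`, the
linear analogue of the `N` in `transformed_equation`. -/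
theorem prolong2_eq {b : Base → Base} {q : Base}
    (hb : DifferentiableAt ℝ (fderiv ℝ b) q) {v w : E3} {N : Base}
    (hN : N = fderiv ℝ (fderiv ℝ b) q (1, v) (1, v) + fderiv ℝ b q (0, w)) :
    prolong2 b q v w = N.2 - N.1 • v - (2 * (fderiv ℝ b q (1, v)).1) • w := by
  have hin : HasFDerivAt (fun s : Base × E3 => ((1, s.2) : Base))
      ((0 : Base × E3 →L[ℝ] ℝ).prod (ContinuousLinearMap.snd ℝ Base E3)) (q, v) :=
    (hasFDerivAt_const (1 : ℝ) (q, v)).prodMk hasFDerivAt_snd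
  have h1 : HasFDerivAt (fun s : Base × E3 => fderiv ℝ b s.1)
      ((fderiv ℝ (fderiv ℝ b) q).comp (ContinuousLinearMap.fst ℝ Base E3)) (q, v) :=
    HasFDerivAt.comp (g := fderiv ℝ b) (q, v) hb.hasFDerivAt hasFDerivAt_fst
  have h2 := h1.clm_apply hin
  have h3 : HasFDerivAt (prolong1 b) _ (q, v) :=
    ((ContinuousLinearMap.snd ℝ ℝ E3).hasFDerivAt.comp (q, v) h2).sub
      (((ContinuousLinearMap.fst ℝ ℝ E3).hasFDerivAt.comp (q, v) h2).smul hasFDerivAt_snd)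
  rw [prolong2, h3.fderiv, hN]
  simp only [ContinuousLinearMap.comp_apply, sub_apply, add_apply, smul_apply,
    ContinuousLinearMap.prod_apply, ContinuousLinearMap.flip_apply,
    ContinuousLinearMap.coe_fst', ContinuousLinearMap.coe_snd', zero_apply,
    ContinuousLinearMap.smulRight_apply, Function.comp_apply, Prod.fst_add, Prod.snd_add]
  module

/-! ### Consequences of the infinitesimal criterion -/

section Generators

variable {I : Set ℝ} {D : Set E3} {b : Base → Base} {c : Aug → Fib}

/-- The infinitesimal criterion, for the components `b = (ξ, η)` and `c = (μ, ν)`. -/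
def SatisfiesCriterion (I : Set ℝ) (D : Set E3) (b : Base → Base) (c : Aug → Fib) : Prop :=
  ∀ j : Jet, j.1 ∈ augDomain I D → auxEq j = 0 → primEq j = 0 →
    fderiv ℝ auxEq j (prolongation b c j) = 0 ∧ fderiv ℝ primEq j (prolongation b c j) = 0

/-- The prolonged derivative of the potentials with respect to the position. -/
def prolongJet (b : Base → Base) (c : Aug → Fib) (z : Aug) (P : E3 →L[ℝ] Fib) : E3 →L[ℝ] Fib :=
  (fderiv ℝ c z).comp (((0 : E3 →L[ℝ] ℝ).prod (ContinuousLinearMap.id ℝ E3)).prod P) -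
    P.comp (spaceDeriv b z.1)

theorem prolongJet_apply (z : Aug) (P : E3 →L[ℝ] Fib) (u : E3) :
    prolongJet b c z P u = fderiv ℝ c z ((0, u), P u) - P (spaceDeriv b z.1 u) := rfl

/-- On the solution manifold `P` and `v` are free: the jet of the potentials has no time part, and
the acceleration is the force. The criterion for the auxiliary equations therefore holds for every
`P`. -/
theorem criterion_aux (h : SatisfiesCriterion I D b c) {z : Aug} (hz : z ∈ augDomain I D)
    (P : E3 →L[ℝ] Fib) : fderiv ℝ c z ((1, 0), 0) = P (fderiv ℝ b z.1 (1, 0)).2 := by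
  have h1 := (h (z, (0, force P 0), P.comp (ContinuousLinearMap.snd ℝ ℝ E3)) hz
    (by simp [auxEq]) (by
      rw [primEq_eq_force]
      exact sub_self _)).1
  rw [fderiv_auxEq] at h1
  simp only [prolongation, prolongFib, sub_apply, ContinuousLinearMap.comp_apply,
    ContinuousLinearMap.prod_apply, ContinuousLinearMap.coe_snd', map_zero,
    ContinuousLinearMap.id_apply] at h1
  exact sub_eq_zero.1 h1

theorem criterion_fderiv_fib_time (h : SatisfiesCriterion I D b c) {z : Aug}
    (hz : z ∈ augDomain I D) : fderiv ℝ c z ((1, 0), 0) = 0 := by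
  simpa using criterion_aux h hz 0

/-- The left side of `criterion_aux` does not contain `P`, so every linear functional vanishes on
the time derivative of the space component. -/
theorem criterion_fderiv_time_space (h : SatisfiesCriterion I D b c) {q : Base}
    (hq : q ∈ I ×ˢ D) : (fderiv ℝ b q (1, 0)).2 = 0 := by
  have hz : ((q, 0) : Aug) ∈ augDomain I D := mem_augDomain.2 ⟨hq.1, hq.2⟩
  ext i
  obtain ⟨P, hP⟩ := exists_clm_apply_eq (F := Fib) i (0, 1)
  have h1 := criterion_aux h hz P
  rw [criterion_fderiv_fib_time h hz, hP] at h1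
  simpa using (congrArg Prod.snd h1).symm

theorem criterion_fderiv_apply (h : SatisfiesCriterion I D b c) {q : Base} (hq : q ∈ I ×ˢ D)
    (s : ℝ) (v : E3) :
    fderiv ℝ b q (s, v) = (timeDeriv b q * s + timeSpaceDeriv b q v, spaceDeriv b q v) := by
  have h1 : ((s, v) : Base) = s • (1, 0) + (0, v) := by simp
  have h2 := criterion_fderiv_time_space h hq
  rw [h1, map_add, map_smul]
  ext1
  · simp [timeDeriv, timeSpaceDeriv, mul_comm]
  · simp [h2, spaceDeriv]

/-- The coefficients of the powers of the velocity in the infinitesimal criterion. -/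
theorem criterion_coefficients (h : SatisfiesCriterion I D b c) (hI : IsOpen I) (hD : IsOpen D)
    (hb : ContDiffOn ℝ ∞ b (I ×ˢ D)) {z : Aug} (hz : z ∈ augDomain I D) (P : E3 →L[ℝ] Fib)
    {α : ℝ} {β : E3 →L[ℝ] ℝ} {K : E3 →L[ℝ] E3} {H : Base →L[ℝ] Base →L[ℝ] Base}
    {P' : E3 →L[ℝ] Fib} (hα : α = timeDeriv b z.1) (hβ : β = timeSpaceDeriv b z.1)
    (hK : K = spaceDeriv b z.1) (hH : H = fderiv ℝ (fderiv ℝ b) z.1)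
    (hP' : P' = prolongJet b c z P) (v : E3) :
    K (force P 0) - (2 * α) • force P 0 - force P' 0 = 0 ∧
    K (magForce P v) - ((H (1, 0) (1, 0)).1 + β (force P 0)) • v - α • magForce P v
      - (2 * β v) • force P 0 - magForce P' v - magForce P (K v) = 0 ∧
    (H (0, v) (0, v)).2 - (2 * (H (1, 0) (0, v)).1 + β (magForce P v)) • v
      - β v • magForce P v = 0 := by
  obtain ⟨q, a⟩ := z
  have hq : q ∈ I ×ˢ D := hz.1
  have hO : IsOpen (I ×ˢ D) := hI.prod hD
  have hsymm : ∀ u w, H u w = H w u := fun u w => by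
    rw [hH]
    exact ((hb.contDiffAt (hO.mem_nhds hq)).isSymmSndFDerivAt two_le_infty) u w
  have hddb : DifferentiableAt ℝ (fderiv ℝ b) q :=
    (((contDiffOn_infty_iff_fderiv_of_isOpen hO).1 hb).2.contDiffAt
      (hO.mem_nhds hq)).differentiableAt (by simp)
  have hH2 : ∀ u, (H u (1, 0)).2 = 0 := fun u => by
    rw [hH]
    exact clm_fderiv_eq_zero hddb ((ContinuousLinearMap.snd ℝ ℝ E3).comp
      (ContinuousLinearMap.apply ℝ Base (1, 0)))
      (Filter.mem_of_superset (hO.mem_nhds hq) fun y hy => criterion_fderiv_time_space h hy) u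
  -- The infinitesimal condition has no denominator, so the polynomial vanishes for all `s`.
  refine cubic_coeff_eq_zero (d := - (H (0, v) (0, v)).1 • v) (Eventually.of_forall fun s => ?_)
  have key := (h ((q, a), (s • v, force P (s • v)), P.comp (ContinuousLinearMap.snd ℝ ℝ E3)) hz
    (by simp [auxEq]) (by
      rw [primEq_eq_force]
      exact sub_self _)).2
  rw [fderiv_primEq] at key
  have e1 : (prolongation b c ((q, a), (s • v, force P (s • v)),
      P.comp (ContinuousLinearMap.snd ℝ ℝ E3))).2.2.comp (ContinuousLinearMap.inr ℝ ℝ E3) = P' := by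
    rw [hP']
    rfl
  have e2 : (P.comp (ContinuousLinearMap.snd ℝ ℝ E3)).comp (ContinuousLinearMap.inr ℝ ℝ E3) = P :=
    rfl
  rw [e1, e2] at key
  simp only [prolongation, prolong1] at key
  rw [prolong2_eq hddb rfl, ← hH, criterion_fderiv_apply h hq, criterion_fderiv_apply h hq,
    ← hα, ← hβ, ← hK, force_smul, force_smul] at key
  have hsplit : ((1, s • v) : Base) = (1, 0) + s • (0, v) := by simp
  have hHs : H (1, s • v) (1, s • v) =
      H (1, 0) (1, 0) + (2 * s) • H (1, 0) (0, v) + s ^ 2 • H (0, v) (0, v) := by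
    rw [hsplit]
    simp only [map_add, map_smul, add_apply, smul_apply, hsymm (0, v) (1, 0)]
    module
  have h11 := hH2 (1, 0)
  have h10 : (H (1, 0) (0, v)).2 = 0 := by rw [hsymm]; exact hH2 _
  have hmag : magForce P (s • K v - (s * (α + s * β v)) • v) =
      s • magForce P (K v) - (s * (α + s * β v)) • magForce P v := by
    refine ext_inner_right ℝ fun w => ?_
    simp only [inner_sub_left, inner_smul_left, inner_magForce, map_sub, map_smul, Prod.fst_sub,
      Prod.smul_fst, inner_sub_right, inner_smul_right, conj_trivial]
    ring
  rw [hHs] at key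
  simp only [Prod.fst_add, Prod.snd_add, Prod.smul_fst, Prod.smul_snd, h11, h10, smul_zero,
    zero_add, mul_zero, mul_one, map_add, map_smul, smul_eq_mul, smul_smul] at key
  rw [mul_comm (α + s * β v) s, hmag] at key
  linear_combination (norm := module) key

/-- Pairing with `v` removes the unknown jet `P'`, whose magnetic force is orthogonal to `v`; this
linearises `transformed_inner`. The same three test fields are inserted next. -/
theorem criterion_inner (h : SatisfiesCriterion I D b c) (hI : IsOpen I) (hD : IsOpen D)
    (hb : ContDiffOn ℝ ∞ b (I ×ˢ D)) {q : Base} (hq : q ∈ I ×ˢ D) (P : E3 →L[ℝ] Fib) (v : E3) :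
    ⟪spaceDeriv b q (magForce P v), v⟫_ℝ + ⟪magForce P v, spaceDeriv b q v⟫_ℝ
      - 2 * timeSpaceDeriv b q v * ⟪force P 0, v⟫_ℝ
      - ((fderiv ℝ (fderiv ℝ b) q (1, 0) (1, 0)).1 + timeSpaceDeriv b q (force P 0))
        * ‖v‖ ^ 2 = 0 := by
  have hz : ((q, 0) : Aug) ∈ augDomain I D := mem_augDomain.2 ⟨hq.1, hq.2⟩
  obtain ⟨-, h1, -⟩ := criterion_coefficients h hI hD hb hz P rfl rfl rfl rfl rfl v
  have h1' := congrArg (fun w => ⟪w, v⟫_ℝ) h1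
  simp only [inner_sub_left, inner_smul_left, conj_trivial, inner_zero_left,
    inner_magForce_self, real_inner_self_eq_norm_sq] at h1'
  rw [inner_magForce_swap P (spaceDeriv b q v) v] at h1'
  rw [real_inner_comm (spaceDeriv b q v)]
  linarith

theorem criterion_fderiv_time_time (h : SatisfiesCriterion I D b c) (hI : IsOpen I)
    (hD : IsOpen D) (hb : ContDiffOn ℝ ∞ b (I ×ˢ D)) {q : Base} (hq : q ∈ I ×ˢ D) :
    (fderiv ℝ (fderiv ℝ b) q (1, 0) (1, 0)).1 = 0 := by
  have h1 := criterion_inner h hI hD hb hq (electricJet 0) (e 0)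
  simpa [magForce_electricJet, force_electricJet] using h1

theorem criterion_timeSpaceDeriv (h : SatisfiesCriterion I D b c) (hI : IsOpen I)
    (hD : IsOpen D) (hb : ContDiffOn ℝ ∞ b (I ×ˢ D)) {q : Base} (hq : q ∈ I ×ˢ D) :
    timeSpaceDeriv b q = 0 := by
  ext1 v
  by_cases hv : v = 0
  · simp [hv]
  have h1 := criterion_inner h hI hD hb hq (electricJet v) v
  rw [magForce_electricJet, force_electricJet, criterion_fderiv_time_time h hI hD hb hq,
    real_inner_self_eq_norm_sq, map_zero, inner_zero_left, inner_zero_left] at h1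
  have h2 : timeSpaceDeriv b q v * ‖v‖ ^ 2 = 0 := by linarith
  exact (mul_eq_zero.1 h2).resolve_right (pow_ne_zero 2 (norm_ne_zero_iff.2 hv))

/-- The linearised preservation of orthogonality, from a magnetic field taking `v` to `u`. -/
theorem criterion_spaceDeriv (h : SatisfiesCriterion I D b c) (hI : IsOpen I)
    (hD : IsOpen D) (hb : ContDiffOn ℝ ∞ b (I ×ˢ D)) {q : Base} (hq : q ∈ I ×ˢ D) {u v : E3}
    (huv : ⟪u, v⟫_ℝ = 0) : ⟪spaceDeriv b q u, v⟫_ℝ + ⟪u, spaceDeriv b q v⟫_ℝ = 0 := by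
  by_cases hv : v = 0
  · simp [hv]
  have h1 := criterion_inner h hI hD hb hq (magneticJet u v) v
  rw [magForce_magneticJet hv huv, force_magneticJet_zero,
    criterion_fderiv_time_time h hI hD hb hq] at h1
  simpa using h1

theorem criterion_fderiv_space_space (h : SatisfiesCriterion I D b c) (hI : IsOpen I)
    (hD : IsOpen D) (hb : ContDiffOn ℝ ∞ b (I ×ˢ D)) {q : Base} (hq : q ∈ I ×ˢ D) (v : E3) :
    (fderiv ℝ (fderiv ℝ b) q (0, v) (0, v)).2 = 0 := by
  have hO : IsOpen (I ×ˢ D) := hI.prod hD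
  have hz : ((q, 0) : Aug) ∈ augDomain I D := mem_augDomain.2 ⟨hq.1, hq.2⟩
  obtain ⟨-, -, h2⟩ := criterion_coefficients h hI hD hb hz (electricJet 0) rfl rfl rfl rfl rfl v
  have hddb : DifferentiableAt ℝ (fderiv ℝ b) q :=
    (((contDiffOn_infty_iff_fderiv_of_isOpen hO).1 hb).2.contDiffAt
      (hO.mem_nhds hq)).differentiableAt (by simp)
  have h3 : (fderiv ℝ (fderiv ℝ b) q (1, 0) (0, v)).1 = 0 :=
    clm_fderiv_eq_zero (c := (0 : ℝ)) hddb ((ContinuousLinearMap.fst ℝ ℝ E3).comp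
      (ContinuousLinearMap.apply ℝ Base (0, v)))
      (Filter.mem_of_superset (hO.mem_nhds hq) fun y hy => by
        have := criterion_fderiv_apply h hy 0 v
        rw [criterion_timeSpaceDeriv h hI hD hb hy] at this
        simp [this]) (1, 0)
  rw [h3, criterion_timeSpaceDeriv h hI hD hb hq, magForce_electricJet] at h2
  simpa using h2

end Generators

/-! ### The generators -/

/-- The parameters of an equivalence generator, up to its gauge part: its `(t, x)`-components are
`τ₁ t + τ₀` and `K x + k`, where `K - l` is skew-symmetric, and its `Φ`-component is
`2 (l - τ₁) Φ + ν`. -/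
structure FieldData where
  τ₁ : ℝ
  τ₀ : ℝ
  l : ℝ
  ν : ℝ
  K : E3 →L[ℝ] E3
  k : E3
  conformal : ∀ u v, ⟪K u, v⟫_ℝ + ⟪u, K v⟫_ℝ = 2 * l * ⟪u, v⟫_ℝ

namespace FieldData

/-- The `(t, x)`-components. -/
def base (d : FieldData) (q : Base) : Base := (d.τ₁ * q.1 + d.τ₀, d.K q.2 + d.k)

/-- The linear part of `FieldData.base`. -/
def baseLin (d : FieldData) : Base →L[ℝ] Base :=
  (d.τ₁ • ContinuousLinearMap.fst ℝ ℝ E3).prod (d.K.comp (ContinuousLinearMap.snd ℝ ℝ E3))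

/-- The `(A, Φ)`-components. -/
def fib (d : FieldData) (z : Aug) : Fib :=
  (d.K z.2.1 - d.τ₁ • z.2.1, 2 * (d.l - d.τ₁) * z.2.2 + d.ν)

/-- The linear part of `FieldData.fib`. -/
def fibLin (d : FieldData) : Fib →L[ℝ] Fib :=
  ((d.K - d.τ₁ • ContinuousLinearMap.id ℝ E3).comp (ContinuousLinearMap.fst ℝ E3 ℝ)).prod
    ((2 * (d.l - d.τ₁)) • ContinuousLinearMap.snd ℝ E3 ℝ)

/-- The vector field. -/
def field (d : FieldData) (p : Aug) : Aug := (d.base p.1, d.fib p)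

theorem hasFDerivAt_base (d : FieldData) (q : Base) : HasFDerivAt d.base d.baseLin q :=
  ((d.τ₁ • ContinuousLinearMap.fst ℝ ℝ E3).hasFDerivAt.add_const d.τ₀).prodMk
    ((d.K.comp (ContinuousLinearMap.snd ℝ ℝ E3)).hasFDerivAt.add_const d.k)

theorem baseLin_apply (d : FieldData) (s : ℝ) (u : E3) : d.baseLin (s, u) = (d.τ₁ * s, d.K u) :=
  rfl

theorem fibLin_apply (d : FieldData) (a : Fib) :
    d.fibLin a = (d.K a.1 - d.τ₁ • a.1, 2 * (d.l - d.τ₁) * a.2) := rfl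

theorem fib_eq (d : FieldData) (z : Aug) : d.fib z = d.fibLin z.2 + (0, d.ν) := by
  simp [fib, fibLin_apply]

theorem hasFDerivAt_fib (d : FieldData) (z : Aug) :
    HasFDerivAt d.fib (d.fibLin.comp (ContinuousLinearMap.snd ℝ Base Fib)) z := by
  have h := (d.fibLin.comp (ContinuousLinearMap.snd ℝ Base Fib)).hasFDerivAt (x := z)
  have h2 := h.add_const (0, d.ν)
  have h3 : d.fib = fun z => d.fibLin.comp (ContinuousLinearMap.snd ℝ Base Fib) z + (0, d.ν) :=
    funext fun z => d.fib_eq z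
  rw [h3]
  exact h2

theorem contDiff_base (d : FieldData) : ContDiff ℝ ∞ d.base := by
  unfold base
  fun_prop

theorem contDiff_fib (d : FieldData) : ContDiff ℝ ∞ d.fib := by
  unfold fib
  fun_prop

theorem inner_K (d : FieldData) (u v : E3) :
    ⟪d.K u, v⟫_ℝ = 2 * d.l * ⟪u, v⟫_ℝ - ⟪u, d.K v⟫_ℝ := by
  rw [← d.conformal]; ring

end FieldData

/-! ### Solution of the infinitesimal criterion -/

section Criterion

variable {I : Set ℝ} {D : Set E3} {b : Base → Base} {c : Aug → Fib}

/-- The linearised counterpart of `exists_affine_conformal` and `exists_potential_form`: an affine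
base field with conformal space part, then the two criteria on total derivatives for the remainders
of the fibre components. -/
theorem exists_fieldData (h : SatisfiesCriterion I D b c) (hI : IsOpen I)
    (hIc : IsPreconnected I) (hIne : I.Nonempty) (hD : IsOpen D) (hDc : Convex ℝ D)
    (hDne : D.Nonempty) (hb : ContDiffOn ℝ ∞ b (I ×ˢ D)) (hc : ContDiffOn ℝ ∞ c (augDomain I D)) :
    ∃ (d : FieldData) (f : E3 → ℝ), ContDiffOn ℝ ∞ f D ∧
      ∀ p ∈ augDomain I D, (b p.1, c p) = d.field p + gaugeField f p := by
  obtain ⟨α, τ, K, k, hT⟩ := exists_affine_of_fderiv hI hIc hIne hD hDc hDne hb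
    (fun q hq => criterion_fderiv_time_space h hq)
    (fun q hq v => by
      have := criterion_fderiv_apply h hq 0 v
      rw [criterion_timeSpaceDeriv h hI hD hb hq] at this
      simp [this])
    (fun q hq => criterion_fderiv_time_time h hI hD hb hq)
    (fun q hq v => criterion_fderiv_space_space h hI hD hb hq v)
  have hα : ∀ q ∈ I ×ˢ D, timeDeriv b q = α := fun q hq => by
    simp [timeDeriv, (hT q hq).2]
  have hK : ∀ q ∈ I ×ˢ D, spaceDeriv b q = K := fun q hq => by
    refine ContinuousLinearMap.ext fun v => ?_
    simp [spaceDeriv, (hT q hq).2]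
  have hq₀ : (hIne.some, hDne.some) ∈ I ×ˢ D := ⟨hIne.some_mem, hDne.some_mem⟩
  obtain ⟨m, hm⟩ := exists_eq_mul_inner (fun u v => ⟪K u, v⟫_ℝ + ⟪u, K v⟫_ℝ)
    (fun u u' v => by simp only [map_add, inner_add_left]; ring)
    (fun s u v => by simp only [map_smul, inner_smul_left, conj_trivial]; ring)
    (fun u v => by rw [real_inner_comm v, real_inner_comm (K v)]; ring)
    (fun u v huv => by
      have := criterion_spaceDeriv h hI hD hb hq₀ huv
      rwa [hK _ hq₀] at this)
  have hconf : ∀ u v, ⟪K u, v⟫_ℝ = m * ⟪u, v⟫_ℝ - ⟪u, K v⟫_ℝ := fun u v => by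
    rw [← hm]; ring
  have hcz : ∀ z ∈ augDomain I D, HasFDerivAt c (fderiv ℝ c z) z := fun z hz =>
    ((hc.contDiffAt ((isOpen_augDomain hI hD).mem_nhds hz)).differentiableAt
      (by simp)).hasFDerivAt
  have hmem : ∀ z ∈ augDomain I D, z.1 ∈ I ×ˢ D := fun z hz => hz.1
  -- the scalar potential
  have hS : ∀ z ∈ augDomain I D, HasFDerivAt (fun z : Aug => (c z).2 - (m - 2 * α) * z.2.2)
      ((ContinuousLinearMap.snd ℝ E3 ℝ).comp (fderiv ℝ c z) -
        (m - 2 * α) • (ContinuousLinearMap.snd ℝ E3 ℝ).comp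
          (ContinuousLinearMap.snd ℝ Base Fib)) z := fun z hz =>
    ((ContinuousLinearMap.snd ℝ E3 ℝ).hasFDerivAt.comp z (hcz z hz)).sub
      (((ContinuousLinearMap.snd ℝ E3 ℝ).comp
          (ContinuousLinearMap.snd ℝ Base Fib)).hasFDerivAt.const_mul _)
  obtain ⟨ν, hν⟩ := exists_const_of_totalDeriv_eq_zero hI hIc hD hDc
    (W := fun z : Aug => (c z).2 - (m - 2 * α) * z.2.2)
    (fun z hz => (hS z hz).differentiableAt.differentiableWithinAt)
    (fun z hz => by
      rw [(hS z hz).fderiv]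
      simp [criterion_fderiv_fib_time h hz])
    (fun z hz P u => by
      obtain ⟨h0, -, -⟩ := criterion_coefficients h hI hD hb hz P rfl rfl rfl rfl rfl 0
      rw [hα _ (hmem z hz), hK _ (hmem z hz)] at h0
      rw [(hS z hz).fderiv]
      have h1 := congrArg (fun w => ⟪w, u⟫_ℝ) h0
      simp only [inner_sub_left, inner_smul_left, conj_trivial, hconf, inner_force_zero,
        prolongJet_apply, hK _ (hmem z hz), Prod.snd_sub, inner_zero_left] at h1
      simp only [sub_apply, ContinuousLinearMap.comp_apply,
        smul_apply, ContinuousLinearMap.coe_snd', smul_eq_mul]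
      linear_combination h1)
  -- the vector potential
  have hV : ∀ z ∈ augDomain I D,
      HasFDerivAt (fun z : Aug => (c z).1 - (K z.2.1 - α • z.2.1))
      ((ContinuousLinearMap.fst ℝ E3 ℝ).comp (fderiv ℝ c z) -
        (K - α • ContinuousLinearMap.id ℝ E3).comp ((ContinuousLinearMap.fst ℝ E3 ℝ).comp
          (ContinuousLinearMap.snd ℝ Base Fib))) z := fun z hz =>
    ((ContinuousLinearMap.fst ℝ E3 ℝ).hasFDerivAt.comp z (hcz z hz)).sub
      ((K - α • ContinuousLinearMap.id ℝ E3).comp ((ContinuousLinearMap.fst ℝ E3 ℝ).comp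
          (ContinuousLinearMap.snd ℝ Base Fib))).hasFDerivAt
  obtain ⟨f, hf, hfW⟩ := exists_gradient_of_totalDeriv_symm hI hIc hIne hD hDc
    (W := fun z : Aug => (c z).1 - (K z.2.1 - α • z.2.1))
    (hc.fst.sub (by fun_prop : ContDiff ℝ ∞ fun z : Aug => K z.2.1 - α • z.2.1).contDiffOn)
    (fun z hz => by
      rw [(hV z hz).fderiv]
      simp [criterion_fderiv_fib_time h hz])
    (fun z hz P u w => by
      obtain ⟨-, h1, -⟩ := criterion_coefficients h hI hD hb hz P rfl rfl rfl rfl rfl w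
      rw [hα _ (hmem z hz), hK _ (hmem z hz), criterion_timeSpaceDeriv h hI hD hb (hmem z hz),
        criterion_fderiv_time_time h hI hD hb (hmem z hz)] at h1
      have h2 := congrArg (fun y => ⟪y, u⟫_ℝ) h1
      simp only [inner_sub_left, inner_smul_left, conj_trivial, hconf, inner_magForce,
        prolongJet_apply, hK _ (hmem z hz), Prod.fst_sub, inner_zero_left, zero_apply,
        add_zero, mul_zero, zero_mul, sub_zero] at h2
      rw [(hV z hz).fderiv]
      simp only [sub_apply, ContinuousLinearMap.comp_apply, smul_apply,
        ContinuousLinearMap.coe_fst', ContinuousLinearMap.coe_snd', ContinuousLinearMap.id_apply,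
        inner_sub_left, inner_smul_left, conj_trivial, hconf]
      linear_combination -h2)
  refine ⟨⟨α, τ, m / 2, ν, K, k, fun u v => by rw [hconf]; ring⟩, f, hf, fun z hz => ?_⟩
  have h1 : (c z).2 - (m - 2 * α) * z.2.2 = ν := hν z hz
  have h2 : (c z).1 - (K z.2.1 - α • z.2.1) = gradient f z.1.2 := hfW z hz
  refine Prod.ext ?_ (Prod.ext ?_ ?_)
  · rw [(hT z.1 (hmem z hz)).1]
    simp [FieldData.field, FieldData.base, gaugeField]
  · simp [FieldData.field, FieldData.fib, gaugeField, ← h2]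
  · simp only [FieldData.field, FieldData.fib, gaugeField, Prod.snd_add]
    linear_combination h1

/-- The base field being affine, no second derivatives enter the prolongation. The remaining terms
cancel by conformality of `K` and symmetry of the Hessian of `f`. -/
theorem FieldData.isEquivalenceGenerator (d : FieldData) (hD : IsOpen D)
    {f : E3 → ℝ} (hf : ContDiffOn ℝ ∞ f D) {V : Aug → Aug}
    (hV : ∀ p ∈ augDomain I D, V p = d.field p + gaugeField f p) :
    IsEquivalenceGenerator I D V := by
  have hgrad : ContDiffOn ℝ ∞ (fun z : Aug => ((gradient f z.1.2, 0) : Fib)) (augDomain I D) :=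
    ((contDiffOn_gradient hD hf).comp (by fun_prop : ContDiff ℝ ∞ fun z : Aug => z.1.2).contDiffOn
      fun z hz => (mem_augDomain.1 hz).2).prodMk contDiffOn_const
  refine ⟨d.base, fun z => d.fib z + (gradient f z.1.2, 0), fun p hp => ?_,
    d.contDiff_base.contDiffOn, d.contDiff_fib.contDiffOn.add hgrad, ?_⟩
  · rw [hV p hp]
    simp [FieldData.field, gaugeField]
  rintro ⟨z, ⟨v, w⟩, P⟩ hz haux hprim
  have hx := (mem_augDomain.1 hz).2
  have hbase : fderiv ℝ d.base = fun _ => d.baseLin := funext fun q => (d.hasFDerivAt_base q).fderiv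
  have hddb : HasFDerivAt (fderiv ℝ d.base) (0 : Base →L[ℝ] Base →L[ℝ] Base) z.1 := by
    rw [hbase]
    exact hasFDerivAt_const _ _
  have hg : HasFDerivAt (fun z : Aug => gradient f z.1.2) ((fderiv ℝ (gradient f) z.1.2).comp
      ((ContinuousLinearMap.snd ℝ ℝ E3).comp (ContinuousLinearMap.fst ℝ Base Fib))) z :=
    HasFDerivAt.comp (g := gradient f) z (hasFDerivAt_gradient hD hf hx)
      ((ContinuousLinearMap.snd ℝ ℝ E3).comp (ContinuousLinearMap.fst ℝ Base Fib)).hasFDerivAt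
  have hc := (d.hasFDerivAt_fib z).add (hg.prodMk (hasFDerivAt_const (0 : ℝ) z))
  have hC : ∀ q a, fderiv ℝ (fun z => d.fib z + (gradient f z.1.2, 0)) z (q, a) =
      d.fibLin a + (fderiv ℝ (gradient f) z.1.2 q.2, 0) := fun q a => by
    have : HasFDerivAt (fun z => d.fib z + (gradient f z.1.2, 0)) _ z := hc
    rw [this.fderiv]
    rfl
  have hP1 : P (1, 0) = 0 := haux
  have hP : ∀ s u, P (s, u) = P (0, u) := fun s u => by
    have : ((s, u) : Base) = s • (1, 0) + (0, u) := by simp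
    rw [this, map_add, map_smul, hP1, smul_zero, zero_add]
  have hw : w = force (P.comp (ContinuousLinearMap.inr ℝ ℝ E3)) v := by
    rw [primEq_eq_force] at hprim
    exact sub_eq_zero.1 hprim
  constructor
  · rw [fderiv_auxEq]
    simp only [prolongation, prolongFib, sub_apply, ContinuousLinearMap.comp_apply,
      ContinuousLinearMap.prod_apply, ContinuousLinearMap.id_apply, hC, hbase,
      FieldData.baseLin_apply, hP1, map_zero]
    rw [hP, show P (0, 0) = 0 from map_zero P, sub_zero, zero_add]
    rfl
  · rw [fderiv_primEq]
    simp only [prolongation, prolong1]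
    rw [prolong2_eq hddb.differentiableAt rfl, hddb.fderiv, hbase]
    simp only [zero_apply, zero_add, FieldData.baseLin_apply, mul_zero, mul_one, zero_smul,
      sub_zero]
    refine ext_inner_right ℝ fun u => ?_
    have hs := inner_fderiv_gradient_comm hD hf hx u v
    simp only [hw, inner_sub_left, inner_smul_left, conj_trivial, d.inner_K, inner_force,
      inner_magForce, inner_zero_left, ContinuousLinearMap.comp_apply,
      ContinuousLinearMap.inr_apply, prolongFib, sub_apply, ContinuousLinearMap.prod_apply,
      ContinuousLinearMap.id_apply, hC, hbase, FieldData.baseLin_apply, FieldData.fibLin_apply,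
      Prod.fst_add, Prod.snd_add, Prod.fst_sub, Prod.snd_sub, inner_add_left, inner_sub_right,
      inner_smul_right, hs, hP (d.τ₁ * 0)]
    have hPs : P (0, d.K v - d.τ₁ • v) = P (0, d.K v) - d.τ₁ • P (0, v) := by
      rw [← map_smul, ← map_sub]
      simp
    rw [hPs]
    simp only [Prod.fst_sub, Prod.smul_fst, inner_sub_left, inner_smul_left, conj_trivial]
    ring

theorem isEquivalenceGenerator_iff_fieldData (hI : IsOpen I)
    (hIc : IsPreconnected I) (hIne : I.Nonempty) (hD : IsOpen D) (hDc : Convex ℝ D)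
    (hDne : D.Nonempty) (V : Aug → Aug) : IsEquivalenceGenerator I D V ↔
      ∃ (d : FieldData) (f : E3 → ℝ), ContDiffOn ℝ ∞ f D ∧
        ∀ p ∈ augDomain I D, V p = d.field p + gaugeField f p := by
  constructor
  · rintro ⟨b, c, hV, hb, hc, h⟩
    obtain ⟨d, f, hf, hd⟩ := exists_fieldData h hI hIc hIne hD hDc hDne hb hc
    exact ⟨d, f, hf, fun p hp => (hV hp).trans (hd p hp)⟩
  · rintro ⟨d, f, hf, hV⟩
    exact d.isEquivalenceGenerator hD hf hV

end Criterion

/-! ### The basis of the finite-dimensional part -/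

/-- The linear part of the space component of `∑ i, c i • basisField i`. -/
def spaceMatrix (c : Fin 10 → ℝ) : E3 →L[ℝ] E3 :=
  (Matrix.toEuclideanLin !![c 7, -c 4, c 5; c 4, c 7, -c 6; -c 5, c 6, c 7]).toContinuousLinearMap

theorem spaceMatrix_apply (c : Fin 10 → ℝ) (v : E3) : spaceMatrix c v =
    !₂[c 7 * v 0 - c 4 * v 1 + c 5 * v 2, c 4 * v 0 + c 7 * v 1 - c 6 * v 2,
      -(c 5 * v 0) + c 6 * v 1 + c 7 * v 2] := by
  ext i
  fin_cases i <;>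
    simp [spaceMatrix, Matrix.mulVec, dotProduct, Fin.sum_univ_three, sub_eq_add_neg]

namespace FieldData

/-- The data of the field `∑ i, c i • basisField i`. -/
def ofCoeff (c : Fin 10 → ℝ) : FieldData where
  τ₁ := c 8
  τ₀ := c 0
  l := c 7
  ν := c 9
  K := spaceMatrix c
  k := !₂[c 1, c 2, c 3]
  conformal u v := by
    simp [spaceMatrix_apply, PiLp.inner_apply, Fin.sum_univ_three]
    ring

theorem field_ofCoeff (c : Fin 10 → ℝ) (p : Aug) :
    (ofCoeff c).field p = ∑ i, c i • basisField i p := by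
  obtain ⟨⟨t, x⟩, ⟨a, φ⟩⟩ := p
  simp only [Fin.sum_univ_succ, Fin.sum_univ_zero]
  refine Prod.ext (Prod.ext ?_ ?_) (Prod.ext ?_ ?_)
  · simp [basisField, field, base, ofCoeff]
    ring
  · ext i
    fin_cases i <;>
      simp [basisField, field, base, ofCoeff, spaceMatrix_apply, infRot4, infRot5, infRot6] <;> ring
  · ext i
    fin_cases i <;>
      simp [basisField, field, fib, ofCoeff, spaceMatrix_apply, infRot4, infRot5, infRot6] <;> ring
  · simp [basisField, field, fib, ofCoeff]
    ring

theorem inner_K_basis (d : FieldData) (i j : Fin 3) :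
    d.K (e j) i + d.K (e i) j = if i = j then 2 * d.l else 0 := by
  have h := d.conformal (e j) (e i)
  rw [EuclideanSpace.inner_single_right, EuclideanSpace.inner_single_left,
    EuclideanSpace.inner_single_left] at h
  simpa [Pi.single_apply, eq_comm] using h

/-- `K - l` is skew, hence given by three entries of `K`, the coefficients of the infinitesimal
rotations; the other coefficients are read off directly. -/
theorem exists_ofCoeff_field (d : FieldData) : ∃ c, (ofCoeff c).field = d.field := by
  refine ⟨![d.τ₀, d.k 0, d.k 1, d.k 2, d.K (e 0) 1, d.K (e 2) 0, d.K (e 1) 2, d.l, d.τ₁, d.ν], ?_⟩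
  have hK : (ofCoeff ![d.τ₀, d.k 0, d.k 1, d.k 2, d.K (e 0) 1, d.K (e 2) 0, d.K (e 1) 2, d.l,
      d.τ₁, d.ν]).K = d.K := by
    refine ContinuousLinearMap.ext fun v => ?_
    have h00 := d.inner_K_basis 0 0
    have h11 := d.inner_K_basis 1 1
    have h22 := d.inner_K_basis 2 2
    have h01 := d.inner_K_basis 0 1
    have h02 := d.inner_K_basis 0 2
    have h12 := d.inner_K_basis 1 2
    simp only [if_true, Fin.reduceEq, if_false] at h00 h11 h22 h01 h02 h12
    conv_rhs => rw [eq_sum_basis v]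
    ext i
    fin_cases i
    · simp [ofCoeff, spaceMatrix_apply]
      linear_combination (-v 0 / 2) * h00 - v 1 * h01
    · simp [ofCoeff, spaceMatrix_apply]
      linear_combination (-v 1 / 2) * h11 - v 2 * h12
    · simp [ofCoeff, spaceMatrix_apply]
      linear_combination (-v 2 / 2) * h22 - v 0 * h02
  have hk : (ofCoeff ![d.τ₀, d.k 0, d.k 1, d.k 2, d.K (e 0) 1, d.K (e 2) 0, d.K (e 1) 2, d.l,
      d.τ₁, d.ν]).k = d.k := by
    ext i
    fin_cases i <;> simp [ofCoeff]
  funext p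
  rw [field, field, base, base, fib, fib, hK, hk]
  rfl

/-- Gauge fields touch neither the base components nor the scalar one, and these already determine
the listed data. -/
theorem eq_of_field_eq {I : Set ℝ} {D : Set E3} (hI : IsOpen I) (hIne : I.Nonempty)
    (hD : IsOpen D) (hDne : D.Nonempty) {d d' : FieldData} {f f' : E3 → ℝ}
    (h : ∀ p ∈ augDomain I D, d.field p + gaugeField f p = d'.field p + gaugeField f' p) :
    d.τ₁ = d'.τ₁ ∧ d.τ₀ = d'.τ₀ ∧ d.ν = d'.ν ∧ d.K = d'.K ∧ d.k = d'.k := by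
  obtain ⟨t, ht⟩ := hIne
  obtain ⟨x, hx⟩ := hDne
  have hb : ∀ q ∈ I ×ˢ D, d.base q = d'.base q := fun q hq => by
    have := congrArg Prod.fst (h (q, 0) (mem_augDomain.2 ⟨hq.1, hq.2⟩))
    simpa [field, gaugeField] using this
  have hq : (t, x) ∈ I ×ˢ D := ⟨ht, hx⟩
  have hlin : d.baseLin = d'.baseLin :=
    (d.hasFDerivAt_base (t, x)).unique ((d'.hasFDerivAt_base (t, x)).congr_of_eventuallyEq
      (Filter.eventuallyEq_of_mem ((hI.prod hD).mem_nhds hq) hb))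
  have hτ : d.τ₁ = d'.τ₁ := by
    simpa [baseLin_apply] using congrArg Prod.fst (DFunLike.congr_fun hlin (1, 0))
  have hK : d.K = d'.K := ContinuousLinearMap.ext fun u => by
    simpa [baseLin_apply] using congrArg Prod.snd (DFunLike.congr_fun hlin (0, u))
  have h0 := hb _ hq
  simp only [base, hτ, hK, Prod.mk.injEq, add_right_inj] at h0
  have hν := congrArg (fun p : Aug => p.2.2) (h ((t, x), 0) (mem_augDomain.2 ⟨ht, hx⟩))
  exact ⟨hτ, h0.1, by simpa [field, fib, gaugeField] using hν, hK, h0.2⟩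

theorem ofCoeff_injective {I : Set ℝ} {D : Set E3} (hI : IsOpen I) (hIne : I.Nonempty)
    (hD : IsOpen D) (hDne : D.Nonempty) {c c' : Fin 10 → ℝ} {f f' : E3 → ℝ}
    (h : ∀ p ∈ augDomain I D,
      (ofCoeff c).field p + gaugeField f p = (ofCoeff c').field p + gaugeField f' p) : c = c' := by
  obtain ⟨h8, h0, h9, hK, hk⟩ := eq_of_field_eq hI hIne hD hDne h
  have hk' : ∀ i, (!₂[c 1, c 2, c 3] : E3) i = (!₂[c' 1, c' 2, c' 3] : E3) i := fun i =>
    congrArg (fun u : E3 => u i) hk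
  have hK' : ∀ u i, spaceMatrix c u i = spaceMatrix c' u i := fun u i =>
    congrArg (fun L : E3 →L[ℝ] E3 => L u i) hK
  simp only [spaceMatrix_apply] at hK'
  funext i
  fin_cases i
  · exact h0
  · simpa using hk' 0
  · simpa using hk' 1
  · simpa using hk' 2
  · simpa using hK' (e 0) 1
  · simpa using hK' (e 2) 0
  · simpa using hK' (e 1) 2
  · simpa using hK' (e 0) 0
  · exact h8
  · exact h9

end FieldData

theorem gaugeField_zero (p : Aug) : gaugeField 0 p = 0 := by
  rw [gaugeField, gradient_zero]
  rfl

/-- Uniqueness concerns `c` alone: adding a constant to `f` does not change its gradient. -/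
theorem isEquivalenceGenerator_iff {I : Set ℝ} {D : Set E3} (hI : IsOpen I)
    (hIc : IsPreconnected I) (hIne : I.Nonempty) (hD : IsOpen D) (hDc : Convex ℝ D)
    (hDne : D.Nonempty) (V : Aug → Aug) : IsEquivalenceGenerator I D V ↔
      ∃! c : Fin 10 → ℝ, ∃ f : E3 → ℝ, ContDiffOn ℝ ∞ f D ∧
        ∀ p ∈ augDomain I D, V p = ∑ i, c i • basisField i p + gaugeField f p := by
  rw [isEquivalenceGenerator_iff_fieldData hI hIc hIne hD hDc hDne]
  simp only [← FieldData.field_ofCoeff]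
  constructor
  · rintro ⟨d, f, hf, hV⟩
    obtain ⟨c, hc⟩ := d.exists_ofCoeff_field
    refine ⟨c, ⟨f, hf, by rwa [hc]⟩, ?_⟩
    rintro c' ⟨f', -, hV'⟩
    exact FieldData.ofCoeff_injective hI hIne hD hDne (f := f') (f' := f) fun p hp => by
      rw [hc, ← hV p hp, hV' p hp]
  · rintro ⟨c, ⟨f, hf, hV⟩, -⟩
    exact ⟨.ofCoeff c, f, hf, hV⟩

theorem linearIndependent_basisField {I : Set ℝ} {D : Set E3} (hI : IsOpen I) (hIne : I.Nonempty)
    (hD : IsOpen D) (hDne : D.Nonempty) :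
    LinearIndependent ℝ (fun i => (augDomain I D).domRestrict (basisField i)) := by
  rw [Fintype.linearIndependent_iff]
  intro c hc
  have h : c = 0 := by
    refine FieldData.ofCoeff_injective hI hIne hD hDne (f := 0) (f' := 0) fun p hp => ?_
    rw [FieldData.field_ofCoeff, FieldData.field_ofCoeff]
    have := congrFun hc ⟨p, hp⟩
    simp only [Finset.sum_apply, Pi.smul_apply, Pi.zero_apply] at this
    simp only [Pi.zero_apply, zero_smul, Finset.sum_const_zero]
    exact congrArg (· + gaugeField 0 p) this
  simp [h]

/-! ### Lie brackets -/

namespace FieldData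

/-- The data of the Lie bracket of two fields. -/
def bracket (d d' : FieldData) : FieldData where
  τ₁ := 0
  τ₀ := d'.τ₁ * d.τ₀ - d.τ₁ * d'.τ₀
  l := 0
  ν := 2 * (d'.l - d'.τ₁) * d.ν - 2 * (d.l - d.τ₁) * d'.ν
  K := d'.K.comp d.K - d.K.comp d'.K
  k := d'.K d.k - d.K d'.k
  conformal u v := by
    simp only [sub_apply, ContinuousLinearMap.comp_apply, inner_sub_left, inner_sub_right,
      d.inner_K, d'.inner_K]
    ring

/-- The potential of the gauge part of the Lie bracket of the field of `d` with `gaugeField f`. -/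
def gaugePotential (d : FieldData) (f : E3 → ℝ) (x : E3) : ℝ :=
  fderiv ℝ f x (d.K x + d.k) + (d.τ₁ - 2 * d.l) * f x

theorem contDiffOn_gaugePotential (d : FieldData) {D : Set E3} (hD : IsOpen D) {f : E3 → ℝ}
    (hf : ContDiffOn ℝ ∞ f D) : ContDiffOn ℝ ∞ (d.gaugePotential f) D :=
  ((((contDiffOn_infty_iff_fderiv_of_isOpen hD).1 hf).2.clm_apply
    (d.K.contDiff.add contDiff_const).contDiffOn).add (contDiffOn_const.mul hf))

theorem hasFDerivAt_gaugePotential (d : FieldData) {D : Set E3} (hD : IsOpen D) {f : E3 → ℝ}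
    (hf : ContDiffOn ℝ ∞ f D) {x : E3} (hx : x ∈ D) :
    HasFDerivAt (d.gaugePotential f) (fderiv ℝ (d.gaugePotential f) x) x :=
  (((d.contDiffOn_gaugePotential hD hf).contDiffAt (hD.mem_nhds hx)).differentiableAt
    (by simp)).hasFDerivAt

/-- Differentiating `fderiv ℝ f x (d.K x + d.k)` gives a Hessian term and the adjoint of `K` at the
gradient. That adjoint is `2 l - K`, whence the correction `(τ₁ - 2 l) f`. -/
theorem gradient_gaugePotential (d : FieldData) {D : Set E3} (hD : IsOpen D) {f : E3 → ℝ}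
    (hf : ContDiffOn ℝ ∞ f D) {x : E3} (hx : x ∈ D) :
    gradient (d.gaugePotential f) x = fderiv ℝ (gradient f) x (d.K x + d.k) -
      (d.K (gradient f x) - d.τ₁ • gradient f x) := by
  have h1 : HasFDerivAt f (fderiv ℝ f x) x :=
    ((hf.contDiffAt (hD.mem_nhds hx)).differentiableAt (by simp)).hasFDerivAt
  have h2 : HasFDerivAt (fderiv ℝ f) (fderiv ℝ (fderiv ℝ f) x) x :=
    ((((contDiffOn_infty_iff_fderiv_of_isOpen hD).1 hf).2.contDiffAt
      (hD.mem_nhds hx)).differentiableAt (by simp)).hasFDerivAt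
  refine gradient_eq_of_hasFDerivAt
    ((h2.clm_apply (d.K.hasFDerivAt.add_const d.k)).add (h1.const_mul _)) fun u => ?_
  have h3 := inner_fderiv_gradient hD hf hx u (d.K x + d.k)
  have h4 := inner_fderiv_gradient_comm hD hf hx u (d.K x + d.k)
  simp only [inner_sub_left, inner_smul_left, conj_trivial, d.inner_K, ← h4, h3, inner_gradient,
    add_apply, smul_apply, ContinuousLinearMap.comp_apply, ContinuousLinearMap.flip_apply,
    smul_eq_mul]
  ring

theorem hasFDerivAt_field_add_gaugeField (d : FieldData) {I : Set ℝ} {D : Set E3}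
    (hI : IsOpen I) (hD : IsOpen D) {f : E3 → ℝ} (hf : ContDiffOn ℝ ∞ f D) {V : Aug → Aug}
    (hV : ∀ p ∈ augDomain I D, V p = d.field p + gaugeField f p) {p : Aug}
    (hp : p ∈ augDomain I D) (h : Aug) :
    fderiv ℝ V p h = (d.baseLin h.1, d.fibLin h.2 + (fderiv ℝ (gradient f) p.1.2 h.1.2, 0)) := by
  have hx := (mem_augDomain.1 hp).2
  have hg : HasFDerivAt (fun z : Aug => gradient f z.1.2) ((fderiv ℝ (gradient f) p.1.2).comp
      ((ContinuousLinearMap.snd ℝ ℝ E3).comp (ContinuousLinearMap.fst ℝ Base Fib))) p :=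
    HasFDerivAt.comp (g := gradient f) p (hasFDerivAt_gradient hD hf hx)
      ((ContinuousLinearMap.snd ℝ ℝ E3).comp (ContinuousLinearMap.fst ℝ Base Fib)).hasFDerivAt
  have hc := (d.hasFDerivAt_fib p).add (hg.prodMk (hasFDerivAt_const (0 : ℝ) p))
  have hb : HasFDerivAt (fun z : Aug => d.base z.1)
      (d.baseLin.comp (ContinuousLinearMap.fst ℝ Base Fib)) p :=
    HasFDerivAt.comp (g := d.base) p (d.hasFDerivAt_base p.1) hasFDerivAt_fst
  have hev : V =ᶠ[𝓝 p] fun z => (d.base z.1, d.fib z + (gradient f z.1.2, 0)) :=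
    Filter.eventuallyEq_of_mem ((isOpen_augDomain hI hD).mem_nhds hp) fun z hz => by
      rw [hV z hz]
      simp [field, gaugeField]
  rw [((hb.prodMk hc).congr_of_eventuallyEq hev).fderiv]
  rfl

/-- The affine parts bracket by commutators, which lose every scaling part; the mixed terms are
gradients by `gradient_gaugePotential`, and two gauge fields commute. -/
theorem lieBracket_eq (d d' : FieldData) {I : Set ℝ} {D : Set E3}
    (hI : IsOpen I) (hD : IsOpen D) {f f' : E3 → ℝ} (hf : ContDiffOn ℝ ∞ f D)
    (hf' : ContDiffOn ℝ ∞ f' D) {V W : Aug → Aug}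
    (hV : ∀ p ∈ augDomain I D, V p = d.field p + gaugeField f p)
    (hW : ∀ p ∈ augDomain I D, W p = d'.field p + gaugeField f' p) {p : Aug}
    (hp : p ∈ augDomain I D) :
    VectorField.lieBracket ℝ V W p = (d.bracket d').field p +
      gaugeField (fun x => d.gaugePotential f' x - d'.gaugePotential f x) p := by
  have hx := (mem_augDomain.1 hp).2
  have hgrad : gradient (fun x => d.gaugePotential f' x - d'.gaugePotential f x) p.1.2 =
      gradient (d.gaugePotential f') p.1.2 - gradient (d'.gaugePotential f) p.1.2 := by
    refine gradient_eq_of_hasFDerivAt ((d.hasFDerivAt_gaugePotential hD hf' hx).sub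
      (d'.hasFDerivAt_gaugePotential hD hf hx)) fun u => ?_
    rw [inner_sub_left, inner_gradient, inner_gradient]
    rfl
  rw [VectorField.lieBracket, d'.hasFDerivAt_field_add_gaugeField hI hD hf' hW hp,
    d.hasFDerivAt_field_add_gaugeField hI hD hf hV hp, hV p hp, hW p hp]
  simp only [field, gaugeField, hgrad, d.gradient_gaugePotential hD hf' hx,
    d'.gradient_gaugePotential hD hf hx]
  refine Prod.ext (Prod.ext ?_ ?_) (Prod.ext ?_ ?_)
  · simp only [base, bracket, baseLin_apply, Prod.fst_sub, add_zero, Prod.mk_add_mk]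
    ring
  · simp only [base, bracket, baseLin_apply, Prod.fst_sub,
      Prod.snd_sub, add_zero, Prod.mk_add_mk, map_add, sub_apply, ContinuousLinearMap.comp_apply]
    abel
  · simp only [base, fib, bracket, fibLin_apply, Prod.fst_sub,
      Prod.snd_sub, add_zero, Prod.mk_add_mk, map_add, map_sub, map_smul, sub_apply,
      ContinuousLinearMap.comp_apply]
    module
  · simp only [fib, bracket, fibLin_apply, Prod.snd_add,
      Prod.snd_sub, add_zero, Prod.mk_add_mk]
    ring

end FieldData

/-! ### The Lie algebra of generators and its gauge ideal -/

section Algebra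

variable {I : Set ℝ} {D : Set E3}

theorem isEquivalenceGenerator_lieBracket (hI : IsOpen I)
    (hIc : IsPreconnected I) (hIne : I.Nonempty) (hD : IsOpen D) (hDc : Convex ℝ D)
    (hDne : D.Nonempty) {V W : Aug → Aug} (hV : IsEquivalenceGenerator I D V)
    (hW : IsEquivalenceGenerator I D W) :
    IsEquivalenceGenerator I D (VectorField.lieBracket ℝ V W) := by
  obtain ⟨d, f, hf, hV⟩ := (isEquivalenceGenerator_iff_fieldData hI hIc hIne hD hDc hDne V).1 hV
  obtain ⟨d', f', hf', hW⟩ := (isEquivalenceGenerator_iff_fieldData hI hIc hIne hD hDc hDne W).1 hW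
  exact (d.bracket d').isEquivalenceGenerator hD
    ((d.contDiffOn_gaugePotential hD hf').sub (d'.contDiffOn_gaugePotential hD hf))
    fun p hp => d.lieBracket_eq d' hI hD hf hf' hV hW hp

theorem FieldData.gaugePotential_zero (d : FieldData) : d.gaugePotential 0 = 0 := by
  funext x
  simp [FieldData.gaugePotential]

/-- The trivial gauge part brings the basis fields into the form required by
`FieldData.lieBracket_eq`. -/
theorem basisField_eq (i : Fin 10) (p : Aug) :
    basisField i p = (FieldData.ofCoeff (Pi.single i 1)).field p + gaugeField 0 p := by
  rw [FieldData.field_ofCoeff, gaugeField_zero, add_zero,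
    Finset.sum_eq_single i (fun j _ hj => by simp [hj]) (by simp)]
  simp

theorem exists_lieBracket_basisField (i j : Fin 10) : ∃ c : Fin 10 → ℝ, ∀ p,
    VectorField.lieBracket ℝ (basisField i) (basisField j) p = ∑ k, c k • basisField k p := by
  obtain ⟨c, hc⟩ := ((FieldData.ofCoeff (Pi.single i 1)).bracket
    (.ofCoeff (Pi.single j 1))).exists_ofCoeff_field
  refine ⟨c, fun p => ?_⟩
  have h0 : ContDiffOn ℝ ∞ (0 : E3 → ℝ) univ := contDiffOn_const
  have h := FieldData.lieBracket_eq _ _ isOpen_univ isOpen_univ h0 h0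
    (fun p _ => basisField_eq i p) (fun p _ => basisField_eq j p)
    (mem_augDomain.2 ⟨mem_univ p.1.1, mem_univ p.1.2⟩)
  simp only [FieldData.gaugePotential_zero, Pi.zero_apply, sub_zero] at h
  rw [h, ← FieldData.field_ofCoeff, hc]
  exact add_eq_left.2 (gaugeField_zero p)

theorem exists_lieBracket_gaugeField (hI : IsOpen I)
    (hIc : IsPreconnected I) (hIne : I.Nonempty) (hD : IsOpen D) (hDc : Convex ℝ D)
    (hDne : D.Nonempty) {V : Aug → Aug} {f : E3 → ℝ} (hV : IsEquivalenceGenerator I D V)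
    (hf : ContDiffOn ℝ ∞ f D) : ∃ h : E3 → ℝ, ContDiffOn ℝ ∞ h D ∧
      EqOn (VectorField.lieBracket ℝ V (gaugeField f)) (gaugeField h) (augDomain I D) := by
  obtain ⟨d, g, hg, hV⟩ := (isEquivalenceGenerator_iff_fieldData hI hIc hIne hD hDc hDne V).1 hV
  -- A gauge field has zero data, and so does its bracket with any generator.
  set o : FieldData := ⟨0, 0, 0, 0, 0, 0, fun u v => by simp⟩ with ho
  have hof : ∀ p, o.field p = 0 := fun p => by
    simp [ho, FieldData.field, FieldData.base, FieldData.fib]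
  refine ⟨_, (d.contDiffOn_gaugePotential hD hf).sub (o.contDiffOn_gaugePotential hD hg),
    fun p hp => ?_⟩
  rw [d.lieBracket_eq o hI hD hg hf hV (fun p _ => by rw [hof, zero_add]) hp]
  refine add_eq_right.2 ?_
  simp [ho, FieldData.field, FieldData.base, FieldData.fib, FieldData.bracket]

/-- The first gradient component of `x 0 ^ (n + 1)` is `(n + 1) * x 0 ^ n`, so a vanishing
combination is a polynomial with infinitely many roots. The exponent starts at one because constants
have no gradient. -/
theorem linearIndependent_gaugeField (hIne : I.Nonempty) (hD : IsOpen D) (hDne : D.Nonempty) :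
    LinearIndependent ℝ (fun n : ℕ => (augDomain I D).domRestrict
      (gaugeField fun x => x 0 ^ (n + 1))) := by
  obtain ⟨t, ht⟩ := hIne
  obtain ⟨x, hx⟩ := hDne
  rw [linearIndependent_iff']
  intro s c hc
  have hgrad : ∀ (n : ℕ) (y : E3), gradient (fun x : E3 => x 0 ^ (n + 1)) y 0 =
      (n + 1) * y 0 ^ n := fun n y => by
    have h1 : HasFDerivAt (fun x : E3 => x 0) (EuclideanSpace.proj 0 : E3 →L[ℝ] ℝ) y :=
      (EuclideanSpace.proj 0 : E3 →L[ℝ] ℝ).hasFDerivAt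
    rw [gradient_apply, (h1.pow (n + 1)).fderiv]
    simp
  set P : Polynomial ℝ := ∑ n ∈ s, Polynomial.monomial n (c n * (n + 1)) with hP
  have hroot : ∀ y ∈ D, P.eval (y 0) = 0 := fun y hy => by
    have h := congrArg (fun a : Aug => a.2.1 0) (congrFun hc ⟨((t, y), 0), mem_augDomain.2 ⟨ht, hy⟩⟩)
    simp only [Finset.sum_apply, Pi.smul_apply, Pi.zero_apply, Prod.snd_sum, Prod.fst_sum,
      Prod.smul_snd, Prod.smul_fst] at h
    rw [hP, Polynomial.eval_finsetSum]
    simp only [Polynomial.eval_monomial]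
    simpa [gaugeField, hgrad, mul_assoc] using h
  have hP0 : P = 0 := by
    refine Polynomial.eq_zero_of_infinite_isRoot P ?_
    have hcont : Continuous fun r : ℝ => x + r • e 0 := by fun_prop
    have hU : {r : ℝ | x + r • e 0 ∈ D} ∈ 𝓝 0 :=
      hcont.continuousAt.preimage_mem_nhds (by simpa using hD.mem_nhds hx)
    have hinf : {r : ℝ | x + r • e 0 ∈ D}.Infinite := infinite_of_mem_nhds 0 hU
    refine (hinf.image (f := fun r => x 0 + r) (add_right_injective _).injOn).mono ?_
    rintro _ ⟨r, hr, rfl⟩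
    simpa [Polynomial.IsRoot] using hroot _ hr
  intro n hn
  have h := congrArg (fun Q => Polynomial.coeff Q n) hP0
  simp only [hP, Polynomial.finsetSum_coeff, Polynomial.coeff_monomial, Finset.sum_ite_eq',
    hn, if_true, Polynomial.coeff_zero] at h
  exact (mul_eq_zero.1 h).resolve_right (by positivity)

theorem hasDerivAt_groupMap_gauge {f : E3 → ℝ} (hD : IsOpen D) (hf : ContDiffOn ℝ ∞ f D) {p : Aug}
    (hp : p ∈ augDomain I D) :
    HasDerivAt (fun s : ℝ => groupMap idParam (s • f) p) (gaugeField f p) 0 := by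
  have hx := (mem_augDomain.1 hp).2
  have hd : HasFDerivAt f (fderiv ℝ f p.1.2) p.1.2 :=
    ((hf.contDiffAt (hD.mem_nhds hx)).differentiableAt (by simp)).hasFDerivAt
  have h : (fun s : ℝ => groupMap idParam (s • f) p) = fun s => p + s • gaugeField f p := by
    funext s
    rw [groupMap_idParam_apply, gaugeField, gradient_eq_of_hasFDerivAt (w := s • gradient f p.1.2)
      (hd.const_smul s) fun u => by rw [inner_smul_left, inner_gradient]; rfl]
    simp [gaugeField]
  rw [h]
  simpa using ((hasDerivAt_id (0 : ℝ)).smul_const (gaugeField f p)).const_add p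

end Algebra

/-! ### The derivatives at the identity -/

section Parameters

/-- A curve in the augmented space is differentiable if its coordinates are. -/
theorem hasDerivAt_aug {γ : ℝ → Aug} {w : Aug} {s : ℝ}
    (h1 : HasDerivAt (fun r => (γ r).1.1) w.1.1 s)
    (h2 : ∀ i, HasDerivAt (fun r => (γ r).1.2 i) (w.1.2 i) s)
    (h3 : ∀ i, HasDerivAt (fun r => (γ r).2.1 i) (w.2.1 i) s)
    (h4 : HasDerivAt (fun r => (γ r).2.2) w.2.2 s) : HasDerivAt γ w s := by
  have euclidean : ∀ {γ : ℝ → E3} {w : E3}, (∀ i, HasDerivAt (fun r => γ r i) (w i) s) →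
      HasDerivAt γ w s := fun {γ w} h =>
    (PiLp.continuousLinearEquiv 2 ℝ fun _ : Fin 3 => ℝ).symm.hasFDerivAt.comp_hasDerivAt
      s (hasDerivAt_pi.2 h)
  exact (h1.prodMk (euclidean h2)).prodMk ((euclidean h3).prodMk h4)

theorem hasDerivAt_matrix_mul {A B : ℝ → Matrix (Fin 3) (Fin 3) ℝ}
    {A' B' : Matrix (Fin 3) (Fin 3) ℝ} {s : ℝ} (hA : ∀ i j, HasDerivAt (fun r => A r i j) (A' i j) s)
    (hB : ∀ i j, HasDerivAt (fun r => B r i j) (B' i j) s) (i j : Fin 3) :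
    HasDerivAt (fun r => (A r * B r) i j) ((A' * B s + A s * B') i j) s := by
  simp only [Matrix.add_apply, Matrix.mul_apply, ← Finset.sum_add_distrib]
  exact HasDerivAt.fun_sum fun k _ => (hA i k).mul (hB k j)

variable {θ : ℝ → ℝ} {w : ℝ}

theorem hasDerivAt_cos_sin (hθ : HasDerivAt θ w 0) (h0 : θ 0 = 0) :
    HasDerivAt (fun s => Real.cos (θ s)) 0 0 ∧ HasDerivAt (fun s => Real.sin (θ s)) w 0 := by
  have h1 := hθ.cos
  have h2 := hθ.sin
  simp only [h0, Real.sin_zero, Real.cos_zero, neg_zero, zero_mul, one_mul] at h1 h2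
  exact ⟨h1, h2⟩

theorem hasDerivAt_rot1 (hθ : HasDerivAt θ w 0) (h0 : θ 0 = 0) (i j : Fin 3) :
    HasDerivAt (fun s => rot1 (θ s) i j) (!![0, 0, 0; 0, 0, -w; 0, w, 0] i j) 0 := by
  obtain ⟨hc, hs⟩ := hasDerivAt_cos_sin hθ h0
  fin_cases i <;> fin_cases j <;>
    first | exact hasDerivAt_const _ _ | exact hc | exact hs | exact hs.neg

theorem hasDerivAt_rot2 (hθ : HasDerivAt θ w 0) (h0 : θ 0 = 0) (i j : Fin 3) :
    HasDerivAt (fun s => rot2 (θ s) i j) (!![0, 0, w; 0, 0, 0; -w, 0, 0] i j) 0 := by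
  obtain ⟨hc, hs⟩ := hasDerivAt_cos_sin hθ h0
  fin_cases i <;> fin_cases j <;>
    first | exact hasDerivAt_const _ _ | exact hc | exact hs | exact hs.neg

theorem hasDerivAt_rot3 (hθ : HasDerivAt θ w 0) (h0 : θ 0 = 0) (i j : Fin 3) :
    HasDerivAt (fun s => rot3 (θ s) i j) (!![0, -w, 0; w, 0, 0; 0, 0, 0] i j) 0 := by
  obtain ⟨hc, hs⟩ := hasDerivAt_cos_sin hθ h0
  fin_cases i <;> fin_cases j <;>
    first | exact hasDerivAt_const _ _ | exact hc | exact hs | exact hs.neg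

theorem rot1_zero : rot1 0 = 1 := by
  ext i j
  fin_cases i <;> fin_cases j <;> simp [rot1]

theorem rot2_zero : rot2 0 = 1 := by
  ext i j
  fin_cases i <;> fin_cases j <;> simp [rot2]

theorem rot3_zero : rot3 0 = 1 := by
  ext i j
  fin_cases i <;> fin_cases j <;> simp [rot3]

variable {ε : ℝ → Fin 10 → ℝ} {c : Fin 10 → ℝ}

/-- All three factors equal `1` at the identity, so the product rule adds their derivatives; the sum
is the skew part of `spaceMatrix c`. -/
theorem hasDerivAt_eulerRotation (hε : ∀ i, HasDerivAt (fun s => ε s i) (c i) 0)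
    (h0 : ε 0 = idParam) (v : E3) (i : Fin 3) :
    HasDerivAt (fun s => eulerRotation (ε s) v i)
      ((spaceMatrix c v - c 7 • v) i) 0 := by
  have h4 : ε 0 4 = 0 := by rw [h0]; rfl
  have h5 : ε 0 5 = 0 := by rw [h0]; rfl
  have h6 : ε 0 6 = 0 := by rw [h0]; rfl
  have h := hasDerivAt_matrix_mul (hasDerivAt_matrix_mul (hasDerivAt_rot1 (hε 6) h6)
    (hasDerivAt_rot2 (hε 5) h5)) (hasDerivAt_rot3 (hε 4) h4)
  simp only [h4, h5, h6, rot1_zero, rot2_zero, rot3_zero, Matrix.mul_one, Matrix.one_mul] at h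
  have h2 : HasDerivAt (fun s => eulerRotation (ε s) v i) _ 0 :=
    HasDerivAt.fun_sum (u := Finset.univ) fun j _ => (h i j).mul_const (v j)
  convert h2 using 1
  fin_cases i <;> simp [spaceMatrix_apply, Fin.sum_univ_three] <;> ring

/-- The derivative of the explicit transformations along a curve of parameters through the
identity. -/
theorem hasDerivAt_groupMap (hε : ∀ i, HasDerivAt (fun s => ε s i) (c i) 0)
    (h0 : ε 0 = idParam) (p : Aug) :
    HasDerivAt (fun s => groupMap (ε s) 0 p) ((FieldData.ofCoeff c).field p) 0 := by
  have h7 : ε 0 7 = 1 := by rw [h0]; rfl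
  have h8 : ε 0 8 = 1 := by rw [h0]; rfl
  have h8' : ε 0 8 ≠ 0 := by rw [h8]; exact one_ne_zero
  have hR : ∀ v i, eulerRotation (ε 0) v i = v i := fun v i => by rw [h0, eulerRotation_idParam]
  have hinv := (hε 8).inv h8'
  have hinv2 := ((hε 8).pow 2).inv (pow_ne_zero 2 h8')
  refine hasDerivAt_aug ?_ (fun i => ?_) (fun i => ?_) ?_
  · exact (((hε 8).mul_const p.1.1).add (hε 0))
  · have hk : HasDerivAt (fun s => (!₂[ε s 1, ε s 2, ε s 3] : E3) i)
        ((!₂[c 1, c 2, c 3] : E3) i) 0 := by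
      fin_cases i
      exacts [hε 1, hε 2, hε 3]
    refine (((hε 7).mul (hasDerivAt_eulerRotation hε h0 p.1.2 i)).add hk).congr_deriv ?_
    rw [hR, h7]
    simp [FieldData.field, FieldData.base, FieldData.ofCoeff]
  · simp only [groupMap, gradient_zero, add_zero]
    refine (((hε 7).mul hinv).mul (hasDerivAt_eulerRotation hε h0 p.2.1 i)).congr_deriv ?_
    simp only [hR, h7, h8]
    simp [FieldData.field, FieldData.fib, FieldData.ofCoeff, h7, h8]
    ring
  · refine (((((hε 7).pow 2).mul hinv2).mul_const p.2.2).add (hε 9)).congr_deriv ?_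
    simp [FieldData.field, FieldData.fib, FieldData.ofCoeff, h7, h8]
    exact Or.inl (by ring)

theorem hasDerivAt_groupMap_single (i : Fin 10) (p : Aug) :
    HasDerivAt (fun s : ℝ => groupMap (idParam + Pi.single i s) 0 p) (basisField i p) 0 := by
  rw [basisField_eq, gaugeField_zero, add_zero]
  refine hasDerivAt_groupMap (fun j => ?_) (by simp) p
  by_cases h : j = i
  · subst h
    simpa using (hasDerivAt_id (0 : ℝ)).const_add (idParam j)
  · simpa [h] using hasDerivAt_const (0 : ℝ) (idParam j)

end Parameters

end ChargedParticle

end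

/-! ### The equivalence group, the equivalence algebra and their tangency -/

theorem mainTheorem2 (I : Set ℝ) (D : Set E3)
    (hI : IsOpen I) (hIc : IsPreconnected I) (hIne : I.Nonempty)
    (hD : IsOpen D) (hDc : Convex ℝ D) (hDne : D.Nonempty) :
    -- the equivalence group
    (∀ Ψ : Aug → Aug, IsEquivalenceTransformation I D Ψ ↔
      ∃ (ε : Fin 10 → ℝ) (g : E3 → ℝ), ε 7 ≠ 0 ∧ ε 8 ≠ 0 ∧
        ContDiffOn ℝ ∞ g (spaceMap ε '' D) ∧ Set.EqOn Ψ (groupMap ε g) (augDomain I D)) ∧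
    -- the transformations of the whole space form a group
    (id ∈ transformations ∧
      (∀ Ψ ∈ transformations, ∀ Ψ' ∈ transformations, Ψ ∘ Ψ' ∈ transformations) ∧
      ∀ Ψ ∈ transformations, ∃ Ψ' ∈ transformations, Ψ ∘ Ψ' = id ∧ Ψ' ∘ Ψ = id) ∧
    -- the equivalence algebra
    (∀ V : Aug → Aug, IsEquivalenceGenerator I D V ↔
      ∃! c : Fin 10 → ℝ, ∃ f : E3 → ℝ, ContDiffOn ℝ ∞ f D ∧
        ∀ p ∈ augDomain I D, V p = ∑ i, c i • basisField i p + gaugeField f p) ∧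
    (∀ V W : Aug → Aug, IsEquivalenceGenerator I D V → IsEquivalenceGenerator I D W →
      IsEquivalenceGenerator I D (VectorField.lieBracket ℝ V W)) ∧
    -- its ten-dimensional subalgebra and its infinite-dimensional ideal
    LinearIndependent ℝ (fun i => (augDomain I D).domRestrict (basisField i)) ∧
    (∀ i j, ∃ c : Fin 10 → ℝ, ∀ p,
      VectorField.lieBracket ℝ (basisField i) (basisField j) p = ∑ k, c k • basisField k p) ∧
    (∃ f : ℕ → E3 → ℝ, (∀ n, ContDiffOn ℝ ∞ (f n) D) ∧
      LinearIndependent ℝ (fun n => (augDomain I D).domRestrict (gaugeField (f n)))) ∧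
    (∀ (V : Aug → Aug) (f : E3 → ℝ), IsEquivalenceGenerator I D V → ContDiffOn ℝ ∞ f D →
      ∃ h : E3 → ℝ, ContDiffOn ℝ ∞ h D ∧ Set.EqOn
        (VectorField.lieBracket ℝ V (gaugeField f)) (gaugeField h) (augDomain I D)) ∧
    -- the algebra is tangent to the group at the identity
    groupMap idParam 0 = id ∧
    (∀ i p, HasDerivAt (fun s : ℝ => groupMap (idParam + Pi.single i s) 0 p)
      (basisField i p) 0) ∧
    (∀ f : E3 → ℝ, ContDiffOn ℝ ∞ f D → ∀ p ∈ augDomain I D,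
      HasDerivAt (fun s : ℝ => groupMap idParam (s • f) p) (gaugeField f p) 0) :=
  ⟨isEquivalenceTransformation_iff hI hIc hIne hD hDc hDne,
    ⟨⟨idParam, 0, one_ne_zero, one_ne_zero, contDiff_const, groupMap_idParam.symm⟩,
      fun _ h _ h' => comp_mem_transformations h h',
      fun _ h => exists_inverse_mem_transformations h⟩,
    isEquivalenceGenerator_iff hI hIc hIne hD hDc hDne,
    fun _ _ => isEquivalenceGenerator_lieBracket hI hIc hIne hD hDc hDne,
    linearIndependent_basisField hI hIne hD hDne,
    exists_lieBracket_basisField,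
    ⟨fun n x => x 0 ^ (n + 1),
      fun n => (by fun_prop : ContDiff ℝ ∞ fun x : E3 => x 0 ^ (n + 1)).contDiffOn,
      linearIndependent_gaugeField hIne hD hDne⟩,
    fun _ _ hV hf => exists_lieBracket_gaugeField hI hIc hIne hD hDc hDne hV hf,
    groupMap_idParam,
    hasDerivAt_groupMap_single,
    fun _ hf _ hp => hasDerivAt_groupMap_gauge hD hf hp⟩
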